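/- Let $\mathcal R\subset\mathbb R^N$ be a (finite, possibly empty, not necessarily spanning) reduced root system, i.e. a finite set of vectors with $\|\alpha\|^2=2$, $-\alpha\in\mathcal R$, $\mathbb R\alpha\cap\mathcal R=\{\pm\alpha\}$ and $\sigma_\alpha(\mathcal R)=\mathcal R$ for all $\alpha\in\mathcal R$, where $\sigma_\alpha$ is the orthogonal reflection in $\alpha^\perp$. Let $G$ be the group generated by the $\sigma_\alpha$, and let $\mu:\mathcal R\to[0,\infty)$ be $G$-invariant. Let $$T_{\xi}f(x)=\partial_\xi f(x)+\tfrac12\sum_{\alpha\in\mathcal R}\mu(\alpha)\langle\alpha,\xi\rangle\frac{f(x)-f(\sigma_\alpha x)}{\langle\alpha,x\rangle}$$ be the Dunkl operators on $C^1(\mathbb R^N)$ (the quotient being extended continuously across $\langle\alpha,x\rangle=0$), and let $E_\mu:\mathbb C^N\times\mathbb C^N\to\mathbb C$ be the Dunkl kernel, i.e. the unique holomorphic function that is real-valued on $\mathbb R^N\times\mathbb R^N$ and satisfies there $T^x_\xi E_\mu(x,y)=\langle\xi,y\rangle E_\mu(x,y)$ and $E_\mu(0,y)=1$ for all $x,y,\xi\in\mathbb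 R^N$. Put $\gamma_\mu=\frac12\sum_{\alpha\in\mathcal R}\mu(\alpha)$, $\tilde\omega_{\mu,t}(x)=t^{-(\gamma_\mu+N/2)}\prod_{\alpha\in\mathcal R}|\langle\alpha,x\rangle|^{\mu(\alpha)}$, $c_\mu=\int_{\mathbb R^N}\tilde\omega_{\mu,1}(x)e^{-\|x\|^2/2}\,dx$ and $\omega_{\mu,t}=c_\mu^{-1}\tilde\omega_{\mu,t}$, and write $L^2(\omega_{\mu,t})=L^2(\mathbb R^N,\omega_{\mu,t}(x)\,dx)$ (complex-valued functions). For $t>0$ let $\mathcal B_{\mu,t}$ be the reproducing kernel Hilbert space of functions on $\mathbb C^N$ with reproducing kernel $\mathbb K_{\mu,t}(z,w)=E_\mu(z^*/t^{1/2},w/t^{1/2})$, where $z^*$ is the complex conjugate of $z$ and $w\mapsto\mathbb K_{\mu,t}(z,w)$ is the kernel function at $z$. With $z^2=\sum_j z_j^2$, let $$A_{\mu,t}\psi(z)=\int_{\mathbb R^N}A_{\mu,t}(z,q)\,\psi(q)\,\omega_{\mu,t}(q)\,dq,\qquad A_{\mu,t}(z,q)=e^{-z^2/2t-q^2/4t}\,E_\mu\!\left(\frac{z}{t^{1/2}},\frac{q}{t^{1/2}}\right)$$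 for $\psi\in L^2(\omega_{\mu,t})$ and $z\in\mathbb C^N$. For $\lambda>0$ let $\delta_\lambda\psi(x)=\psi(\lambda x)$ for functions $\psi$ on $\mathbb R^N$ and $D_\lambda f(z)=f(\lambda z)$ for functions $f$ on $\mathbb C^N$. **Theorem.** Let $s,t>0$. The integrals defining $A_{\mu,t}$ and $A_{\mu,s}$ converge absolutely, these formulas define bounded linear operators $$A_{\mu,t}:L^2(\omega_{\mu,t})\to\mathcal B_{\mu,t},\quad A_{\mu,s}:L^2(\omega_{\mu,s})\to\mathcal B_{\mu,s},\quad \delta_{(t/s)^{1/2}}:L^2(\omega_{\mu,t})\to L^2(\omega_{\mu,s}),\quad D_{(t/s)^{1/2}}:\mathcal B_{\mu,t}\to\mathcal B_{\mu,s},$$ and the diagram they form commutes: $$D_{(t/s)^{1/2}}\,A_{\mu,t}=A_{\mu,s}\,\delta_{(t/s)^{1/2}}\quad\text{as maps } L^2(\omega_{\mu,t})\to\mathcal B_{\mu,s}.$$ -/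

import Mathlib

open MeasureTheory
open scoped ComplexConjugate ENNReal

namespace Dunkl

/-- The configuration space `ℝᴺ`. -/
abbrev RSpace (N : ℕ) := EuclideanSpace ℝ (Fin N)

/-- The phase space `ℂᴺ`. -/
abbrev CSpace (N : ℕ) := EuclideanSpace ℂ (Fin N)

variable {N : ℕ}

/-- The inclusion of `ℝᴺ` into `ℂᴺ`. -/
noncomputable def toC (x : RSpace N) : CSpace N := WithLp.toLp 2 fun i => (x i : ℂ)

/-- Coordinatewise complex conjugation on `ℂᴺ`. -/
noncomputable def conjC (z : CSpace N) : CSpace N := WithLp.toLp 2 fun i => conj (z i)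

/-- The holomorphic function `z² = ∑ zⱼ²` on `ℂᴺ`. -/
noncomputable def sqC (z : CSpace N) : ℂ := ∑ i, z i ^ 2

/-- The orthogonal reflection `σ_α` in the hyperplane orthogonal to `α`. -/
noncomputable def rootRefl (α : RSpace N) : RSpace N ≃ₗᵢ[ℝ] RSpace N :=
  (Submodule.span ℝ {α})ᗮ.reflection

/-- Root systems in `ℝᴺ`, normalized by `‖α‖² = 2`. The empty set is allowed, and the roots need
not span. -/
structure IsRootSystem (R : Finset (RSpace N)) : Prop where
  ne_zero : ∀ α ∈ R, α ≠ 0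
  neg_mem : ∀ α ∈ R, -α ∈ R
  reduced : ∀ α ∈ R, ∀ r : ℝ, r • α ∈ R → r = 1 ∨ r = -1
  refl_image : ∀ α ∈ R, rootRefl α '' (R : Set (RSpace N)) = R
  norm_sq : ∀ α ∈ R, ‖α‖ ^ 2 = 2

/-- The Coxeter group generated by the reflections in the roots. -/
noncomputable def coxeterGroup (R : Finset (RSpace N)) : Subgroup (RSpace N ≃ₗᵢ[ℝ] RSpace N) :=
  Subgroup.closure {g | ∃ α ∈ R, g = rootRefl α}

/-- Non-negative multiplicity functions `μ : R → [0, ∞)`, invariant under the Coxeter group.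
The values of `μ` outside `R` are never used. -/
structure IsMultiplicity (R : Finset (RSpace N)) (μ : RSpace N → ℝ) : Prop where
  nonneg : ∀ α ∈ R, 0 ≤ μ α
  invariant : ∀ g ∈ coxeterGroup R, ∀ α ∈ R, μ (g α) = μ α

open Classical in
/-- The quotient `(f x - f (σ_α x)) / ⟨α, x⟩` for a `C¹` function `f`. On the hyperplane
`⟨α, x⟩ = 0` its value is the one of the continuous extension,
the limit being `(2 / ‖α‖²) ∂_α f x`. -/
noncomputable def diffQuot (α : RSpace N) (f : RSpace N → ℂ) (x : RSpace N) : ℂ :=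
  if inner ℝ α x = 0 then ((2 / ‖α‖ ^ 2 : ℝ) : ℂ) * fderiv ℝ f x α
  else (f x - f (rootRefl α x)) / ((inner ℝ α x : ℝ) : ℂ)

/-- The Dunkl operator `T_{ξ,μ}` on `C¹` functions. -/
noncomputable def dunklOp (R : Finset (RSpace N)) (μ : RSpace N → ℝ) (ξ : RSpace N)
    (f : RSpace N → ℂ) (x : RSpace N) : ℂ :=
  fderiv ℝ f x ξ +
    (1 / 2) * ∑ α ∈ R, (μ α : ℂ) * ((inner ℝ α ξ : ℝ) : ℂ) * diffQuot α f x

/-- `E` is the Dunkl kernel: it is holomorphic on `ℂᴺ × ℂᴺ`, and its restriction to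
`ℝᴺ × ℝᴺ` is real valued and solves `T^x_ξ E(x,y) = ⟨ξ,y⟩ E(x,y)`, `E(0,y) = 1`. -/
structure IsDunklKernel (R : Finset (RSpace N)) (μ : RSpace N → ℝ)
    (E : CSpace N → CSpace N → ℂ) : Prop where
  holomorphic : Differentiable ℂ fun p : CSpace N × CSpace N => E p.1 p.2
  real_valued : ∀ x y : RSpace N, (E (toC x) (toC y)).im = 0
  eigen : ∀ x y ξ : RSpace N,
    dunklOp R μ ξ (fun x' => E (toC x') (toC y)) x
      = ((inner ℝ ξ y : ℝ) : ℂ) * E (toC x) (toC y)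
  normalized : ∀ y : RSpace N, E 0 (toC y) = 1

open Classical in
/-- The Dunkl kernel function `E_μ : ℂᴺ × ℂᴺ → ℂ`, the unique function with `IsDunklKernel`.
(For a root system and `μ ≥ 0` it exists; the `else` branch only makes the definition total.) -/
noncomputable def dunklKernel (R : Finset (RSpace N)) (μ : RSpace N → ℝ) :
    CSpace N → CSpace N → ℂ :=
  if h : ∃ E, IsDunklKernel R μ E then h.choose else 0

/-- `γ_μ = ½ ∑_{α ∈ R} μ(α)`. -/
noncomputable def gammaConst (R : Finset (RSpace N)) (μ : RSpace N → ℝ) : ℝ :=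
  (1 / 2) * ∑ α ∈ R, μ α

/-- The unnormalized weight `t^{-(γ_μ + N/2)} ∏_{α ∈ R} |⟨α, x⟩|^{μ(α)}`. -/
noncomputable def weightTilde (R : Finset (RSpace N)) (μ : RSpace N → ℝ) (t : ℝ)
    (x : RSpace N) : ℝ :=
  t ^ (-(gammaConst R μ + (N : ℝ) / 2)) * ∏ α ∈ R, |(inner ℝ α x : ℝ)| ^ μ α

/-- The Macdonald-Mehta-Selberg constant `c_μ`. -/
noncomputable def mmsConst (R : Finset (RSpace N)) (μ : RSpace N → ℝ) : ℝ :=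
  ∫ x : RSpace N, weightTilde R μ 1 x * Real.exp (-‖x‖ ^ 2 / 2)

/-- The weight function `ω_{μ,t}`. -/
noncomputable def weight (R : Finset (RSpace N)) (μ : RSpace N → ℝ) (t : ℝ)
    (x : RSpace N) : ℝ :=
  (mmsConst R μ)⁻¹ * weightTilde R μ t x

/-- The measure `dω_{μ,t}(x) = ω_{μ,t}(x) dᴺx` on `ℝᴺ`. -/
noncomputable def weightMeasure (R : Finset (RSpace N)) (μ : RSpace N → ℝ) (t : ℝ) :
    Measure (RSpace N) :=
  volume.withDensity fun x => ENNReal.ofReal (weight R μ t x)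

/-- The Hilbert space `L²(ω_{μ,t})`. -/
noncomputable abbrev L2Weight (R : Finset (RSpace N)) (μ : RSpace N → ℝ) (t : ℝ) :=
  Lp ℂ 2 (weightMeasure R μ t)

/-- The kernel `𝕂_{μ,t}(z,w) = E_μ(z* / t^{1/2}, w / t^{1/2})`. -/
noncomputable def sbKernel (R : Finset (RSpace N)) (μ : RSpace N → ℝ) (t : ℝ)
    (z w : CSpace N) : ℂ :=
  dunklKernel R μ (((Real.sqrt t)⁻¹ : ℂ) • conjC z) (((Real.sqrt t)⁻¹ : ℂ) • w)

/-- The kernel `𝕂_{μ,t}` in the form used for Mathlib's reproducing kernel Hilbert spaces: the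
entry at `(w, z)` is (multiplication by) `𝕂_{μ,t}(z,w)`, so that `w ↦ 𝕂_{μ,t}(z,w)` is the
kernel function at the point `z`. -/
noncomputable def sbMatrix (R : Finset (RSpace N)) (μ : RSpace N → ℝ) (t : ℝ) :
    Matrix (CSpace N) (CSpace N) (ℂ →L[ℂ] ℂ) :=
  Matrix.of fun w z => sbKernel R μ t z w • ContinuousLinearMap.id ℂ ℂ

open Classical in
/-- `sbMatrix`, made total. (For a root system, `μ ≥ 0` and `t > 0` the kernel `𝕂_{μ,t}` is
positive semidefinite, so that this is `sbMatrix`.) -/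
noncomputable def sbMatrixTotal (R : Finset (RSpace N)) (μ : RSpace N → ℝ) (t : ℝ) :
    Matrix (CSpace N) (CSpace N) (ℂ →L[ℂ] ℂ) :=
  if (sbMatrix R μ t).PosSemidef then sbMatrix R μ t else 0

instance factPosSemidef (R : Finset (RSpace N)) (μ : RSpace N → ℝ) (t : ℝ) :
    Fact (sbMatrixTotal R μ t).PosSemidef := by
  constructor
  unfold sbMatrixTotal
  split_ifs with h
  · exact h
  · exact Matrix.PosSemidef.zero

/-- The Segal-Bargmann space `𝓑_{μ,t}`: the Hilbert space of functions on `ℂᴺ` with reproducing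
kernel `𝕂_{μ,t}`. -/
noncomputable def SegalBargmann (R : Finset (RSpace N)) (μ : RSpace N → ℝ) (t : ℝ) : Type :=
  RKHS.OfKernel (sbMatrixTotal R μ t)

noncomputable instance (R : Finset (RSpace N)) (μ : RSpace N → ℝ) (t : ℝ) :
    NormedAddCommGroup (SegalBargmann R μ t) :=
  inferInstanceAs (NormedAddCommGroup (RKHS.OfKernel (sbMatrixTotal R μ t)))

noncomputable instance (R : Finset (RSpace N)) (μ : RSpace N → ℝ) (t : ℝ) :
    InnerProductSpace ℂ (SegalBargmann R μ t) :=
  inferInstanceAs (InnerProductSpace ℂ (RKHS.OfKernel (sbMatrixTotal R μ t)))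

instance (R : Finset (RSpace N)) (μ : RSpace N → ℝ) (t : ℝ) :
    CompleteSpace (SegalBargmann R μ t) :=
  inferInstanceAs (CompleteSpace (RKHS.OfKernel (sbMatrixTotal R μ t)))

/-- The elements of `𝓑_{μ,t}` are functions `ℂᴺ → ℂ`. -/
noncomputable instance (R : Finset (RSpace N)) (μ : RSpace N → ℝ) (t : ℝ) :
    RKHS ℂ (SegalBargmann R μ t) (CSpace N) ℂ :=
  inferInstanceAs (RKHS ℂ (RKHS.OfKernel (sbMatrixTotal R μ t)) (CSpace N) ℂ)

/-- The reproducing kernel of `𝓑_{μ,t}`. -/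
theorem kernel_segalBargmann (R : Finset (RSpace N)) (μ : RSpace N → ℝ) (t : ℝ) :
    RKHS.kernel (SegalBargmann R μ t) = sbMatrixTotal R μ t :=
  RKHS.OfKernel.kernel_ofKernel (K := sbMatrixTotal R μ t)

/-- The integral kernel
`A_{μ,t}(z,q) = exp(-z²/2t - q²/4t) E_μ(z / t^{1/2}, q / t^{1/2})`. -/
noncomputable def kernelA (R : Finset (RSpace N)) (μ : RSpace N → ℝ) (t : ℝ)
    (z : CSpace N) (q : RSpace N) : ℂ :=
  Complex.exp (-sqC z / (2 * t) - (‖q‖ : ℂ) ^ 2 / (4 * t)) *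
    dunklKernel R μ (((Real.sqrt t)⁻¹ : ℂ) • z) (((Real.sqrt t)⁻¹ : ℂ) • toC q)

/-- The Version A Segal-Bargmann transform
`A_{μ,t} ψ (z) = ∫ A_{μ,t}(z,q) ψ(q) dω_{μ,t}(q)`. -/
noncomputable def transformA (R : Finset (RSpace N)) (μ : RSpace N → ℝ) (t : ℝ)
    (ψ : RSpace N → ℂ) (z : CSpace N) : ℂ :=
  ∫ q, kernelA R μ t z q * ψ q ∂(weightMeasure R μ t)

/-- The dilation operator `δ_c ψ (x) = ψ(c x)` on functions on `ℝᴺ`. -/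
def dilReal (c : ℝ) (ψ : RSpace N → ℂ) (x : RSpace N) : ℂ := ψ (c • x)

/-- The dilation operator `D_c f (z) = f(c z)` on functions on `ℂᴺ`. -/
def dilComplex (c : ℂ) (f : CSpace N → ℂ) (z : CSpace N) : ℂ := f (c • z)

end Dunkl

/-! The commutation is a change of variables. With c = √(t/s), so t = c²s, the map x ↦ cx carries
ω_{μ,s}dx to ω_{μ,t}dx (`measurePreserving_smul`), since the product of root powers is homogeneous
of degree 2γ_μ, and A_{μ,t}(cz,cq) = A_{μ,s}(z,q) (`kernelA_smul`). The real work is to show that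
the objects exist and that the arrows are bounded.

Boundedness of A_{μ,t} comes from a Gram matrix. If the functions conj A_{μ,t}(z,·) have in L² the
same inner products as the kernel functions of 𝓑_{μ,t}, then the linear map between them is
isometric on spans, and its adjoint is the transform (`exists_clm_of_gram`). The same principle
gives D, and writing the kernel as a Gram matrix also proves that it is positive semidefinite. For t
= 1 the Gram computation is the Gaussian identity `gaussPairing_eq`: ∫
E(q,z)E(q,w)e^{-q²/2}∏|⟨α,q⟩|^{μ(α)}dq = c_μ e^{(z²+w²)/2}E(z,w).

Everything about E rests on one equation and one estimate. The direction ξ = x in the eigenvalue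
equation removes all denominators and leaves an Euler equation along complex lines. The operator n +
½∑μ(α)(1-σ_α), n > 0, obeys a maximum principle (`norm_le_of_reflection_equation`). Applied to
Taylor coefficients this gives |f(z)| ≤ |f(0)|e^{‖z‖‖w‖} for solutions with spectral parameter w,
hence uniqueness given f(0) (`IsEulerSolution.eq_of_zero`). Homogeneity, reflection invariance,
symmetry and conjugation symmetry of E follow by comparing two solutions. So does the Gaussian
identity: e^{-w²/2} times the pairing solves the Euler equation in w, by antisymmetry of the Dunkl
operators for the weight (`integral_dunklOp_mul`). Antisymmetry is integration by parts with each
|⟨α,x⟩|^{μ(α)} replaced by (⟨α,x⟩²+ε)^{μ(α)/2}, followed by ε → 0.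

Existence of E (`exists_isDunklKernel`) reuses the maximum principle. It makes the radial equation
solvable degree by degree on finite-dimensional spaces of polynomials and bounds the terms by those
of an exponential series. A further application, to pairs (x,ξ), with commutativity of the Dunkl
operators, recovers the equations for all ξ from the radial one (`dunklOp_eq_of_radial`). -/

namespace Dunkl

variable {N : ℕ}

/-! ### The bilinear form, conjugation and complexified reflections -/

/-- The complex bilinear extension `∑ᵢ zᵢ wᵢ` of the Euclidean inner product. -/
noncomputable def bilin (z : CSpace N) : CSpace N →L[ℂ] ℂ := ∑ i, z i • EuclideanSpace.proj i

lemma bilin_apply (z w : CSpace N) : bilin z w = ∑ i, z i * w i := by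
  simp [bilin]

lemma bilin_comm (z w : CSpace N) : bilin z w = bilin w z := by
  simp [bilin_apply, mul_comm]

lemma bilin_add_left (z z' w : CSpace N) : bilin (z + z') w = bilin z w + bilin z' w := by
  rw [bilin_comm, map_add, bilin_comm w, bilin_comm w]

lemma bilin_smul_left (c : ℂ) (z w : CSpace N) : bilin (c • z) w = c * bilin z w := by
  rw [bilin_comm, map_smul, bilin_comm w, smul_eq_mul]

lemma bilin_sub_left (z z' w : CSpace N) : bilin (z - z') w = bilin z w - bilin z' w := by
  rw [bilin_comm, map_sub, bilin_comm w, bilin_comm w]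

@[simp] lemma toC_apply (x : RSpace N) (i : Fin N) : toC x i = (x i : ℂ) := rfl

@[simp] lemma conjC_apply (z : CSpace N) (i : Fin N) : conjC z i = conj (z i) := rfl

lemma toC_add (x y : RSpace N) : toC (x + y) = toC x + toC y := by ext; simp
lemma toC_sub (x y : RSpace N) : toC (x - y) = toC x - toC y := by ext; simp
lemma toC_smul (c : ℝ) (x : RSpace N) : toC (c • x) = (c : ℂ) • toC x := by ext; simp

@[simp] lemma conjC_toC (x : RSpace N) : conjC (toC x) = toC x := by ext; simp
@[simp] lemma conjC_conjC (z : CSpace N) : conjC (conjC z) = z := by ext; simp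
lemma conjC_smul (c : ℂ) (z : CSpace N) : conjC (c • z) = conj c • conjC z := by ext; simp
lemma conjC_sub (z w : CSpace N) : conjC (z - w) = conjC z - conjC w := by ext; simp
@[simp] lemma conjC_zero : conjC (0 : CSpace N) = 0 := by ext; simp

/-- `toC` as a continuous real-linear map. -/
noncomputable def toCL : RSpace N →L[ℝ] CSpace N :=
  LinearMap.toContinuousLinearMap
    { toFun := toC, map_add' := toC_add, map_smul' := fun c x => by simp [toC_smul] }

@[simp] lemma toCL_apply (x : RSpace N) : toCL x = toC x := rfl

@[simp] lemma norm_toC (x : RSpace N) : ‖toC x‖ = ‖x‖ := by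
  simp [EuclideanSpace.norm_eq]

@[simp] lemma norm_conjC (z : CSpace N) : ‖conjC z‖ = ‖z‖ := by
  simp [EuclideanSpace.norm_eq]

lemma bilin_toC (x y : RSpace N) : bilin (toC x) (toC y) = ((inner ℝ x y : ℝ) : ℂ) := by
  simp [bilin_apply, PiLp.inner_apply, mul_comm]

lemma bilin_eq_inner (z w : CSpace N) : bilin z w = inner ℂ (conjC z) w := by
  simp [bilin_apply, PiLp.inner_apply, mul_comm]

lemma norm_bilin_le (z w : CSpace N) : ‖bilin z w‖ ≤ ‖z‖ * ‖w‖ := by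
  rw [bilin_eq_inner]
  simpa using norm_inner_le_norm (𝕜 := ℂ) (conjC z) w

lemma conj_bilin (z w : CSpace N) : conj (bilin z w) = bilin (conjC z) (conjC w) := by
  simp [bilin_apply]

lemma bilin_conjC_self (z : CSpace N) : bilin (conjC z) z = (‖z‖ : ℂ) ^ 2 := by
  rw [bilin_eq_inner, conjC_conjC, inner_self_eq_norm_sq_to_K]; rfl

/-- Every complex vector is of the form `x + i y` with `x` and `y` real. -/
lemma exists_toC_add (z : CSpace N) : ∃ x y : RSpace N, z = toC x + Complex.I • toC y := by
  refine ⟨WithLp.toLp 2 fun i => (z i).re, WithLp.toLp 2 fun i => (z i).im, ?_⟩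
  ext i
  simp [mul_comm Complex.I, Complex.re_add_im]

/-- The complexified reflection, for roots normalized by `‖α‖² = 2`. -/
noncomputable def reflC (α : RSpace N) : CSpace N →L[ℂ] CSpace N :=
  ContinuousLinearMap.id ℂ _ - (bilin (toC α)).smulRight (toC α)

lemma reflC_apply (α : RSpace N) (z : CSpace N) : reflC α z = z - bilin (toC α) z • toC α := by
  simp [reflC]

lemma rootRefl_apply {α : RSpace N} (hα : ‖α‖ ^ 2 = 2) (x : RSpace N) :
    rootRefl α x = x - (inner ℝ α x : ℝ) • α := by
  rw [rootRefl, Submodule.reflection_orthogonal_apply, Submodule.reflection_singleton_apply]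
  simp only [RCLike.ofReal_real_eq_id, id, hα]
  rw [← Nat.cast_smul_eq_nsmul ℝ, smul_smul]
  rw [neg_sub, Nat.cast_ofNat, mul_div_cancel₀ _ (two_ne_zero' ℝ)]

lemma toC_rootRefl {α : RSpace N} (hα : ‖α‖ ^ 2 = 2) (x : RSpace N) :
    toC (rootRefl α x) = reflC α (toC x) := by
  rw [rootRefl_apply hα, reflC_apply, toC_sub, toC_smul, bilin_toC]

lemma bilin_self_of_norm_sq {α : RSpace N} (hα : ‖α‖ ^ 2 = 2) : bilin (toC α) (toC α) = 2 := by
  rw [bilin_toC, real_inner_self_eq_norm_sq, hα]; norm_num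

lemma bilin_reflC_reflC {α : RSpace N} (hα : ‖α‖ ^ 2 = 2) (z w : CSpace N) :
    bilin (reflC α z) (reflC α w) = bilin z w := by
  simp only [reflC_apply, map_sub, map_smul, bilin_sub_left, bilin_smul_left, smul_eq_mul,
    bilin_self_of_norm_sq hα, bilin_comm z (toC α)]
  ring

lemma reflC_reflC {α : RSpace N} (hα : ‖α‖ ^ 2 = 2) (z : CSpace N) :
    reflC α (reflC α z) = z := by
  simp only [reflC_apply, map_sub, map_smul, bilin_self_of_norm_sq hα]
  module

lemma conjC_reflC (α : RSpace N) (z : CSpace N) : conjC (reflC α z) = reflC α (conjC z) := by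
  simp [reflC_apply, conjC_sub, conjC_smul, conj_bilin]

lemma norm_reflC {α : RSpace N} (hα : ‖α‖ ^ 2 = 2) (z : CSpace N) : ‖reflC α z‖ = ‖z‖ := by
  have h : (‖reflC α z‖ : ℂ) ^ 2 = (‖z‖ : ℂ) ^ 2 := by
    rw [← bilin_conjC_self, conjC_reflC, bilin_reflC_reflC hα, bilin_conjC_self]
  have h' : ‖reflC α z‖ ^ 2 = ‖z‖ ^ 2 := by exact_mod_cast h
  exact (sq_eq_sq₀ (norm_nonneg _) (norm_nonneg _)).1 h'

/-- This is the conjugation rule σ_{σ_βα} = σ_β σ_α σ_β. It makes sums over roots equivariant once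
they are reindexed by σ_β. -/
lemma reflC_comp_reflC {α β : RSpace N} (hβ : ‖β‖ ^ 2 = 2) (z : CSpace N) :
    reflC (rootRefl β α) (reflC β z) = reflC β (reflC α z) := by
  simp only [reflC_apply _ (reflC β z), toC_rootRefl hβ, bilin_reflC_reflC hβ]
  rw [reflC_apply α z, map_sub, map_smul]

lemma rootRefl_involutive (α : RSpace N) (x : RSpace N) : rootRefl α (rootRefl α x) = x :=
  Submodule.reflection_reflection _ x

/-! ### The maximum principle and the Euler equation along complex lines -/

section RootSystem

variable {R : Finset (RSpace N)} {μ : RSpace N → ℝ}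

lemma IsRootSystem.rootRefl_mem (hR : IsRootSystem R) {α β : RSpace N} (hβ : β ∈ R)
    (hα : α ∈ R) : rootRefl β α ∈ R := by
  have h := hR.refl_image β hβ
  exact_mod_cast h ▸ Set.mem_image_of_mem (rootRefl β) (Finset.mem_coe.2 hα)

lemma IsMultiplicity.rootRefl_eq (hμ : IsMultiplicity R μ) {α β : RSpace N} (hβ : β ∈ R)
    (hα : α ∈ R) : μ (rootRefl β α) = μ α :=
  hμ.invariant _ (Subgroup.subset_closure ⟨β, hβ, rfl⟩) α hα

/-- Sums over the roots may be reindexed by a reflection. -/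
lemma sum_rootRefl {M : Type*} [AddCommMonoid M] (hR : IsRootSystem R) {β : RSpace N}
    (hβ : β ∈ R) (f : RSpace N → M) : ∑ α ∈ R, f (rootRefl β α) = ∑ α ∈ R, f α :=
  Finset.sum_nbij' (rootRefl β) (rootRefl β) (fun _ h => hR.rootRefl_mem hβ h)
    (fun _ h => hR.rootRefl_mem hβ h) (fun _ _ => rootRefl_involutive β _)
    (fun _ _ => rootRefl_involutive β _) (fun _ _ => rfl)

/-- A maximum principle for the operators `n + ½ ∑ μ(α) (1 - σ_α)`, `n > 0`. -/
lemma norm_le_of_reflection_equation {X : Type*} (hμ : IsMultiplicity R μ)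
    (σ : RSpace N → X → X) (S : Set X) (hσ : ∀ α ∈ R, ∀ x ∈ S, σ α x ∈ S) (f : X → ℂ) {B : ℝ}
    (hB : ∀ x ∈ S, ‖f x‖ ≤ B) {n : ℝ} (hn : 0 < n) {C : ℝ}
    (h : ∀ x ∈ S, ‖n * f x + (1 / 2) * ∑ α ∈ R, (μ α : ℂ) * (f x - f (σ α x))‖ ≤ n * C) :
    ∀ x ∈ S, ‖f x‖ ≤ C := by
  intro x₀ hx₀
  set M := sSup ((fun x => ‖f x‖) '' S) with hM
  have hbdd : BddAbove ((fun x => ‖f x‖) '' S) := ⟨B, by rintro _ ⟨x, hx, rfl⟩; exact hB x hx⟩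
  have hle : ∀ x ∈ S, ‖f x‖ ≤ M := fun x hx => le_csSup hbdd ⟨x, hx, rfl⟩
  set γ : ℝ := (1 / 2) * ∑ α ∈ R, μ α with hγ
  have hγ0 : 0 ≤ γ := mul_nonneg (by norm_num) (Finset.sum_nonneg fun α hα => hμ.nonneg α hα)
  have key : ∀ x ∈ S, ‖f x‖ ≤ (n * C + γ * M) / (n + γ) := by
    intro x hx
    rw [le_div_iff₀ (by positivity)]
    -- Moving the reflected terms to the right leaves (n+γ)f(x). Hence M ≤ (nC+γM)/(n+γ) for the
    -- supremum M, which need not be attained; the γM cancels because M is finite, and n > 0 allows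
    -- division.
    have e : ((n + γ : ℝ) : ℂ) * f x =
        (n * f x + (1 / 2) * ∑ α ∈ R, (μ α : ℂ) * (f x - f (σ α x))) +
          (1 / 2) * ∑ α ∈ R, (μ α : ℂ) * f (σ α x) := by
      simp only [mul_sub, Finset.sum_sub_distrib, hγ, ← Finset.sum_mul]
      push_cast
      ring
    have e2 : ‖(1 / 2 : ℂ) * ∑ α ∈ R, (μ α : ℂ) * f (σ α x)‖ ≤ γ * M := by
      rw [norm_mul, hγ, mul_assoc, Finset.sum_mul]
      norm_num
      refine (norm_sum_le _ _).trans (Finset.sum_le_sum fun α hα => ?_)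
      rw [norm_mul, Complex.norm_real, Real.norm_of_nonneg (hμ.nonneg α hα)]
      exact mul_le_mul_of_nonneg_left (hle _ (hσ α hα x hx)) (hμ.nonneg α hα)
    have e3 : ‖((n + γ : ℝ) : ℂ) * f x‖ = ‖f x‖ * (n + γ) := by
      rw [norm_mul, Complex.norm_real, Real.norm_of_nonneg (by positivity), mul_comm]
    rw [← e3, e]
    exact (norm_add_le _ _).trans (add_le_add (h x hx) e2)
  have hMle : M ≤ (n * C + γ * M) / (n + γ) :=
    csSup_le ⟨_, x₀, hx₀, rfl⟩ (by rintro _ ⟨x, hx, rfl⟩; exact key x hx)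
  rw [le_div_iff₀ (by positivity)] at hMle
  have : n * M ≤ n * C := by linarith
  exact (hle x₀ hx₀).trans (le_of_mul_le_mul_left this hn)

/-- Leibniz' rule, meant for x = 0: there the first term drops out, and multiplication by the
variable shifts Taylor coefficients. -/
lemma iteratedDeriv_id_mul {g : ℂ → ℂ} (hg : Differentiable ℂ g) (n : ℕ) (x : ℂ) :
    iteratedDeriv (n + 1) (fun y => y * g y) x =
      x * iteratedDeriv (n + 1) g x + (n + 1) * iteratedDeriv n g x := by
  have hd : ∀ m, Differentiable ℂ (iteratedDeriv m g) := fun m =>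
    (hg.contDiff (n := ⊤)).differentiable_iteratedDeriv m (WithTop.coe_lt_top _)
  induction n generalizing x with
  | zero =>
    simp only [zero_add, iteratedDeriv_one, iteratedDeriv_zero]
    rw [deriv_fun_mul differentiableAt_fun_id (hg x)]
    simp [add_comm]
  | succ n ih =>
    rw [iteratedDeriv_succ, show iteratedDeriv (n + 1) (fun y => y * g y) = _ from funext ih]
    rw [deriv_fun_add (differentiableAt_fun_id.fun_mul (hd _ _)) ((hd _ _).const_mul _),
      deriv_fun_mul differentiableAt_fun_id (hd _ _), deriv_const_mul _ (hd _ _),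
      iteratedDeriv_succ (n := n + 1), iteratedDeriv_succ (n := n)]
    simp
    ring

/-- The radial (Euler) form of the eigenvalue equation of the Dunkl operators, on the complex
lines through the origin. -/
structure IsEulerSolution (R : Finset (RSpace N)) (μ : RSpace N → ℝ) (w : CSpace N)
    (f : CSpace N → ℂ) : Prop where
  differentiable : ∀ z, Differentiable ℂ fun l : ℂ => f (l • z)
  equation : ∀ z (l : ℂ), l * deriv (fun l : ℂ => f (l • z)) l +
    (1 / 2) * ∑ α ∈ R, (μ α : ℂ) * (f (l • z) - f (l • reflC α z)) = l * bilin z w * f (l • z)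
  bounded : ∀ r : ℝ, ∃ C, ∀ z, ‖z‖ ≤ r → ‖f z‖ ≤ C

/-- Differentiating the Euler equation n+1 times at l = 0 expresses (n+1 + ½∑μ(α)(1-σ_α)) applied to
the derivative of order n+1 as (n+1)⟨z,w⟩ times the derivative of order n. The maximum principle on
the sphere through z cancels the factor n+1, so each order costs exactly ‖z‖‖w‖. -/
lemma IsEulerSolution.norm_iteratedDeriv_le (hR : IsRootSystem R) (hμ : IsMultiplicity R μ)
    {w : CSpace N} {f : CSpace N → ℂ} (hf : IsEulerSolution R μ w f) (n : ℕ) (z : CSpace N) :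
    ‖iteratedDeriv n (fun l : ℂ => f (l • z)) 0‖ ≤ (‖z‖ * ‖w‖) ^ n * ‖f 0‖ := by
  induction n generalizing z with
  | zero => simp
  | succ n ih =>
    have hcd : ∀ z, ContDiff ℂ ⊤ fun l : ℂ => f (l • z) := fun z => (hf.differentiable z).contDiff
    obtain ⟨B, hB⟩ := hf.bounded ‖z‖
    refine norm_le_of_reflection_equation hμ (fun α z => reflC α z) {y | ‖y‖ = ‖z‖}
      (fun α hα y hy => (norm_reflC (hR.norm_sq α hα) y).trans hy)
      (fun z => iteratedDeriv (n + 1) (fun l : ℂ => f (l • z)) 0) (B := (n + 1).factorial * B)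
      ?_ (n := n + 1) (by positivity) ?_ z rfl
    -- The maximum principle needs some a priori bound on the sphere. Cauchy's estimate on |l| = 1
    -- supplies it, since there l•y stays in the ball of radius ‖z‖.
    · intro y hy
      have := Complex.norm_iteratedDeriv_le_of_forall_mem_sphere_norm_le (n + 1) one_pos
        (hf.differentiable y).diffContOnCl (c := 0) (C := B) (fun l hl => hB _ (by
          have : ‖l‖ = 1 := by simpa using hl
          rw [norm_smul, this, one_mul]; exact hy.le))
      simpa using this
    · intro y hy
      have e := congrArg (fun g => iteratedDeriv (n + 1) g 0) (funext (hf.equation y))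
      have h1 : ContDiffAt ℂ (n + 1 : ℕ)
          (fun l => l * deriv (fun l : ℂ => f (l • y)) l) 0 :=
        (contDiffAt_id.mul ((hf.differentiable y).deriv.contDiff.contDiffAt))
      have h2 : ∀ α ∈ R, ContDiffAt ℂ (n + 1 : ℕ)
          (fun l : ℂ => (μ α : ℂ) * (f (l • y) - f (l • reflC α y))) 0 := fun α _ =>
        (contDiffAt_const.mul (((hcd y).of_le le_top).contDiffAt.sub
          ((hcd _).of_le le_top).contDiffAt))
      have h3 : ContDiffAt ℂ (n + 1 : ℕ) (fun l : ℂ =>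
          ∑ α ∈ R, (μ α : ℂ) * (f (l • y) - f (l • reflC α y))) 0 := ContDiffAt.sum h2
      rw [iteratedDeriv_fun_add h1 (contDiffAt_const.mul h3),
        iteratedDeriv_const_mul_field, iteratedDeriv_fun_sum h2,
        iteratedDeriv_id_mul (hf.differentiable y).deriv] at e
      have e3 : (fun l : ℂ => l * bilin y w * f (l • y)) =
          fun l : ℂ => bilin y w * (l * f (l • y)) := by ext; ring
      rw [e3, iteratedDeriv_const_mul_field, iteratedDeriv_id_mul (hf.differentiable y)] at e
      simp only [iteratedDeriv_const_mul_field] at e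
      have e4 : ∀ α, iteratedDeriv (n + 1) (fun l : ℂ => f (l • y) - f (l • reflC α y)) 0 =
          iteratedDeriv (n + 1) (fun l : ℂ => f (l • y)) 0 -
            iteratedDeriv (n + 1) (fun l : ℂ => f (l • reflC α y)) 0 := fun α =>
        iteratedDeriv_fun_sub ((hcd y).of_le le_top).contDiffAt ((hcd _).of_le le_top).contDiffAt
      simp only [e4, zero_mul, zero_add, ← iteratedDeriv_succ'] at e
      push_cast
      rw [e, norm_mul, norm_mul]
      have hn : ‖(n + 1 : ℂ)‖ = n + 1 := by exact_mod_cast Complex.norm_natCast (n + 1)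
      rw [hn]
      have hy' : ‖y‖ = ‖z‖ := hy
      calc ‖bilin y w‖ * ((n + 1) * ‖iteratedDeriv n (fun l : ℂ => f (l • y)) 0‖)
          ≤ (‖y‖ * ‖w‖) * ((n + 1) * ((‖y‖ * ‖w‖) ^ n * ‖f 0‖)) := by
            gcongr
            · exact norm_bilin_le y w
            · exact ih y
        _ = (n + 1) * ((‖z‖ * ‖w‖) ^ (n + 1) * ‖f 0‖) := by rw [hy']; ring

/-- Solutions of the Euler equation grow at most exponentially. -/
lemma IsEulerSolution.norm_le (hR : IsRootSystem R) (hμ : IsMultiplicity R μ)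
    {w : CSpace N} {f : CSpace N → ℂ} (hf : IsEulerSolution R μ w f) (z : CSpace N) :
    ‖f z‖ ≤ ‖f 0‖ * Real.exp (‖z‖ * ‖w‖) := by
  have h := Complex.hasSum_taylorSeries_of_entire (hf.differentiable z) 0 1
  have h2 := (NormedSpace.expSeries_div_hasSum_exp (𝔸 := ℝ) (‖z‖ * ‖w‖)).mul_left ‖f 0‖
  rw [← Real.exp_eq_exp_ℝ] at h2
  have h3 := h.norm_le_of_bounded h2 (fun n => ?_)
  · simpa using h3
  · simp only [sub_zero, one_pow, one_smul, norm_smul, norm_inv, Complex.norm_natCast]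
    calc ((n.factorial : ℝ))⁻¹ * ‖iteratedDeriv n (fun l : ℂ => f (l • z)) 0‖
        ≤ ((n.factorial : ℝ))⁻¹ * ((‖z‖ * ‖w‖) ^ n * ‖f 0‖) := by
          gcongr; exact hf.norm_iteratedDeriv_le hR hμ n z
      _ = _ := by ring

lemma IsEulerSolution.sub {w : CSpace N} {f g : CSpace N → ℂ}
    (hf : IsEulerSolution R μ w f) (hg : IsEulerSolution R μ w g) :
    IsEulerSolution R μ w (fun z => f z - g z) where
  differentiable z := (hf.differentiable z).sub (hg.differentiable z)
  equation z l := by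
    rw [deriv_fun_sub (hf.differentiable z l) (hg.differentiable z l)]
    have h1 := hf.equation z l
    have h2 := hg.equation z l
    simp only [mul_sub, Finset.sum_sub_distrib] at h1 h2 ⊢
    linear_combination h1 - h2
  bounded r := by
    obtain ⟨C, hC⟩ := hf.bounded r
    obtain ⟨D, hD⟩ := hg.bounded r
    exact ⟨C + D, fun z hz => (norm_sub_le _ _).trans (add_le_add (hC z hz) (hD z hz))⟩

lemma IsEulerSolution.const_mul {w : CSpace N} {f : CSpace N → ℂ}
    (hf : IsEulerSolution R μ w f) (c : ℂ) : IsEulerSolution R μ w (fun z => c * f z) where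
  differentiable z := (hf.differentiable z).const_mul c
  equation z l := by
    rw [deriv_const_mul _ (hf.differentiable z l)]
    simp only [← mul_sub, mul_left_comm _ c, ← Finset.mul_sum, ← mul_add]
    rw [hf.equation z l]
  bounded r := by
    obtain ⟨C, hC⟩ := hf.bounded r
    exact ⟨‖c‖ * C, fun z hz => by rw [norm_mul]; gcongr; exact hC z hz⟩

/-- A solution of the Euler equation is determined by its value at the origin. -/
lemma IsEulerSolution.eq_of_zero (hR : IsRootSystem R) (hμ : IsMultiplicity R μ)
    {w : CSpace N} {f g : CSpace N → ℂ} (hf : IsEulerSolution R μ w f)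
    (hg : IsEulerSolution R μ w g) (h0 : f 0 = g 0) : f = g := by
  ext z
  have := (hf.sub hg).norm_le hR hμ z
  rw [h0, sub_self, norm_zero, zero_mul, norm_le_zero_iff, sub_eq_zero] at this
  exact this

end RootSystem

/-! ### Parameter integrals of holomorphic functions and the identity theorem -/

/-- Differentiation under the integral sign for a family of entire functions. -/
lemma hasDerivAt_integral_of_entire {A : Type*} [MeasurableSpace A] {m : Measure A}
    {F : ℂ → A → ℂ} (hF : ∀ a, Differentiable ℂ fun l => F l a)
    (hm : ∀ l, AEStronglyMeasurable (F l) m) (l₀ : ℂ) {bound : A → ℝ}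
    (hb : Integrable bound m) (hle : ∀ a, ∀ l, ‖l - l₀‖ ≤ 2 → ‖F l a‖ ≤ bound a) :
    Integrable (fun a => deriv (fun l => F l a) l₀) m ∧
      HasDerivAt (fun l => ∫ a, F l a ∂m) (∫ a, deriv (fun l => F l a) l₀ ∂m) l₀ := by
  refine hasDerivAt_integral_of_dominated_loc_of_deriv_le (F := F)
    (F' := fun l a => deriv (fun l => F l a) l) (bound := bound)
    (Metric.closedBall_mem_nhds l₀ one_pos) (Filter.Eventually.of_forall hm) ?_ ?_ ?_ hb ?_
  · exact hb.mono' (hm l₀) (Filter.Eventually.of_forall fun a => hle a l₀ (by simp))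
  -- The derivative is measurable in a as the pointwise limit of difference quotients along l₀ +
  -- 1/(n+1).
  · have ht : Filter.Tendsto (fun n : ℕ => (l₀ + 1 / ((n : ℂ) + 1))) Filter.atTop
        (nhdsWithin l₀ {l₀}ᶜ) := by
      refine tendsto_nhdsWithin_iff.2 ⟨?_, Filter.Eventually.of_forall fun n => ?_⟩
      · simpa using (tendsto_one_div_add_atTop_nhds_zero_nat (𝕜 := ℂ)).const_add l₀
      · have : (n : ℂ) + 1 ≠ 0 := by exact_mod_cast n.succ_ne_zero
        simp [this]
    refine aestronglyMeasurable_of_tendsto_ae (u := Filter.atTop)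
      (f := fun n : ℕ => fun a => slope (fun l => F l a) l₀ (l₀ + 1 / ((n : ℂ) + 1)))
      (fun n => ?_) (Filter.Eventually.of_forall fun a => ?_)
    · simp only [slope_def_module]
      exact ((hm _).sub (hm l₀)).const_smul (_ : ℂ)
    · exact (hasDerivAt_iff_tendsto_slope.1 ((hF a) l₀).hasDerivAt).comp ht
  -- The bound holds within distance 2 of l₀, so Cauchy's estimate on a unit circle bounds the
  -- derivative within distance 1 by the same function.
  · refine Filter.Eventually.of_forall fun a l hl => ?_
    have hl' : ‖l - l₀‖ ≤ 1 := by simpa [dist_eq_norm] using hl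
    have := Complex.norm_deriv_le_of_forall_mem_sphere_norm_le (c := l) one_pos
      (hF a).diffContOnCl (C := bound a) (fun x hx => hle a x (by
        have hx' : ‖x - l‖ = 1 := by simpa [dist_eq_norm] using hx
        calc ‖x - l₀‖ = ‖(x - l) + (l - l₀)‖ := by ring_nf
          _ ≤ ‖x - l‖ + ‖l - l₀‖ := norm_add_le _ _
          _ ≤ 2 := by linarith))
    simpa using this
  · exact Filter.Eventually.of_forall fun a l _ => ((hF a) l).hasDerivAt

/-- The partial derivative of a holomorphic function of two variables is holomorphic in the
other variable. -/
lemma differentiable_deriv_of_prod {g : ℂ × ℂ → ℂ} (hg : Differentiable ℂ g) :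
    Differentiable ℂ fun s => deriv (fun l => g (l, s)) 0 := by
  have hc : ∀ s, Differentiable ℂ fun l => g (l, s) := fun s =>
    hg.comp (differentiable_id.prodMk (differentiable_const s))
  -- Cauchy's formula over the unit circle turns the l-derivative into an integral in which s is
  -- only a parameter.
  have e : ∀ s, deriv (fun l => g (l, s)) 0 = (2 * Real.pi * Complex.I : ℂ)⁻¹ *
      ∫ θ in Set.Ioc 0 (2 * Real.pi), deriv (circleMap 0 1) θ •
        (1 / (circleMap 0 1 θ) ^ 2 * g (circleMap 0 1 θ, s)) := by
    intro s
    have := DiffContOnCl.deriv_eq_smul_circleIntegral (c := 0) one_pos (hc s).diffContOnCl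
    rw [circleIntegral, intervalIntegral.integral_of_le (by positivity)] at this
    simp only [smul_eq_mul, sub_zero] at this ⊢
    rw [this, inv_mul_cancel_left₀ Complex.two_pi_I_ne_zero]
  intro s₀
  rw [show (fun s => deriv (fun l => g (l, s)) 0) = _ from funext e]
  refine DifferentiableAt.const_mul ?_ _
  have hK : IsCompact (Metric.closedBall (0 : ℂ) 1 ×ˢ Metric.closedBall s₀ 2) :=
    (isCompact_closedBall _ _).prod (isCompact_closedBall _ _)
  obtain ⟨C, hC⟩ := hK.exists_bound_of_continuousOn hg.continuous.continuousOn
  have hcm : ∀ θ, circleMap 0 1 θ ≠ 0 := fun θ => circleMap_ne_center one_ne_zero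
  refine (hasDerivAt_integral_of_entire (m := volume.restrict (Set.Ioc 0 (2 * Real.pi)))
    (F := fun s θ => deriv (circleMap 0 1) θ •
        (1 / (circleMap 0 1 θ) ^ 2 * g (circleMap 0 1 θ, s)))
    (fun θ => ?_) (fun s => ?_) s₀ (bound := fun _ => C) (integrable_const C)
    (fun θ s hs => ?_)).2.differentiableAt
  · have hs : Differentiable ℂ fun s => g (circleMap 0 1 θ, s) :=
      hg.comp ((differentiable_const _).prodMk differentiable_id)
    exact (hs.const_mul _).const_mul _
  · refine Continuous.aestronglyMeasurable ?_
    have h1 : Continuous (deriv (circleMap 0 1)) := by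
      rw [show deriv (circleMap 0 1) = fun θ => circleMap 0 1 θ * Complex.I from
        funext fun θ => deriv_circleMap 0 1 θ]
      fun_prop
    have h2 : Continuous fun θ => 1 / circleMap 0 1 θ ^ 2 :=
      continuous_const.div ((continuous_circleMap 0 1).pow 2) fun θ => pow_ne_zero 2 (hcm θ)
    exact h1.smul (h2.mul (hg.continuous.comp ((continuous_circleMap 0 1).prodMk
      continuous_const)))
  · have := hC (circleMap 0 1 θ, s) ⟨by simp, by simpa [dist_eq_norm] using hs⟩
    simpa [deriv_circleMap] using this

lemma hasDerivAt_line {V : Type*} [NormedAddCommGroup V] [NormedSpace ℂ V] {f : V → ℂ}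
    (hf : Differentiable ℂ f) (a b : V) (l : ℂ) :
    HasDerivAt (fun l : ℂ => f (a + l • b)) (fderiv ℂ f (a + l • b) b) l := by
  have h := (hf (a + l • b)).hasFDerivAt.comp_hasDerivAt l
    (((hasDerivAt_id l).smul_const b).const_add a)
  simpa [Function.comp_def] using! h

lemma differentiable_line {V : Type*} [NormedAddCommGroup V] [NormedSpace ℂ V] {f : V → ℂ}
    (hf : Differentiable ℂ f) (a b : V) : Differentiable ℂ fun l : ℂ => f (a + l • b) :=
  fun l => (hasDerivAt_line hf a b l).differentiableAt

/-- The directional derivative is the l-derivative at 0 of f(a + s•b + l•v), a holomorphic function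
of two complex variables. Holomorphy along lines is all that the identity theorem below asks for. -/
lemma differentiable_fderiv_line {V : Type*} [NormedAddCommGroup V] [NormedSpace ℂ V] {f : V → ℂ}
    (hf : Differentiable ℂ f) (a b v : V) :
    Differentiable ℂ fun s : ℂ => fderiv ℂ f (a + s • b) v := by
  have h : Differentiable ℂ fun p : ℂ × ℂ => f ((a + p.2 • b) + p.1 • v) := by fun_prop
  have := differentiable_deriv_of_prod h
  rwa [show (fun s : ℂ => fderiv ℂ f (a + s • b) v) = _ from funext fun s => ?_]
  have h := (hasDerivAt_line hf (a + s • b) v 0).deriv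
  simpa using h.symm

/-- Identity theorem: real points are a set of uniqueness. -/
lemma eq_zero_of_toC {G : CSpace N → ℂ} (hG : ∀ a b, Differentiable ℂ fun l : ℂ => G (a + l • b))
    (h0 : ∀ x, G (toC x) = 0) (z : CSpace N) : G z = 0 := by
  obtain ⟨x, y, rfl⟩ := exists_toC_add z
  have ha : AnalyticOnNhd ℂ (fun l : ℂ => G (toC x + l • toC y)) Set.univ :=
    (hG _ _).differentiableOn.analyticOnNhd isOpen_univ
  have hfr : ∃ᶠ l in nhdsWithin (0 : ℂ) {0}ᶜ, (fun l : ℂ => G (toC x + l • toC y)) l = 0 := by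
    have ht : Filter.Tendsto (fun n : ℕ => (1 / ((n : ℂ) + 1))) Filter.atTop
        (nhdsWithin 0 {0}ᶜ) := by
      refine tendsto_nhdsWithin_iff.2 ⟨tendsto_one_div_add_atTop_nhds_zero_nat,
        Filter.Eventually.of_forall fun n => ?_⟩
      have : (n : ℂ) + 1 ≠ 0 := by exact_mod_cast n.succ_ne_zero
      simp [this]
    refine ht.frequently (Filter.Frequently.of_forall fun n => ?_)
    have := h0 (x + (1 / ((n : ℝ) + 1)) • y)
    rw [toC_add, toC_smul] at this
    push_cast at this
    exact this
  -- The zeros at the real points l = 1/(n+1) accumulate at 0, so the restriction to the line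
  -- vanishes; l = i gives the point x + iy.
  have := ha.eqOn_zero_of_preconnected_of_frequently_eq_zero isPreconnected_univ
    (Set.mem_univ 0) hfr (Set.mem_univ Complex.I)
  exact this

/-! ### The Dunkl kernel through its Euler equation -/

section Kernel

variable {R : Finset (RSpace N)} {μ : RSpace N → ℝ}

/-- Kernels satisfying the Euler form of the eigenvalue equations. -/
structure IsEulerKernel (R : Finset (RSpace N)) (μ : RSpace N → ℝ)
    (E : CSpace N → CSpace N → ℂ) : Prop where
  holomorphic : Differentiable ℂ fun p : CSpace N × CSpace N => E p.1 p.2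
  euler : ∀ z w, fderiv ℂ (fun z' => E z' w) z z +
    (1 / 2) * ∑ α ∈ R, (μ α : ℂ) * (E z w - E (reflC α z) w) = bilin z w * E z w
  normalized : ∀ w, E 0 w = 1

lemma differentiable_left {E : CSpace N → CSpace N → ℂ}
    (hE : Differentiable ℂ fun p : CSpace N × CSpace N => E p.1 p.2) (w : CSpace N) :
    Differentiable ℂ fun z => E z w := by
  have : Differentiable ℂ fun z : CSpace N => (z, w) := by fun_prop
  exact hE.comp this

lemma differentiable_right {E : CSpace N → CSpace N → ℂ}
    (hE : Differentiable ℂ fun p : CSpace N × CSpace N => E p.1 p.2) (z : CSpace N) :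
    Differentiable ℂ fun w => E z w := by
  have : Differentiable ℂ fun w : CSpace N => (z, w) := by fun_prop
  exact hE.comp this

/-- Seen as a derivative of the joint function along (v,0), the partial derivative can be varied
along lines in the other argument. -/
lemma fderiv_left_eq {E : CSpace N → CSpace N → ℂ}
    (hE : Differentiable ℂ fun p : CSpace N × CSpace N => E p.1 p.2) (z w v : CSpace N) :
    fderiv ℂ (fun z => E z w) z v =
      fderiv ℂ (fun p : CSpace N × CSpace N => E p.1 p.2) (z, w) (v, 0) := by
  have h := (hE (z, w)).hasFDerivAt.comp z
    (f := fun z' => (z', w)) ((hasFDerivAt_id z).prodMk (hasFDerivAt_const w z))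
  have h' : HasFDerivAt (fun z => E z w) _ z := h
  rw [h'.fderiv]
  simp

lemma differentiable_fderiv_left {E : CSpace N → CSpace N → ℂ}
    (hE : Differentiable ℂ fun p : CSpace N × CSpace N => E p.1 p.2) (z v a b : CSpace N) :
    Differentiable ℂ fun l : ℂ => fderiv ℂ (fun z => E z (a + l • b)) z v := by
  simp_rw [fderiv_left_eq hE]
  have := differentiable_fderiv_line hE (z, a) ((0 : CSpace N), b) (v, 0)
  simpa using this

lemma fderiv_comp_toC {f : CSpace N → ℂ} (hf : Differentiable ℂ f) (x ξ : RSpace N) :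
    fderiv ℝ (fun x => f (toC x)) x ξ = fderiv ℂ f (toC x) (toC ξ) := by
  have h := ((hf (toC x)).hasFDerivAt.restrictScalars ℝ).comp x (toCL (N := N)).hasFDerivAt
  have h' : HasFDerivAt (fun x => f (toC x)) _ x := h
  rw [h'.fderiv]
  simp

/-- On the hyperplane ⟨α,x⟩ = 0 both sides vanish, because σ_α fixes x. With ξ = x the Dunkl
operator therefore contains no quotients. -/
lemma inner_mul_diffQuot {α : RSpace N} (hα : ‖α‖ ^ 2 = 2) (f : RSpace N → ℂ) (x : RSpace N) :
    ((inner ℝ α x : ℝ) : ℂ) * diffQuot α f x = f x - f (rootRefl α x) := by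
  unfold diffQuot
  split_ifs with h
  · simp [h, rootRefl_apply hα]
  · rw [mul_div_cancel₀]
    exact_mod_cast h

lemma diffQuot_comp_toC {α : RSpace N} (hα : ‖α‖ ^ 2 = 2) {f : CSpace N → ℂ}
    (hf : Differentiable ℂ f) (x : RSpace N) :
    diffQuot α (fun x => f (toC x)) x = if (inner ℝ α x : ℝ) = 0 then fderiv ℂ f (toC x) (toC α)
      else (f (toC x) - f (reflC α (toC x))) / ((inner ℝ α x : ℝ) : ℂ) := by
  unfold diffQuot
  simp only [fderiv_comp_toC hf, hα, toC_rootRefl hα]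
  simp

/-- The direction ξ = x turns the eigenvalue equation into the Euler form at real points. The
identity theorem then extends it one argument at a time, w first and z afterwards. Reality of the
values is not assumed, so the lemma can serve in the existence proof before reality is known. -/
lemma isEulerKernel_of_eigen (hR : IsRootSystem R) {E : CSpace N → CSpace N → ℂ}
    (hd : Differentiable ℂ fun p : CSpace N × CSpace N => E p.1 p.2)
    (heig : ∀ x y ξ : RSpace N, dunklOp R μ ξ (fun x' => E (toC x') (toC y)) x
      = ((inner ℝ ξ y : ℝ) : ℂ) * E (toC x) (toC y))
    (hnorm : ∀ y : RSpace N, E 0 (toC y) = 1) : IsEulerKernel R μ E := by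
  have hreal : ∀ x y : RSpace N, fderiv ℂ (fun z' => E z' (toC y)) (toC x) (toC x) +
      (1 / 2) * ∑ α ∈ R, (μ α : ℂ) * (E (toC x) (toC y) - E (reflC α (toC x)) (toC y)) -
        bilin (toC x) (toC y) * E (toC x) (toC y) = 0 := by
    intro x y
    have h := heig x y x
    rw [dunklOp, fderiv_comp_toC (differentiable_left hd (toC y))] at h
    rw [bilin_toC, ← h, add_sub_add_left_eq_sub, ← mul_sub, ← Finset.sum_sub_distrib,
      Finset.sum_eq_zero, mul_zero]
    intro α hα
    rw [mul_assoc, inner_mul_diffQuot (hR.norm_sq α hα), toC_rootRefl (hR.norm_sq α hα), sub_self]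
  have h1 : ∀ (x : RSpace N) (w : CSpace N), fderiv ℂ (fun z' => E z' w) (toC x) (toC x) +
      (1 / 2) * ∑ α ∈ R, (μ α : ℂ) * (E (toC x) w - E (reflC α (toC x)) w) -
        bilin (toC x) w * E (toC x) w = 0 := by
    intro x
    refine eq_zero_of_toC (fun a b => ?_) (hreal x)
    have k1 := differentiable_fderiv_left hd (toC x) (toC x) a b
    have k2 := fun z => differentiable_line (differentiable_right hd z) a b
    have k3 : Differentiable ℂ fun l : ℂ => bilin (toC x) (a + l • b) := by fun_prop
    have k4 : Differentiable ℂ fun l : ℂ => ∑ α ∈ R, (μ α : ℂ) *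
        (E (toC x) (a + l • b) - E (reflC α (toC x)) (a + l • b)) :=
      Differentiable.fun_sum fun α _ => ((k2 _).sub (k2 _)).const_mul _
    exact (k1.add (k4.const_mul _)).sub (k3.mul (k2 _))
  refine ⟨hd, fun z w => ?_, ?_⟩
  · rw [← sub_eq_zero]
    refine eq_zero_of_toC (G := fun z => fderiv ℂ (fun z' => E z' w) z z +
      (1 / 2) * ∑ α ∈ R, (μ α : ℂ) * (E z w - E (reflC α z) w) - bilin z w * E z w)
      (fun a b => ?_) (fun x => h1 x w) z
    have hl := differentiable_left hd w
    have k1 : Differentiable ℂ fun l : ℂ =>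
        fderiv ℂ (fun z' => E z' w) (a + l • b) (a + l • b) := by
      simp only [map_add, map_smul, smul_eq_mul]
      exact (differentiable_fderiv_line hl a b a).add
        (differentiable_id.mul (differentiable_fderiv_line hl a b b))
    have k2 := differentiable_line hl a b
    have k2' : ∀ α, Differentiable ℂ fun l : ℂ => E (reflC α (a + l • b)) w := by
      intro α
      simp only [map_add, map_smul]
      exact differentiable_line hl _ _
    have k3 : Differentiable ℂ fun l : ℂ => bilin (a + l • b) w := by
      simp only [bilin_comm _ w]
      fun_prop
    have k4 : Differentiable ℂ fun l : ℂ => ∑ α ∈ R, (μ α : ℂ) *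
        (E (a + l • b) w - E (reflC α (a + l • b)) w) :=
      Differentiable.fun_sum fun α _ => (k2.sub (k2' _)).const_mul _
    exact (k1.add (k4.const_mul _)).sub (k3.mul k2)
  · intro w
    rw [← sub_eq_zero]
    refine eq_zero_of_toC (G := fun w => E 0 w - 1) (fun a b => ?_) (fun x => ?_) w
    · exact (differentiable_line (differentiable_right hd 0) a b).sub_const 1
    · simp [hnorm]

lemma IsDunklKernel.isEulerKernel (hR : IsRootSystem R) {E : CSpace N → CSpace N → ℂ}
    (hE : IsDunklKernel R μ E) : IsEulerKernel R μ E :=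
  isEulerKernel_of_eigen hR hE.holomorphic hE.eigen hE.normalized

/-- The eigenvalue equation of the Dunkl kernel holds for complex spectral parameters. -/
lemma IsDunklKernel.dunklOp_eq (hR : IsRootSystem R) {E : CSpace N → CSpace N → ℂ}
    (hE : IsDunklKernel R μ E) (x ξ : RSpace N) (w : CSpace N) :
    dunklOp R μ ξ (fun x => E (toC x) w) x = bilin (toC ξ) w * E (toC x) w := by
  have hd := hE.holomorphic
  rw [← sub_eq_zero]
  refine eq_zero_of_toC (G := fun w => dunklOp R μ ξ (fun x => E (toC x) w) x -
    bilin (toC ξ) w * E (toC x) w) (fun a b => ?_) (fun y => ?_) w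
  · have k2 := fun z => differentiable_line (differentiable_right hd z) a b
    have k3 : Differentiable ℂ fun l : ℂ => bilin (toC ξ) (a + l • b) := by fun_prop
    have k4 : Differentiable ℂ fun l : ℂ => ∑ α ∈ R, (μ α : ℂ) * ((inner ℝ α ξ : ℝ) : ℂ) *
        diffQuot α (fun x => E (toC x) (a + l • b)) x := by
      refine Differentiable.fun_sum fun α hα => Differentiable.const_mul ?_ _
      simp only [diffQuot_comp_toC (hR.norm_sq α hα) (differentiable_left hd _)]
      split_ifs with h
      · exact differentiable_fderiv_left hd _ _ a b
      · exact ((k2 _).sub (k2 _)).div_const _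
    simp only [dunklOp, fderiv_comp_toC (differentiable_left hd _)]
    exact ((differentiable_fderiv_left hd _ _ a b).add (k4.const_mul _)).sub (k3.mul (k2 _))
  · rw [hE.eigen, bilin_toC, sub_self]

variable {E : CSpace N → CSpace N → ℂ}

lemma IsEulerKernel.hasDerivAt_line (hE : IsEulerKernel R μ E) (z w : CSpace N) (l : ℂ) :
    HasDerivAt (fun l : ℂ => E (l • z) w) (fderiv ℂ (fun z => E z w) (l • z) z) l := by
  have := Dunkl.hasDerivAt_line (differentiable_left hE.holomorphic w) 0 z l
  simpa using this

lemma IsEulerKernel.isEulerSolution (hE : IsEulerKernel R μ E) (w : CSpace N) :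
    IsEulerSolution R μ w (fun z => E z w) where
  differentiable z l := (hE.hasDerivAt_line z w l).differentiableAt
  equation z l := by
    have h := hE.euler (l • z) w
    rw [(hE.hasDerivAt_line z w l).deriv]
    simp only [map_smul, bilin_smul_left, smul_eq_mul] at h
    exact h
  bounded r := by
    obtain ⟨C, hC⟩ := (isCompact_closedBall (0 : CSpace N) r).exists_bound_of_continuousOn
      (differentiable_left hE.holomorphic w).continuous.continuousOn
    exact ⟨C, fun z hz => hC z (by simpa using hz)⟩

lemma IsEulerKernel.norm_le (hR : IsRootSystem R) (hμ : IsMultiplicity R μ)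
    (hE : IsEulerKernel R μ E) (z w : CSpace N) : ‖E z w‖ ≤ Real.exp (‖z‖ * ‖w‖) := by
  simpa [hE.normalized] using (hE.isEulerSolution w).norm_le hR hμ z

/-- As functions of z, both sides solve the Euler equation with spectral parameter c•w and equal 1
at the origin. The symmetries below are obtained by the same comparison. -/
lemma IsEulerKernel.smul_left (hR : IsRootSystem R) (hμ : IsMultiplicity R μ)
    (hE : IsEulerKernel R μ E) (c : ℂ) (z w : CSpace N) : E (c • z) w = E z (c • w) := by
  have h : IsEulerSolution R μ (c • w) (fun z => E (c • z) w) := by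
    have hd : ∀ z (l : ℂ), HasDerivAt (fun l : ℂ => E (c • l • z) w)
        (fderiv ℂ (fun z => E z w) ((c * l) • z) z * c) l := by
      intro z l
      have := (hE.hasDerivAt_line z w (c * l)).comp l ((hasDerivAt_id l).const_mul c)
      simpa [Function.comp_def, mul_smul] using this
    refine ⟨fun z l => (hd z l).differentiableAt, fun z l => ?_, fun r => ?_⟩
    · have h := (hE.isEulerSolution w).equation z (c * l)
      rw [(hE.hasDerivAt_line z w (c * l)).deriv] at h
      rw [(hd z l).deriv, map_smul, smul_eq_mul]
      simp only [mul_smul] at h ⊢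
      linear_combination h
    · obtain ⟨C, hC⟩ := (hE.isEulerSolution w).bounded (‖c‖ * r)
      exact ⟨C, fun z hz => hC _ (by rw [norm_smul]; gcongr)⟩
  exact congrFun (h.eq_of_zero hR hμ (hE.isEulerSolution (c • w)) (by simp [hE.normalized])) z

/-- Conjugating the equation by σ_β permutes the roots, preserves μ and preserves the bilinear form,
so the reflected kernel solves the original equation. -/
lemma IsEulerKernel.reflC_reflC (hR : IsRootSystem R) (hμ : IsMultiplicity R μ)
    (hE : IsEulerKernel R μ E) {β : RSpace N} (hβ : β ∈ R) (z w : CSpace N) :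
    E (reflC β z) (reflC β w) = E z w := by
  have hβ2 := hR.norm_sq β hβ
  have h : IsEulerSolution R μ w (fun z => E (reflC β z) (reflC β w)) := by
    refine ⟨fun z => ?_, fun z l => ?_, fun r => ?_⟩
    · simpa using (hE.isEulerSolution (reflC β w)).differentiable (reflC β z)
    · have h := (hE.isEulerSolution (reflC β w)).equation (reflC β z) l
      rw [bilin_reflC_reflC hβ2, ← sum_rootRefl hR hβ] at h
      simp only [map_smul]
      rw [← h]
      congr 2
      refine Finset.sum_congr rfl fun α hα => ?_
      rw [hμ.rootRefl_eq hβ hα, reflC_comp_reflC hβ2]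
    · obtain ⟨C, hC⟩ := (hE.isEulerSolution (reflC β w)).bounded r
      exact ⟨C, fun z hz => hC _ (by rwa [norm_reflC hβ2])⟩
  exact congrFun (h.eq_of_zero hR hμ (hE.isEulerSolution w) (by simp [hE.normalized])) z

lemma IsEulerKernel.right_zero (hR : IsRootSystem R) (hμ : IsMultiplicity R μ)
    (hE : IsEulerKernel R μ E) (z : CSpace N) : E z 0 = 1 := by
  have := hE.smul_left hR hμ 0 z 0
  rwa [zero_smul, zero_smul, hE.normalized, eq_comm] at this

/-- The Dunkl kernel, as a function of its second argument, solves the same equation. -/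
lemma IsEulerKernel.isEulerSolution_right (hR : IsRootSystem R) (hμ : IsMultiplicity R μ)
    (hE : IsEulerKernel R μ E) (w : CSpace N) : IsEulerSolution R μ w (fun z => E w z) := by
  -- Homogeneity moves the scalar to the first argument, where the Euler equation is known;
  -- reflection invariance will do the same for σ_α.
  have e : ∀ z : CSpace N, (fun l : ℂ => E w (l • z)) = fun l => E (l • w) z := fun z =>
    funext fun l => (hE.smul_left hR hμ l w z).symm
  refine ⟨fun z => ?_, fun z l => ?_, fun r => ?_⟩
  · rw [e]; exact (hE.isEulerSolution z).differentiable w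
  · have h := (hE.isEulerSolution z).equation w l
    rw [e, bilin_comm z w, ← hE.smul_left hR hμ l w z, ← h]
    congr 2
    refine Finset.sum_congr rfl fun α hα => ?_
    rw [← hE.reflC_reflC hR hμ hα w (l • reflC α z), map_smul,
      Dunkl.reflC_reflC (hR.norm_sq α hα), hE.smul_left hR hμ l (reflC α w)]
  · refine ⟨Real.exp (‖w‖ * r), fun z hz => (hE.norm_le hR hμ w z).trans ?_⟩
    gcongr

lemma IsEulerKernel.symm (hR : IsRootSystem R) (hμ : IsMultiplicity R μ)
    (hE : IsEulerKernel R μ E) (z w : CSpace N) : E z w = E w z :=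
  congrFun ((hE.isEulerSolution w).eq_of_zero hR hμ (hE.isEulerSolution_right hR hμ w)
    (by rw [hE.normalized, hE.right_zero hR hμ])) z

/-- Since μ is real, conjugating both arguments and the value preserves the equation, and two
conjugations restore holomorphy. At real points this forces real values. -/
lemma IsEulerKernel.conj_eq (hR : IsRootSystem R) (hμ : IsMultiplicity R μ)
    (hE : IsEulerKernel R μ E) (z w : CSpace N) : conj (E z w) = E (conjC z) (conjC w) := by
  have h : IsEulerSolution R μ w (fun z => conj (E (conjC z) (conjC w))) := by
    have hs := hE.isEulerSolution (conjC w)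
    have hd : ∀ z (l : ℂ), HasDerivAt (fun l : ℂ => conj (E (conjC (l • z)) (conjC w)))
        (conj (deriv (fun l : ℂ => E (l • conjC z) (conjC w)) (conj l))) l := by
      intro z l
      have := ((hs.differentiable (conjC z)) (conj l)).hasDerivAt.conj_conj
      simpa [Function.comp_def, conjC_smul] using this
    refine ⟨fun z l => (hd z l).differentiableAt, fun z l => ?_, fun r => ?_⟩
    · have h := congrArg conj (hs.equation (conjC z) (conj l))
      rw [(hd z l).deriv]
      simpa [conjC_smul, conjC_reflC, conj_bilin, Complex.conj_ofNat] using h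
    · obtain ⟨C, hC⟩ := hs.bounded r
      exact ⟨C, fun z hz => by rw [RCLike.norm_conj]; exact hC _ (by rwa [norm_conjC])⟩
  rw [← congrFun (h.eq_of_zero hR hμ (hE.isEulerSolution w) (by simp [hE.normalized])) z]
  simp

end Kernel

/-! ### Functions of exponential growth against Gaussians -/

/-- Functions of at most exponential growth. -/
def ExpBdd {F : Type*} [Norm F] (h : RSpace N → F) : Prop :=
  ∃ C a : ℝ, 0 ≤ C ∧ 0 ≤ a ∧ ∀ x, ‖h x‖ ≤ C * Real.exp (a * ‖x‖)

lemma ExpBdd.of_le {F : Type*} [Norm F] {h : RSpace N → F} (C a : ℝ) (hC : 0 ≤ C) (ha : 0 ≤ a)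
    (hle : ∀ x, ‖h x‖ ≤ C * Real.exp (a * ‖x‖)) : ExpBdd h := ⟨C, a, hC, ha, hle⟩

lemma ExpBdd.mono {F G : Type*} [Norm F] [Norm G] {h : RSpace N → F} {k : RSpace N → G}
    (hh : ExpBdd h) (hk : ∀ x, ‖k x‖ ≤ ‖h x‖) : ExpBdd k :=
  let ⟨C, a, hC, ha, hle⟩ := hh
  ⟨C, a, hC, ha, fun x => (hk x).trans (hle x)⟩

lemma ExpBdd.const {F : Type*} [NormedAddCommGroup F] (c : F) : ExpBdd fun _ : RSpace N => c :=
  ⟨‖c‖, 0, norm_nonneg _, le_rfl, fun x => by simp⟩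

lemma ExpBdd.mul {h k : RSpace N → ℂ} (hh : ExpBdd h) (hk : ExpBdd k) :
    ExpBdd fun x => h x * k x := by
  obtain ⟨C, a, hC, ha, h1⟩ := hh
  obtain ⟨D, b, hD, hb, h2⟩ := hk
  refine ⟨C * D, a + b, by positivity, by positivity, fun x => ?_⟩
  rw [norm_mul, add_mul, Real.exp_add]
  calc ‖h x‖ * ‖k x‖ ≤ (C * Real.exp (a * ‖x‖)) * (D * Real.exp (b * ‖x‖)) := by
        gcongr
        · exact h1 x
        · exact h2 x
    _ = _ := by ring

lemma ExpBdd.smul {F : Type*} [NormedAddCommGroup F] [NormedSpace ℂ F] {h : RSpace N → ℂ}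
    {k : RSpace N → F} (hh : ExpBdd h) (hk : ExpBdd k) : ExpBdd fun x => h x • k x := by
  have h1 : ExpBdd fun x => ((‖k x‖ : ℝ) : ℂ) := hk.mono fun x => by simp
  exact (hh.mul h1).mono fun x => by simp [norm_smul]

lemma ExpBdd.add {F : Type*} [NormedAddCommGroup F] {h k : RSpace N → F} (hh : ExpBdd h)
    (hk : ExpBdd k) : ExpBdd fun x => h x + k x := by
  obtain ⟨C, a, hC, ha, h1⟩ := hh
  obtain ⟨D, b, hD, hb, h2⟩ := hk
  refine ⟨C + D, a + b, by positivity, by positivity, fun x => (norm_add_le _ _).trans ?_⟩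
  rw [add_mul C]
  refine add_le_add ((h1 x).trans ?_) ((h2 x).trans ?_)
  · gcongr; linarith
  · gcongr; linarith

lemma ExpBdd.sub {F : Type*} [NormedAddCommGroup F] {h k : RSpace N → F} (hh : ExpBdd h)
    (hk : ExpBdd k) : ExpBdd fun x => h x - k x := by
  simp only [sub_eq_add_neg]
  exact hh.add (hk.mono fun x => (norm_neg _).le)

lemma ExpBdd.sum {F ι : Type*} [NormedAddCommGroup F] {s : Finset ι} {h : ι → RSpace N → F}
    (hh : ∀ i ∈ s, ExpBdd (h i)) : ExpBdd fun x => ∑ i ∈ s, h i x := by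
  classical
  induction s using Finset.induction_on with
  | empty => simpa using ExpBdd.const (0 : F)
  | insert i s hi ih =>
    simp only [Finset.sum_insert hi]
    exact (hh i (by simp)).add (ih fun j hj => hh j (by simp [hj]))

lemma ExpBdd.comp_rootRefl {F : Type*} [Norm F] {h : RSpace N → F} (hh : ExpBdd h)
    (α : RSpace N) : ExpBdd fun x => h (rootRefl α x) := by
  obtain ⟨C, a, hC, ha, h1⟩ := hh
  exact ⟨C, a, hC, ha, fun x => by simpa using h1 (rootRefl α x)⟩

lemma ExpBdd.inner (ξ : RSpace N) : ExpBdd fun x => ((inner ℝ ξ x : ℝ) : ℂ) := by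
  refine ⟨‖ξ‖, 1, norm_nonneg _, zero_le_one, fun x => ?_⟩
  rw [Complex.norm_real, one_mul]
  refine (norm_inner_le_norm ξ x).trans ?_
  gcongr
  linarith [Real.add_one_le_exp ‖x‖]

lemma integrable_exp_mul_norm_mul_gauss (a : ℝ) :
    Integrable fun x : RSpace N => Real.exp (a * ‖x‖) * Real.exp (-‖x‖ ^ 2 / 2) := by
  -- From (a - r/2)² ≥ 0 follows ar - r²/2 ≤ a² - r²/4, which explains the rate 1/4 and the constant
  -- e^{a²}.
  have h := (GaussianFourier.integrable_cexp_neg_mul_sq_norm_add (V := RSpace N) (b := 1 / 4)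
    (by norm_num) 0 0).norm.const_mul (Real.exp (a ^ 2))
  refine h.mono' (by fun_prop) (Filter.Eventually.of_forall fun x => ?_)
  rw [Complex.norm_exp, ← Real.exp_add, ← Real.exp_add, Real.norm_eq_abs, Real.abs_exp,
    Real.exp_le_exp]
  have : (-(1 / 4 : ℂ) * (‖x‖ : ℂ) ^ 2 + 0 * ((inner ℝ (0 : RSpace N) x : ℝ) : ℂ)).re
      = -(1 / 4) * ‖x‖ ^ 2 := by
    rw [zero_mul, add_zero]
    have : (-(1 / 4 : ℂ) * (‖x‖ : ℂ) ^ 2) = ((-(1 / 4) * ‖x‖ ^ 2 : ℝ) : ℂ) := by push_cast; ring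
    rw [this, Complex.ofReal_re]
  rw [this]
  nlinarith [sq_nonneg (a - ‖x‖ / 2)]

/-! ### The regularized weight and antisymmetry of the Dunkl operators -/

section Weight

variable {R : Finset (RSpace N)} {μ : RSpace N → ℝ}

/-- The weight `∏ |⟨α, x⟩|^{μ(α)}`, regularized by a parameter `ε ≥ 0`. -/
noncomputable def regWeight (R : Finset (RSpace N)) (μ : RSpace N → ℝ) (ε : ℝ) (x : RSpace N) : ℝ :=
  ∏ α ∈ R, ((inner ℝ α x : ℝ) ^ 2 + ε) ^ (μ α / 2)

/-- The Gaussian density times the regularized weight. -/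
noncomputable def gaussWeight (R : Finset (RSpace N)) (μ : RSpace N → ℝ) (ε : ℝ) (x : RSpace N) : ℝ :=
  Real.exp (-‖x‖ ^ 2 / 2) * regWeight R μ ε x

lemma regWeight_zero (x : RSpace N) :
    regWeight R μ 0 x = ∏ α ∈ R, |(inner ℝ α x : ℝ)| ^ μ α := by
  refine Finset.prod_congr rfl fun α _ => ?_
  rw [add_zero, ← sq_abs, ← Real.rpow_natCast_mul (abs_nonneg _)]
  congr 1
  push_cast
  ring

lemma regWeight_nonneg {ε : ℝ} (hε : 0 ≤ ε) (x : RSpace N) : 0 ≤ regWeight R μ ε x :=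
  Finset.prod_nonneg fun _ _ => Real.rpow_nonneg (by positivity) _

lemma gaussWeight_nonneg {ε : ℝ} (hε : 0 ≤ ε) (x : RSpace N) : 0 ≤ gaussWeight R μ ε x :=
  mul_nonneg (Real.exp_nonneg _) (regWeight_nonneg hε x)

lemma inner_rootRefl_rootRefl (β x y : RSpace N) :
    (inner ℝ (rootRefl β x) (rootRefl β y) : ℝ) = inner ℝ x y :=
  (rootRefl β).inner_map_map x y

/-- The reflection permutes the factors and μ is invariant. The symmetry survives the regularization
for each ε, so integrals can be folded along σ_β before the limit is taken. -/
lemma gaussWeight_rootRefl (hR : IsRootSystem R) (hμ : IsMultiplicity R μ) {β : RSpace N}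
    (hβ : β ∈ R) (ε : ℝ) (x : RSpace N) :
    gaussWeight R μ ε (rootRefl β x) = gaussWeight R μ ε x := by
  unfold gaussWeight regWeight
  rw [LinearIsometryEquiv.norm_map]
  congr 1
  refine Finset.prod_nbij' (rootRefl β) (rootRefl β) (fun _ h => hR.rootRefl_mem hβ h)
    (fun _ h => hR.rootRefl_mem hβ h) (fun _ _ => rootRefl_involutive β _)
    (fun _ _ => rootRefl_involutive β _) (fun α hα => ?_)
  rw [hμ.rootRefl_eq hβ hα, ← inner_rootRefl_rootRefl β α (rootRefl β x), rootRefl_involutive]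

lemma continuous_regWeight (hμ : IsMultiplicity R μ) (ε : ℝ) : Continuous (regWeight R μ ε) := by
  unfold regWeight
  refine continuous_finsetProd _ fun α hα => ?_
  exact Continuous.rpow_const (by fun_prop) fun x =>
    Or.inr (div_nonneg (hμ.nonneg α hα) zero_le_two)

lemma continuous_gaussWeight (hμ : IsMultiplicity R μ) (ε : ℝ) : Continuous (gaussWeight R μ ε) :=
  (by fun_prop : Continuous fun x : RSpace N => Real.exp (-‖x‖ ^ 2 / 2)).mul
    (continuous_regWeight hμ ε)

lemma continuous_gaussWeight_left (hμ : IsMultiplicity R μ) (x : RSpace N) :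
    Continuous fun ε => gaussWeight R μ ε x := by
  unfold gaussWeight regWeight
  refine continuous_const.mul (continuous_finsetProd _ fun α hα => ?_)
  exact Continuous.rpow_const (by fun_prop) fun x =>
    Or.inr (div_nonneg (hμ.nonneg α hα) zero_le_two)

lemma regWeight_le (hR : IsRootSystem R) (hμ : IsMultiplicity R μ) {ε : ℝ} (hε : 0 ≤ ε)
    (hε1 : ε ≤ 1) (x : RSpace N) :
    regWeight R μ ε x ≤ Real.exp ((2 * ∑ α ∈ R, μ α) * ‖x‖) := by
  rw [Finset.mul_sum, Finset.sum_mul, Real.exp_sum]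
  refine Finset.prod_le_prod (fun _ _ => Real.rpow_nonneg (by positivity) _) fun α hα => ?_
  have h1 : (inner ℝ α x : ℝ) ^ 2 + ε ≤ Real.exp (4 * ‖x‖) := by
    have h2 : (inner ℝ α x : ℝ) ^ 2 ≤ ‖α‖ ^ 2 * ‖x‖ ^ 2 := by
      rw [← mul_pow, ← sq_abs]
      gcongr
      exact abs_real_inner_le_norm α x
    rw [hR.norm_sq α hα] at h2
    -- With r = ‖x‖ this gives 1 + 4r + 8r² ≤ e^{4r}, more than the required 2r² + ε.
    have := Real.quadratic_le_exp_of_nonneg (x := 4 * ‖x‖) (by positivity)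
    nlinarith [norm_nonneg x]
  calc ((inner ℝ α x : ℝ) ^ 2 + ε) ^ (μ α / 2) ≤ (Real.exp (4 * ‖x‖)) ^ (μ α / 2) :=
        Real.rpow_le_rpow (by positivity) h1 (div_nonneg (hμ.nonneg α hα) zero_le_two)
    _ = Real.exp (2 * μ α * ‖x‖) := by rw [← Real.exp_mul]; ring_nf

/-- Functions of exponential growth, times the Gaussian weight, have an integrable bound which is
uniform in the regularization. -/
lemma ExpBdd.exists_bound (hR : IsRootSystem R) (hμ : IsMultiplicity R μ) {h : RSpace N → ℂ}
    (hh : ExpBdd h) : ∃ b : RSpace N → ℝ, Integrable b ∧ ∀ ε, 0 ≤ ε → ε ≤ 1 → ∀ x,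
      ‖h x‖ * gaussWeight R μ ε x ≤ b x := by
  obtain ⟨C, a, hC, ha, h1⟩ := hh
  refine ⟨_, (integrable_exp_mul_norm_mul_gauss (a + 2 * ∑ α ∈ R, μ α)).const_mul C,
    fun ε hε hε1 x => ?_⟩
  calc ‖h x‖ * gaussWeight R μ ε x
      ≤ (C * Real.exp (a * ‖x‖)) *
        (Real.exp (-‖x‖ ^ 2 / 2) * Real.exp ((2 * ∑ α ∈ R, μ α) * ‖x‖)) := by
        unfold gaussWeight
        have := regWeight_nonneg (R := R) (μ := μ) hε x
        have h2 := regWeight_le hR hμ hε hε1 x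
        gcongr
        exact h1 x
    _ = _ := by rw [add_mul, Real.exp_add]; ring

lemma ExpBdd.integrable (hR : IsRootSystem R) (hμ : IsMultiplicity R μ) {h : RSpace N → ℂ}
    (hh : ExpBdd h) (hm : AEStronglyMeasurable h) {ε : ℝ} (hε : 0 ≤ ε) (hε1 : ε ≤ 1) :
    Integrable fun x => h x * (gaussWeight R μ ε x : ℂ) := by
  obtain ⟨b, hb, hle⟩ := hh.exists_bound hR hμ
  refine hb.mono' (hm.mul (Complex.continuous_ofReal.comp
    (continuous_gaussWeight hμ ε)).aestronglyMeasurable) (Filter.Eventually.of_forall fun x => ?_)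
  rw [norm_mul, Complex.norm_real, Real.norm_of_nonneg (gaussWeight_nonneg hε x)]
  exact hle ε hε hε1 x

/-- For ε > 0 every factor is positive and the weight is the exponential of a sum of logarithms. A
root contributes μ(α)⟨α,ξ⟩ times a regularized 1/⟨α,x⟩ to the logarithmic derivative. -/
lemma hasLineDerivAt_gaussWeight {ε : ℝ} (hε : 0 < ε) (x ξ : RSpace N) :
    HasLineDerivAt ℝ (gaussWeight R μ ε) (gaussWeight R μ ε x * (-(inner ℝ ξ x : ℝ) +
      ∑ α ∈ R, μ α * (inner ℝ α ξ : ℝ) * ((inner ℝ α x : ℝ) / ((inner ℝ α x : ℝ) ^ 2 + ε)))) x ξ := by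
  have e : ∀ y, gaussWeight R μ ε y = Real.exp (-(inner ℝ y y : ℝ) / 2 +
      ∑ α ∈ R, Real.log ((inner ℝ α y : ℝ) ^ 2 + ε) * (μ α / 2)) := by
    intro y
    rw [Real.exp_add, Real.exp_sum, gaussWeight, regWeight, real_inner_self_eq_norm_sq]
    congr 1
    refine Finset.prod_congr rfl fun α _ => ?_
    rw [Real.rpow_def_of_pos (by positivity)]
  have hl : HasDerivAt (fun t : ℝ => x + t • ξ) ξ 0 := by
    simpa using ((hasDerivAt_id (0 : ℝ)).smul_const ξ).const_add x
  have hi : ∀ α : RSpace N, HasDerivAt (fun t : ℝ => (inner ℝ α (x + t • ξ) : ℝ))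
      (inner ℝ α ξ) 0 := by
    intro α
    simpa using (hasDerivAt_const (0 : ℝ) α).inner ℝ hl
  have h1 : HasDerivAt (fun t : ℝ => (inner ℝ (x + t • ξ) (x + t • ξ) : ℝ))
      (2 * (inner ℝ ξ x : ℝ)) 0 := by
    have := hl.inner ℝ hl
    simp only [zero_smul, add_zero, real_inner_comm ξ x] at this
    convert! this using 1
    ring
  have h2 : ∀ α ∈ R, HasDerivAt (fun t : ℝ =>
      Real.log ((inner ℝ α (x + t • ξ) : ℝ) ^ 2 + ε) * (μ α / 2))
      (μ α * (inner ℝ α ξ : ℝ) * ((inner ℝ α x : ℝ) / ((inner ℝ α x : ℝ) ^ 2 + ε))) 0 := by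
    intro α _
    have hpos : 0 < (inner ℝ α (x + (0 : ℝ) • ξ) : ℝ) ^ 2 + ε := by positivity
    have := ((((hi α).pow 2).add_const ε).log hpos.ne').mul_const (μ α / 2)
    simp only [zero_smul, add_zero, Pi.pow_apply] at this
    convert! this using 1
    field_simp
    ring
  have h3 := ((h1.neg.div_const 2).add (HasDerivAt.fun_sum h2)).exp
  unfold HasLineDerivAt
  rw [funext fun t : ℝ => e (x + t • ξ), e x]
  convert! h3 using 1
  simp
  ring

lemma measurable_diffQuot {h : RSpace N → ℂ} (hd : Differentiable ℝ h) (α : RSpace N) :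
    Measurable (diffQuot α h) := by
  unfold diffQuot
  refine Measurable.ite ?_ ?_ ?_
  · exact (isClosed_eq (by fun_prop) continuous_const).measurableSet
  · exact (measurable_fderiv_apply_const ℝ h α).const_mul _
  · refine Measurable.div ?_ (by fun_prop)
    exact hd.continuous.measurable.sub
      (hd.continuous.comp (rootRefl α).continuous).measurable

/-- The ball of radius ‖x‖ is convex and contains both x and σ_αx, whose difference is ⟨α,x⟩α. The
mean value inequality thus produces the factor that cancels the denominator. -/
lemma expBdd_diffQuot {h : RSpace N → ℂ} (hd : Differentiable ℝ h) (hb : ExpBdd (fderiv ℝ h))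
    {α : RSpace N} (hα : ‖α‖ ^ 2 = 2) : ExpBdd (diffQuot α h) := by
  obtain ⟨C, a, hC, ha, h1⟩ := hb
  refine ⟨C * ‖α‖, a, by positivity, ha, fun x => ?_⟩
  by_cases hx : (inner ℝ α x : ℝ) = 0
  · simp only [diffQuot, hx, if_true, hα]
    norm_num
    calc ‖fderiv ℝ h x α‖ ≤ ‖fderiv ℝ h x‖ * ‖α‖ := (fderiv ℝ h x).le_opNorm α
      _ ≤ (C * Real.exp (a * ‖x‖)) * ‖α‖ := by gcongr; exact h1 x
      _ = _ := by ring
  · simp only [diffQuot, hx, if_false]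
    have hx' : 0 < ‖(inner ℝ α x : ℝ)‖ := norm_pos_iff.2 hx
    rw [norm_div, Complex.norm_real, div_le_iff₀ hx']
    have := (convex_closedBall (0 : RSpace N) ‖x‖).norm_image_sub_le_of_norm_fderiv_le
      (𝕜 := ℝ) (f := h) (C := C * Real.exp (a * ‖x‖)) (x := rootRefl α x) (y := x)
      (fun y _ => hd y) (fun y hy => (h1 y).trans (by
        have : ‖y‖ ≤ ‖x‖ := by simpa using hy
        gcongr)) (by simp) (by simp)
    refine this.trans (le_of_eq ?_)
    rw [rootRefl_apply hα, sub_sub_cancel, norm_smul]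
    ring

lemma integral_comp_rootRefl (α : RSpace N) (F : RSpace N → ℂ) :
    ∫ x, F (rootRefl α x) = ∫ x, F x :=
  (rootRefl α).measurePreserving.integral_comp' (f := (rootRefl α).toMeasurableEquiv) F

lemma norm_inner_div_le {ε : ℝ} (hε : 0 < ε) (a : ℝ) : ‖a / (a ^ 2 + ε)‖ ≤ ‖a‖ / ε := by
  rw [norm_div, Real.norm_of_nonneg (show 0 ≤ a ^ 2 + ε by positivity)]
  gcongr
  nlinarith [sq_nonneg a]

/-- Integration by parts for the regularized weight. -/
lemma integral_fderiv_gaussWeight (hR : IsRootSystem R) (hμ : IsMultiplicity R μ)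
    {h : RSpace N → ℂ} (hd : Differentiable ℝ h) (hb : ExpBdd h) (hb' : ExpBdd (fderiv ℝ h))
    (ξ : RSpace N) {ε : ℝ} (hε : 0 < ε) (hε1 : ε ≤ 1) :
    ∫ x, (fderiv ℝ h x ξ - ((inner ℝ ξ x : ℝ) : ℂ) * h x) * (gaussWeight R μ ε x : ℂ) =
      - ∑ α ∈ R, (1 / 2) * (((inner ℝ α ξ : ℝ) : ℂ) * ∫ x, ((μ α : ℂ) * diffQuot α h x *
        (((inner ℝ α x : ℝ) ^ 2 / ((inner ℝ α x : ℝ) ^ 2 + ε) : ℝ) : ℂ)) *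
          (gaussWeight R μ ε x : ℂ)) := by
  have hhm : AEStronglyMeasurable h (volume : Measure (RSpace N)) :=
    hd.continuous.aestronglyMeasurable
  have hξb : ExpBdd fun x => fderiv ℝ h x ξ := by
    have := (ExpBdd.const (N := N) ((‖ξ‖ : ℝ) : ℂ)).smul hb'
    refine this.mono fun x => ?_
    rw [norm_smul, Complex.norm_real, norm_norm, mul_comm]
    exact (fderiv ℝ h x).le_opNorm ξ
  have hξm : AEStronglyMeasurable (fun x => fderiv ℝ h x ξ) (volume : Measure (RSpace N)) :=
    (measurable_fderiv_apply_const ℝ h ξ).aestronglyMeasurable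
  have hkb : ∀ α, ExpBdd fun x : RSpace N =>
      (((inner ℝ α x : ℝ) / ((inner ℝ α x : ℝ) ^ 2 + ε) : ℝ) : ℂ) := by
    intro α
    refine ((ExpBdd.const (1 / ε : ℂ)).mul (ExpBdd.inner α)).mono fun x => ?_
    rw [Complex.norm_real, norm_mul, Complex.norm_real]
    refine (norm_inner_div_le hε _).trans (le_of_eq ?_)
    simp [abs_of_pos hε]
    ring
  have hkm : ∀ α, AEStronglyMeasurable (fun x : RSpace N =>
      (((inner ℝ α x : ℝ) / ((inner ℝ α x : ℝ) ^ 2 + ε) : ℝ) : ℂ)) := by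
    intro α
    refine Continuous.aestronglyMeasurable (Complex.continuous_ofReal.comp ?_)
    exact Continuous.div (by fun_prop) (by fun_prop) fun x => by positivity
  have hint : Integrable fun x => h x * (gaussWeight R μ ε x : ℂ) :=
    hb.integrable hR hμ hhm hε.le hε1
  have hint1 : Integrable fun x => fderiv ℝ h x ξ * (gaussWeight R μ ε x : ℂ) :=
    hξb.integrable hR hμ hξm hε.le hε1
  have him : AEStronglyMeasurable (fun x : RSpace N => ((inner ℝ ξ x : ℝ) : ℂ)) :=
    (Complex.continuous_ofReal.comp (by fun_prop)).aestronglyMeasurable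
  have hint2 : Integrable fun x => ((inner ℝ ξ x : ℝ) : ℂ) * h x * (gaussWeight R μ ε x : ℂ) :=
    ((ExpBdd.inner ξ).mul hb).integrable hR hμ (him.mul hhm) hε.le hε1
  have hint3 : ∀ α, Integrable fun x => (h x * (((inner ℝ α x : ℝ) /
      ((inner ℝ α x : ℝ) ^ 2 + ε) : ℝ) : ℂ)) * (gaussWeight R μ ε x : ℂ) := fun α =>
    (hb.mul (hkb α)).integrable hR hμ (hhm.mul (hkm α)) hε.le hε1
  have hint4 : ∀ α, Integrable fun x => (h (rootRefl α x) * (((inner ℝ α x : ℝ) /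
      ((inner ℝ α x : ℝ) ^ 2 + ε) : ℝ) : ℂ)) * (gaussWeight R μ ε x : ℂ) := fun α =>
    ((hb.comp_rootRefl α).mul (hkb α)).integrable hR hμ
      ((hd.continuous.comp (rootRefl α).continuous).aestronglyMeasurable.mul (hkm α)) hε.le hε1
  set g' : RSpace N → ℂ := fun x => ((gaussWeight R μ ε x * (-(inner ℝ ξ x : ℝ) +
      ∑ α ∈ R, μ α * (inner ℝ α ξ : ℝ) *
        ((inner ℝ α x : ℝ) / ((inner ℝ α x : ℝ) ^ 2 + ε))) : ℝ) : ℂ) with hg'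
  have hsplit : ∀ x, h x * g' x = -(((inner ℝ ξ x : ℝ) : ℂ) * h x * (gaussWeight R μ ε x : ℂ)) +
      ∑ α ∈ R, (μ α : ℂ) * ((inner ℝ α ξ : ℝ) : ℂ) * ((h x * (((inner ℝ α x : ℝ) /
      ((inner ℝ α x : ℝ) ^ 2 + ε) : ℝ) : ℂ)) * (gaussWeight R μ ε x : ℂ)) := by
    intro x
    simp only [hg']
    push_cast
    rw [mul_add, mul_add, Finset.mul_sum, Finset.mul_sum]
    congr 1
    · ring
    · exact Finset.sum_congr rfl fun α _ => by ring
  have hint5 : Integrable fun x => ∑ α ∈ R, (μ α : ℂ) * ((inner ℝ α ξ : ℝ) : ℂ) *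
      ((h x * (((inner ℝ α x : ℝ) / ((inner ℝ α x : ℝ) ^ 2 + ε) : ℝ) : ℂ)) *
        (gaussWeight R μ ε x : ℂ)) :=
    integrable_finsetSum _ fun α _ => (hint3 α).const_mul _
  -- Integration by parts in direction ξ; the boundary terms disappear because all products involved
  -- are integrable.
  have key := integral_bilinear_hasLineDerivAt_right_eq_neg_left_of_integrable
    (μ := (volume : Measure (RSpace N)))
    (f := h) (f' := fun x => fderiv ℝ h x ξ) (g := fun x => (gaussWeight R μ ε x : ℂ))
    (g' := g') (v := ξ) (B := ContinuousLinearMap.mul ℝ ℂ) hint1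
    (by
      simp only [ContinuousLinearMap.mul_apply', hsplit]
      exact hint2.neg.add hint5) hint
    (fun x _ => (hd x).hasFDerivAt.hasLineDerivAt ξ)
    (fun x _ => (hasLineDerivAt_gaussWeight hε x ξ).ofReal_comp)
  simp only [ContinuousLinearMap.mul_apply', hsplit] at key
  have hneg : Integrable fun x => -(((inner ℝ ξ x : ℝ) : ℂ) * h x * (gaussWeight R μ ε x : ℂ)) :=
    hint2.neg
  rw [integral_add hneg hint5, integral_finsetSum _ fun α _ => (hint3 α).const_mul _,
    integral_neg] at key
  simp only [sub_mul]
  rw [integral_sub hint1 hint2]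
  -- The factor ⟨α,x⟩/(⟨α,x⟩²+ε) is odd under σ_α and the weight is even. So h may be replaced by
  -- ½(h - h∘σ_α), which equals ½⟨α,x⟩ times the difference quotient.
  have key2 : ∀ α ∈ R, ∫ x, (μ α : ℂ) * ((inner ℝ α ξ : ℝ) : ℂ) * ((h x * (((inner ℝ α x : ℝ) /
      ((inner ℝ α x : ℝ) ^ 2 + ε) : ℝ) : ℂ)) * (gaussWeight R μ ε x : ℂ)) =
      (1 / 2) * (((inner ℝ α ξ : ℝ) : ℂ) * ∫ x, ((μ α : ℂ) * diffQuot α h x *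
        (((inner ℝ α x : ℝ) ^ 2 / ((inner ℝ α x : ℝ) ^ 2 + ε) : ℝ) : ℂ)) *
          (gaussWeight R μ ε x : ℂ)) := by
    intro α hα
    have s1 : ∫ x, (h (rootRefl α x) * (((inner ℝ α x : ℝ) /
      ((inner ℝ α x : ℝ) ^ 2 + ε) : ℝ) : ℂ)) * (gaussWeight R μ ε x : ℂ) = -
      ∫ x, (h x * (((inner ℝ α x : ℝ) /
      ((inner ℝ α x : ℝ) ^ 2 + ε) : ℝ) : ℂ)) * (gaussWeight R μ ε x : ℂ) := by
      rw [← integral_comp_rootRefl α, ← integral_neg]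
      refine integral_congr_ae (Filter.Eventually.of_forall fun x => ?_)
      have hin : (inner ℝ α (rootRefl α x) : ℝ) = -inner ℝ α x := by
        rw [rootRefl_apply (hR.norm_sq α hα), inner_sub_right, inner_smul_right,
          real_inner_self_eq_norm_sq, hR.norm_sq α hα]
        ring
      simp only [rootRefl_involutive, gaussWeight_rootRefl hR hμ hα, hin]
      push_cast
      ring
    have s2 : ∫ x, ((μ α : ℂ) * diffQuot α h x *
        (((inner ℝ α x : ℝ) ^ 2 / ((inner ℝ α x : ℝ) ^ 2 + ε) : ℝ) : ℂ)) *
          (gaussWeight R μ ε x : ℂ) = (μ α : ℂ) * (∫ x, (h x * (((inner ℝ α x : ℝ) /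
      ((inner ℝ α x : ℝ) ^ 2 + ε) : ℝ) : ℂ)) * (gaussWeight R μ ε x : ℂ) -
        (h (rootRefl α x) * (((inner ℝ α x : ℝ) /
      ((inner ℝ α x : ℝ) ^ 2 + ε) : ℝ) : ℂ)) * (gaussWeight R μ ε x : ℂ)) := by
      rw [← integral_const_mul]
      refine integral_congr_ae (Filter.Eventually.of_forall fun x => ?_)
      have := inner_mul_diffQuot (hR.norm_sq α hα) h x
      simp only []
      rw [← sub_mul, ← sub_mul, ← this]
      push_cast
      ring
    rw [s2, integral_sub (hint3 α) (hint4 α), s1, integral_const_mul]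
    ring
  rw [Finset.sum_congr rfl key2] at key
  linear_combination key

/-- The Dunkl operators are antisymmetric: the integral of `T_ξ (h e^{-|x|²/2})` against the
weight vanishes. -/
lemma integral_dunklOp_gaussWeight (hR : IsRootSystem R) (hμ : IsMultiplicity R μ)
    {h : RSpace N → ℂ} (hd : Differentiable ℝ h) (hb : ExpBdd h) (hb' : ExpBdd (fderiv ℝ h))
    (ξ : RSpace N) :
    ∫ x, (dunklOp R μ ξ h x - ((inner ℝ ξ x : ℝ) : ℂ) * h x) * (gaussWeight R μ 0 x : ℂ) = 0 := by
  have hhm : AEStronglyMeasurable h (volume : Measure (RSpace N)) :=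
    hd.continuous.aestronglyMeasurable
  have hξb : ExpBdd fun x => fderiv ℝ h x ξ := by
    have := (ExpBdd.const (N := N) ((‖ξ‖ : ℝ) : ℂ)).smul hb'
    refine this.mono fun x => ?_
    rw [norm_smul, Complex.norm_real, norm_norm, mul_comm]
    exact (fderiv ℝ h x).le_opNorm ξ
  have hξm : AEStronglyMeasurable (fun x => fderiv ℝ h x ξ) (volume : Measure (RSpace N)) :=
    (measurable_fderiv_apply_const ℝ h ξ).aestronglyMeasurable
  have him : AEStronglyMeasurable (fun x : RSpace N => ((inner ℝ ξ x : ℝ) : ℂ)) :=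
    (Complex.continuous_ofReal.comp (by fun_prop)).aestronglyMeasurable
  have hLb : ExpBdd fun x => fderiv ℝ h x ξ - ((inner ℝ ξ x : ℝ) : ℂ) * h x :=
    hξb.sub ((ExpBdd.inner ξ).mul hb)
  have hLm := hξm.sub (him.mul hhm)
  have hQb : ∀ α ∈ R, ExpBdd fun x => (μ α : ℂ) * diffQuot α h x := fun α hα =>
    (ExpBdd.const _).mul (expBdd_diffQuot hd hb' (hR.norm_sq α hα))
  have hQm : ∀ α, AEStronglyMeasurable (fun x => (μ α : ℂ) * diffQuot α h x) volume := fun α =>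
    ((measurable_diffQuot hd α).const_mul _).aestronglyMeasurable
  set e : ℕ → ℝ := fun n => 1 / ((n : ℝ) + 1) with he
  have he0 : ∀ n, 0 < e n := fun n => by positivity
  have he1 : ∀ n, e n ≤ 1 := fun n => by
    rw [he]; exact div_le_one_of_le₀ (by linarith [n.cast_nonneg (α := ℝ)]) (by positivity)
  have het : Filter.Tendsto e Filter.atTop (nhds 0) := tendsto_one_div_add_atTop_nhds_zero_nat
  have hW : ∀ x, Filter.Tendsto (fun n => (gaussWeight R μ (e n) x : ℂ)) Filter.atTop
      (nhds (gaussWeight R μ 0 x : ℂ)) := fun x =>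
    (Complex.continuous_ofReal.tendsto _).comp
      (((continuous_gaussWeight_left hμ x).tendsto 0).comp het)
  have lim1 : Filter.Tendsto (fun n => ∫ x, (fderiv ℝ h x ξ - ((inner ℝ ξ x : ℝ) : ℂ) * h x) *
      (gaussWeight R μ (e n) x : ℂ)) Filter.atTop (nhds (∫ x, (fderiv ℝ h x ξ -
        ((inner ℝ ξ x : ℝ) : ℂ) * h x) * (gaussWeight R μ 0 x : ℂ))) := by
    obtain ⟨b, hbi, hle⟩ := hLb.exists_bound hR hμ
    refine tendsto_integral_of_dominated_convergence b
      (fun n => (hLb.integrable hR hμ hLm (he0 n).le (he1 n)).aestronglyMeasurable) hbi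
      (fun n => Filter.Eventually.of_forall fun x => ?_)
      (Filter.Eventually.of_forall fun x => (hW x).const_mul _)
    rw [norm_mul, Complex.norm_real, Real.norm_of_nonneg (gaussWeight_nonneg (he0 n).le x)]
    exact hle _ (he0 n).le (he1 n) x
  have lim2 : ∀ α ∈ R, Filter.Tendsto (fun n => ∫ x, ((μ α : ℂ) * diffQuot α h x *
        (((inner ℝ α x : ℝ) ^ 2 / ((inner ℝ α x : ℝ) ^ 2 + e n) : ℝ) : ℂ)) *
          (gaussWeight R μ (e n) x : ℂ)) Filter.atTop
      (nhds (∫ x, ((μ α : ℂ) * diffQuot α h x) * (gaussWeight R μ 0 x : ℂ))) := by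
    intro α hα
    obtain ⟨b, hbi, hle⟩ := (hQb α hα).exists_bound hR hμ
    refine tendsto_integral_of_dominated_convergence b (fun n => ?_) hbi
      (fun n => Filter.Eventually.of_forall fun x => ?_)
      (Filter.Eventually.of_forall fun x => ?_)
    · refine ((hQm α).mul ?_).mul (Complex.continuous_ofReal.comp
        (continuous_gaussWeight hμ (e n))).aestronglyMeasurable
      refine Continuous.aestronglyMeasurable (Complex.continuous_ofReal.comp ?_)
      exact Continuous.div (by fun_prop) (by fun_prop) fun x => by have := he0 n; positivity
    · rw [norm_mul, norm_mul, Complex.norm_real, Complex.norm_real,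
        Real.norm_of_nonneg (gaussWeight_nonneg (he0 n).le x)]
      refine le_trans ?_ (hle _ (he0 n).le (he1 n) x)
      have h1 : ‖(inner ℝ α x : ℝ) ^ 2 / ((inner ℝ α x : ℝ) ^ 2 + e n)‖ ≤ 1 := by
        have := he0 n
        rw [Real.norm_of_nonneg (by positivity)]
        exact div_le_one_of_le₀ (by linarith) (by positivity)
      have := gaussWeight_nonneg (R := R) (μ := μ) (he0 n).le x
      gcongr
      exact mul_le_of_le_one_right (norm_nonneg _) h1
    -- On the hyperplane the ratio is 0 for every n and does not tend to 1. There either μ(α) = 0 or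
    -- the limiting weight vanishes, so the integrands still converge at every point.
    · by_cases hx : (inner ℝ α x : ℝ) = 0
      · by_cases hm : μ α = 0
        · simp [hm]
        · have h0 : gaussWeight R μ 0 x = 0 := by
            rw [gaussWeight, regWeight, Finset.prod_eq_zero hα, mul_zero]
            simp [hx, hm]
          simp [hx, h0]
      · refine Filter.Tendsto.mul ?_ (hW x)
        have : Filter.Tendsto (fun n => (inner ℝ α x : ℝ) ^ 2 / ((inner ℝ α x : ℝ) ^ 2 + e n))
            Filter.atTop (nhds 1) := by
          have h2 := (het.const_add ((inner ℝ α x : ℝ) ^ 2))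
          have h3 : Filter.Tendsto (fun n => (inner ℝ α x : ℝ) ^ 2 /
              ((inner ℝ α x : ℝ) ^ 2 + e n)) Filter.atTop
              (nhds ((inner ℝ α x : ℝ) ^ 2 / ((inner ℝ α x : ℝ) ^ 2 + 0))) :=
            tendsto_const_nhds.div h2 (by simpa using hx)
          simpa [hx] using h3
        simpa using ((Complex.continuous_ofReal.tendsto _).comp this).const_mul
          ((μ α : ℂ) * diffQuot α h x)
  have lim3 := tendsto_finsetSum R fun α hα =>
    ((lim2 α hα).const_mul ((inner ℝ α ξ : ℝ) : ℂ)).const_mul (1 / 2)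
  have heq := tendsto_nhds_unique (lim1.congr fun n =>
    integral_fderiv_gaussWeight hR hμ hd hb hb' ξ (he0 n) (he1 n)) lim3.neg
  have hi1 : Integrable fun x => (fderiv ℝ h x ξ - ((inner ℝ ξ x : ℝ) : ℂ) * h x) *
      (gaussWeight R μ 0 x : ℂ) := hLb.integrable hR hμ hLm le_rfl zero_le_one
  have hi2 : ∀ α ∈ R, Integrable fun x => ((μ α : ℂ) * diffQuot α h x) *
      (gaussWeight R μ 0 x : ℂ) := fun α hα =>
    (hQb α hα).integrable hR hμ (hQm α) le_rfl zero_le_one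
  have hsplit : ∀ x, (dunklOp R μ ξ h x - ((inner ℝ ξ x : ℝ) : ℂ) * h x) *
      (gaussWeight R μ 0 x : ℂ) = (fderiv ℝ h x ξ - ((inner ℝ ξ x : ℝ) : ℂ) * h x) *
      (gaussWeight R μ 0 x : ℂ) + ∑ α ∈ R, (1 / 2) * (((inner ℝ α ξ : ℝ) : ℂ) *
        (((μ α : ℂ) * diffQuot α h x) * (gaussWeight R μ 0 x : ℂ))) := by
    intro x
    rw [dunklOp, ← Finset.mul_sum]
    have : ∑ α ∈ R, (((inner ℝ α ξ : ℝ) : ℂ) *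
        (((μ α : ℂ) * diffQuot α h x) * (gaussWeight R μ 0 x : ℂ))) =
        (∑ α ∈ R, (μ α : ℂ) * ((inner ℝ α ξ : ℝ) : ℂ) * diffQuot α h x) *
          (gaussWeight R μ 0 x : ℂ) := by
      rw [Finset.sum_mul]
      exact Finset.sum_congr rfl fun α _ => by ring
    rw [this]
    ring
  simp only [hsplit]
  rw [integral_add hi1 (integrable_finsetSum _ fun α hα => ((hi2 α hα).const_mul _).const_mul _),
    integral_finsetSum _ fun α hα => ((hi2 α hα).const_mul _).const_mul _, heq]
  simp only [integral_const_mul]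
  ring

/-- The Leibniz rule fails only by the last term. Its first factor is even under σ_α and its second
is odd, so it will not contribute to integrals against an invariant weight. -/
lemma diffQuot_mul {α : RSpace N} (hα : ‖α‖ ^ 2 = 2) {f g : RSpace N → ℂ}
    (hf : Differentiable ℝ f) (hg : Differentiable ℝ g) (x : RSpace N) :
    diffQuot α (fun x => f x * g x) x = diffQuot α f x * g x + f x * diffQuot α g x -
      diffQuot α f x * (g x - g (rootRefl α x)) := by
  unfold diffQuot
  split_ifs with h
  · rw [fderiv_fun_mul (hf x) (hg x), rootRefl_apply hα, h]
    simp
    ring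
  · have : ((inner ℝ α x : ℝ) : ℂ) ≠ 0 := by exact_mod_cast h
    field_simp
    ring

/-- Antisymmetry of the Dunkl operators on products. -/
lemma integral_dunklOp_mul (hR : IsRootSystem R) (hμ : IsMultiplicity R μ)
    {f g : RSpace N → ℂ} (hf : Differentiable ℝ f) (hfb : ExpBdd f) (hfb' : ExpBdd (fderiv ℝ f))
    (hg : Differentiable ℝ g) (hgb : ExpBdd g) (hgb' : ExpBdd (fderiv ℝ g)) (ξ : RSpace N) :
    ∫ x, (dunklOp R μ ξ f x * g x + f x * dunklOp R μ ξ g x - ((inner ℝ ξ x : ℝ) : ℂ) *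
      (f x * g x)) * (gaussWeight R μ 0 x : ℂ) = 0 := by
  have hfg : Differentiable ℝ fun x => f x * g x := hf.mul hg
  have hfgb : ExpBdd fun x => f x * g x := hfb.mul hgb
  have hfgb' : ExpBdd (fderiv ℝ fun x => f x * g x) := by
    rw [show (fderiv ℝ fun x => f x * g x) = fun x => f x • fderiv ℝ g x + g x • fderiv ℝ f x from
      funext fun x => fderiv_fun_mul (hf x) (hg x)]
    exact (hfb.smul hgb').add (hgb.smul hfb')
  have hmain := integral_dunklOp_gaussWeight hR hμ hfg hfgb hfgb' ξ
  have hob : ∀ α ∈ R, ExpBdd fun x => diffQuot α f x * (g x - g (rootRefl α x)) := fun α hα =>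
    (expBdd_diffQuot hf hfb' (hR.norm_sq α hα)).mul (hgb.sub (hgb.comp_rootRefl α))
  have hoi : ∀ α ∈ R, Integrable fun x => diffQuot α f x * (g x - g (rootRefl α x)) *
      (gaussWeight R μ 0 x : ℂ) := fun α hα =>
    (hob α hα).integrable hR hμ ((measurable_diffQuot hf α).aestronglyMeasurable.mul
      (hg.continuous.sub (hg.continuous.comp (rootRefl α).continuous)).aestronglyMeasurable)
      le_rfl zero_le_one
  -- The Leibniz defect is odd under σ_α: the substitution x ↦ σ_αx shows that the integral is its
  -- own negative.
  have ho : ∀ α ∈ R, ∫ x, diffQuot α f x * (g x - g (rootRefl α x)) *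
      (gaussWeight R μ 0 x : ℂ) = 0 := by
    intro α hα
    rw [← self_eq_neg, ← integral_neg, ← integral_comp_rootRefl α]
    refine integral_congr_ae (Filter.Eventually.of_forall fun x => ?_)
    have hin : (inner ℝ α (rootRefl α x) : ℝ) = -inner ℝ α x := by
      rw [rootRefl_apply (hR.norm_sq α hα), inner_sub_right, inner_smul_right,
        real_inner_self_eq_norm_sq, hR.norm_sq α hα]
      ring
    simp only [rootRefl_involutive, gaussWeight_rootRefl hR hμ hα]
    by_cases h : (inner ℝ α x : ℝ) = 0
    · have : rootRefl α x = x := by rw [rootRefl_apply (hR.norm_sq α hα), h]; simp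
      simp [this]
    · have h' : ((inner ℝ α x : ℝ) : ℂ) ≠ 0 := by exact_mod_cast h
      simp only [diffQuot, hin, neg_eq_zero, h, if_false, rootRefl_involutive]
      push_cast
      field_simp
      ring
  have hsplit : ∀ x, (dunklOp R μ ξ f x * g x + f x * dunklOp R μ ξ g x - ((inner ℝ ξ x : ℝ) : ℂ) *
      (f x * g x)) * (gaussWeight R μ 0 x : ℂ) =
      (dunklOp R μ ξ (fun x => f x * g x) x - ((inner ℝ ξ x : ℝ) : ℂ) * (f x * g x)) *
        (gaussWeight R μ 0 x : ℂ) + ∑ α ∈ R, (1 / 2) * ((μ α : ℂ) * ((inner ℝ α ξ : ℝ) : ℂ)) *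
          (diffQuot α f x * (g x - g (rootRefl α x)) * (gaussWeight R μ 0 x : ℂ)) := by
    intro x
    have h1 : dunklOp R μ ξ (fun x => f x * g x) x = dunklOp R μ ξ f x * g x +
        f x * dunklOp R μ ξ g x - (1 / 2) * ∑ α ∈ R, (μ α : ℂ) * ((inner ℝ α ξ : ℝ) : ℂ) *
          (diffQuot α f x * (g x - g (rootRefl α x))) := by
      unfold dunklOp
      rw [Finset.sum_congr rfl fun α hα => by rw [diffQuot_mul (hR.norm_sq α hα) hf hg]]
      rw [fderiv_fun_mul (hf x) (hg x)]
      simp only [mul_add, mul_sub, Finset.sum_add_distrib, Finset.sum_sub_distrib, add_mul,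
        Finset.sum_mul, Finset.mul_sum]
      simp
      have e1 : ∀ α, 2⁻¹ * ((μ α : ℂ) * ((inner ℝ α ξ : ℝ) : ℂ) * (diffQuot α f x * g x)) =
        2⁻¹ * ((μ α : ℂ) * ((inner ℝ α ξ : ℝ) : ℂ) * diffQuot α f x) * g x := fun α => by ring
      have e2 : ∀ α, 2⁻¹ * ((μ α : ℂ) * ((inner ℝ α ξ : ℝ) : ℂ) * (f x * diffQuot α g x)) =
        f x * (2⁻¹ * ((μ α : ℂ) * ((inner ℝ α ξ : ℝ) : ℂ) * diffQuot α g x)) := fun α => by ring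
      simp only [e1, e2]
      ring
    rw [h1, Finset.mul_sum]
    have e3 : ∑ α ∈ R, (1 / 2) * ((μ α : ℂ) * ((inner ℝ α ξ : ℝ) : ℂ)) *
          (diffQuot α f x * (g x - g (rootRefl α x)) * (gaussWeight R μ 0 x : ℂ)) =
        (∑ α ∈ R, (1 / 2) * ((μ α : ℂ) * ((inner ℝ α ξ : ℝ) : ℂ) *
          (diffQuot α f x * (g x - g (rootRefl α x))))) * (gaussWeight R μ 0 x : ℂ) := by
      rw [Finset.sum_mul]
      exact Finset.sum_congr rfl fun α _ => by ring
    rw [e3]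
    ring
  simp only [hsplit]
  have hTb : ExpBdd fun x => dunklOp R μ ξ (fun x => f x * g x) x -
      ((inner ℝ ξ x : ℝ) : ℂ) * (f x * g x) := by
    refine ExpBdd.sub (ExpBdd.add ?_ ((ExpBdd.const _).mul (ExpBdd.sum fun α hα =>
      (ExpBdd.const _).mul (expBdd_diffQuot hfg hfgb' (hR.norm_sq α hα)))))
      ((ExpBdd.inner ξ).mul hfgb)
    have := (ExpBdd.const (N := N) ((‖ξ‖ : ℝ) : ℂ)).smul hfgb'
    refine this.mono fun x => ?_
    rw [norm_smul, Complex.norm_real, norm_norm, mul_comm]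
    exact (fderiv ℝ _ x).le_opNorm ξ
  have hTm : AEStronglyMeasurable (fun x => dunklOp R μ ξ (fun x => f x * g x) x -
      ((inner ℝ ξ x : ℝ) : ℂ) * (f x * g x)) volume := by
    refine ((measurable_fderiv_apply_const ℝ _ ξ).add ((Finset.measurable_fun_sum _ fun α _ =>
      (measurable_diffQuot hfg α).const_mul _).const_mul _)).aestronglyMeasurable.sub ?_
    exact ((Complex.continuous_ofReal.comp (by fun_prop)).mul
      hfg.continuous).aestronglyMeasurable
  rw [integral_add (hTb.integrable hR hμ hTm le_rfl zero_le_one)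
    (integrable_finsetSum _ fun α hα => (hoi α hα).const_mul _), hmain,
    integral_finsetSum _ fun α hα => (hoi α hα).const_mul _, zero_add]
  refine Finset.sum_eq_zero fun α hα => ?_
  rw [integral_const_mul, ho α hα, mul_zero]

end Weight

/-! ### The Gaussian identity for the Dunkl kernel -/

section Gaussian

variable {R : Finset (RSpace N)} {μ : RSpace N → ℝ} {E : CSpace N → CSpace N → ℂ}

lemma IsEulerKernel.expBdd (hR : IsRootSystem R) (hμ : IsMultiplicity R μ)
    (hE : IsEulerKernel R μ E) (w : CSpace N) : ExpBdd fun x => E (toC x) w := by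
  refine ⟨1, ‖w‖, zero_le_one, norm_nonneg _, fun x => ?_⟩
  simpa [mul_comm] using hE.norm_le hR hμ (toC x) w

lemma IsEulerKernel.differentiable_toC (hE : IsEulerKernel R μ E) (w : CSpace N) :
    Differentiable ℝ fun x => E (toC x) w := fun x =>
  ((differentiable_left hE.holomorphic w (toC x)).restrictScalars ℝ).comp x
    (toCL (N := N)).differentiableAt

/-- Cauchy's estimate on the unit circle in direction ξ: the point moves by at most 1, at the cost
of a factor e^{‖w‖}. -/
lemma IsEulerKernel.expBdd_fderiv (hR : IsRootSystem R) (hμ : IsMultiplicity R μ)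
    (hE : IsEulerKernel R μ E) (w : CSpace N) : ExpBdd (fderiv ℝ fun x => E (toC x) w) := by
  refine ⟨Real.exp ‖w‖, ‖w‖, (Real.exp_pos _).le, norm_nonneg _, fun x => ?_⟩
  refine ContinuousLinearMap.opNorm_le_of_unit_norm (by positivity) fun ξ hξ => ?_
  have hd := differentiable_left hE.holomorphic w
  have h1 := Dunkl.hasDerivAt_line hd (toC x) (toC ξ) 0
  rw [fderiv_comp_toC hd]
  simp only [zero_smul, add_zero] at h1
  rw [← h1.deriv]
  have := Complex.norm_deriv_le_of_forall_mem_sphere_norm_le (c := 0) one_pos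
    (differentiable_line hd (toC x) (toC ξ)).diffContOnCl
    (C := Real.exp ‖w‖ * Real.exp (‖w‖ * ‖x‖)) (fun l hl => by
      refine (hE.norm_le hR hμ _ w).trans ?_
      rw [← Real.exp_add, Real.exp_le_exp]
      have hl' : ‖l‖ = 1 := by simpa using hl
      have : ‖toC x + l • toC ξ‖ ≤ ‖x‖ + 1 := by
        refine (norm_add_le _ _).trans ?_
        rw [norm_smul, hl', norm_toC, norm_toC, hξ, one_mul]
      nlinarith [norm_nonneg w])
  simpa using this

/-- The Gaussian pairing of two Dunkl kernels. -/
noncomputable def gaussPairing (R : Finset (RSpace N)) (μ : RSpace N → ℝ)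
    (E : CSpace N → CSpace N → ℂ) (z w : CSpace N) : ℂ :=
  ∫ q : RSpace N, E (toC q) z * E (toC q) w * (gaussWeight R μ 0 q : ℂ)

lemma IsEulerKernel.integrable_mul (hR : IsRootSystem R) (hμ : IsMultiplicity R μ)
    (hE : IsEulerKernel R μ E) {k : RSpace N → ℂ} (hk : Continuous k) (hkb : ExpBdd k)
    (z w : CSpace N) :
    Integrable fun q => k q * (E (toC q) z * E (toC q) w * (gaussWeight R μ 0 q : ℂ)) := by
  have := (hkb.mul ((hE.expBdd hR hμ z).mul (hE.expBdd hR hμ w))).integrable hR hμ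
    (hk.mul ((hE.differentiable_toC z).continuous.mul
      (hE.differentiable_toC w).continuous)).aestronglyMeasurable le_rfl zero_le_one
  simpa [mul_assoc] using this

lemma integrable_pairing (hR : IsRootSystem R) (hμ : IsMultiplicity R μ)
    (hE : IsEulerKernel R μ E) (z w : CSpace N) :
    Integrable fun q => E (toC q) z * E (toC q) w * (gaussWeight R μ 0 q : ℂ) := by
  simpa using hE.integrable_mul hR hμ (continuous_const (y := (1 : ℂ))) (ExpBdd.const 1) z w

lemma continuous_toC : Continuous (toC : RSpace N → CSpace N) := (toCL (N := N)).continuous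

lemma expBdd_bilin (v : CSpace N) : ExpBdd fun q : RSpace N => bilin v (toC q) := by
  have h := (ExpBdd.const (N := N) ((‖v‖ : ℝ) : ℂ)).mul (k := fun q => ((‖q‖ : ℝ) : ℂ))
    (ExpBdd.of_le 1 1 zero_le_one zero_le_one fun x => by
      rw [Complex.norm_real, norm_norm, one_mul, one_mul]
      linarith [Real.add_one_le_exp ‖x‖])
  refine h.mono fun q => (norm_bilin_le v _).trans ?_
  simp

/-- Antisymmetry with the two factors E(·,z) and E(·,w): the eigenvalue equation turns the two Dunkl
derivatives into ⟨v,z⟩ and ⟨v,w⟩. Real v come first, complex v by linearity. -/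
lemma integral_bilin_mul (hR : IsRootSystem R) (hμ : IsMultiplicity R μ)
    (hE : IsDunklKernel R μ E) (v z w : CSpace N) :
    ∫ q : RSpace N, bilin v (toC q) * (E (toC q) z * E (toC q) w * (gaussWeight R μ 0 q : ℂ)) =
      bilin v (z + w) * gaussPairing R μ E z w := by
  have hEe := hE.isEulerKernel hR
  have hb : ∀ v : CSpace N, Continuous fun q : RSpace N => bilin v (toC q) := fun v =>
    (bilin v).continuous.comp continuous_toC
  have hreal : ∀ ξ : RSpace N, ∫ q : RSpace N, bilin (toC ξ) (toC q) *
      (E (toC q) z * E (toC q) w * (gaussWeight R μ 0 q : ℂ)) =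
      bilin (toC ξ) (z + w) * gaussPairing R μ E z w := by
    intro ξ
    have h := integral_dunklOp_mul hR hμ (hEe.differentiable_toC z) (hEe.expBdd hR hμ z)
      (hEe.expBdd_fderiv hR hμ z) (hEe.differentiable_toC w) (hEe.expBdd hR hμ w)
      (hEe.expBdd_fderiv hR hμ w) ξ
    have e : ∀ q : RSpace N, (dunklOp R μ ξ (fun x => E (toC x) z) q * E (toC q) w +
        E (toC q) z * dunklOp R μ ξ (fun x => E (toC x) w) q -
          ((inner ℝ ξ q : ℝ) : ℂ) * (E (toC q) z * E (toC q) w)) * (gaussWeight R μ 0 q : ℂ) =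
        bilin (toC ξ) (z + w) * (E (toC q) z * E (toC q) w * (gaussWeight R μ 0 q : ℂ)) -
          bilin (toC ξ) (toC q) * (E (toC q) z * E (toC q) w * (gaussWeight R μ 0 q : ℂ)) := by
      intro q
      rw [hE.dunklOp_eq hR, hE.dunklOp_eq hR, bilin_toC, map_add]
      ring
    simp only [e] at h
    rw [integral_sub ((integrable_pairing hR hμ hEe z w).const_mul _)
      (hEe.integrable_mul hR hμ (hb _) (expBdd_bilin _) z w), integral_const_mul,
      sub_eq_zero] at h
    exact h.symm
  obtain ⟨x, y, rfl⟩ := exists_toC_add v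
  have i1 := hEe.integrable_mul hR hμ (hb (toC x)) (expBdd_bilin (toC x)) z w
  have i2 := (hEe.integrable_mul hR hμ (hb (toC y)) (expBdd_bilin (toC y)) z w).const_mul Complex.I
  simp only [bilin_add_left, bilin_smul_left, add_mul, mul_assoc Complex.I]
  rw [integral_add i1 i2, integral_const_mul, hreal, hreal]

lemma gaussPairing_comm (z w : CSpace N) : gaussPairing R μ E z w = gaussPairing R μ E w z := by
  unfold gaussPairing
  simp only [mul_comm (E _ z)]

lemma IsEulerKernel.exists_pairing_bound (hR : IsRootSystem R) (hμ : IsMultiplicity R μ)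
    (hE : IsEulerKernel R μ E) (z : CSpace N) {r : ℝ} (hr : 0 ≤ r) : ∃ b : RSpace N → ℝ,
      Integrable b ∧ ∀ q w, ‖w‖ ≤ r →
        ‖E (toC q) z * E (toC q) w * (gaussWeight R μ 0 q : ℂ)‖ ≤ b q := by
  have h : ExpBdd fun q : RSpace N => ((Real.exp ((‖z‖ + r) * ‖q‖) : ℝ) : ℂ) :=
    ⟨1, ‖z‖ + r, zero_le_one, by positivity, fun q => by
      rw [Complex.norm_real, Real.norm_eq_abs, Real.abs_exp, one_mul]⟩
  obtain ⟨b, hb, hle⟩ := h.exists_bound hR hμ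
  refine ⟨b, hb, fun q w hw => le_trans ?_ (hle 0 le_rfl zero_le_one q)⟩
  have hg := gaussWeight_nonneg (R := R) (μ := μ) le_rfl q
  rw [norm_mul, Complex.norm_real, Real.norm_of_nonneg hg, Complex.norm_real, Real.norm_eq_abs,
    Real.abs_exp, norm_mul, add_mul, Real.exp_add]
  gcongr
  · simpa [mul_comm] using hE.norm_le hR hμ (toC q) z
  · refine (hE.norm_le hR hμ (toC q) w).trans ?_
    rw [norm_toC, mul_comm]
    gcongr

/-- Under the integral, the Euler equation of w ↦ E(q,w) produces a factor ⟨w,q⟩, which integrates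
to ⟨w,z+w⟩ times the pairing. The reflection-invariant Gaussian e^{-w²/2} removes ⟨w,w⟩, and the
equation with spectral parameter z remains. -/
lemma gaussPairing_isEulerSolution (hR : IsRootSystem R) (hμ : IsMultiplicity R μ)
    (hE : IsDunklKernel R μ E) (z : CSpace N) :
    IsEulerSolution R μ z
      (fun w => Complex.exp (-bilin w w / 2) * gaussPairing R μ E z w) := by
  have hEe := hE.isEulerKernel hR
  have hm : ∀ w, AEStronglyMeasurable
      (fun q => E (toC q) z * E (toC q) w * (gaussWeight R μ 0 q : ℂ)) volume := fun w =>
    (integrable_pairing hR hμ hEe z w).aestronglyMeasurable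
  have hslice : ∀ (w : CSpace N) (q : RSpace N) (l : ℂ), HasDerivAt (fun l : ℂ => E (toC q) z *
      E (toC q) (l • w) * (gaussWeight R μ 0 q : ℂ)) (E (toC q) z *
      deriv (fun l : ℂ => E (toC q) (l • w)) l * (gaussWeight R μ 0 q : ℂ)) l := fun w q l =>
    ((((hEe.isEulerSolution_right hR hμ (toC q)).differentiable w) l).hasDerivAt.const_mul
      _).mul_const _
  have hder : ∀ (w : CSpace N) (l : ℂ),
      Integrable (fun q : RSpace N => E (toC q) z *
        deriv (fun l : ℂ => E (toC q) (l • w)) l * (gaussWeight R μ 0 q : ℂ)) ∧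
      HasDerivAt (fun l : ℂ => gaussPairing R μ E z (l • w))
        (∫ q : RSpace N, E (toC q) z * deriv (fun l : ℂ => E (toC q) (l • w)) l *
          (gaussWeight R μ 0 q : ℂ)) l := by
    intro w l
    obtain ⟨b, hb, hle⟩ := hEe.exists_pairing_bound hR hμ z
      (r := (‖l‖ + 2) * ‖w‖) (by positivity)
    have := hasDerivAt_integral_of_entire (m := (volume : Measure (RSpace N)))
      (F := fun l q => E (toC q) z * E (toC q) (l • w) * (gaussWeight R μ 0 q : ℂ))
      (fun q l => (hslice w q l).differentiableAt) (fun l => hm _) l hb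
      (fun q l' hl' => hle q _ (by
        rw [norm_smul]
        gcongr
        calc ‖l'‖ = ‖l + (l' - l)‖ := by ring_nf
          _ ≤ ‖l‖ + ‖l' - l‖ := norm_add_le _ _
          _ ≤ ‖l‖ + 2 := by linarith))
    simpa only [(hslice w _ l).deriv] using! this
  have hexp : ∀ (w : CSpace N) (l : ℂ), HasDerivAt (fun l : ℂ =>
      Complex.exp (-bilin (l • w) (l • w) / 2))
      (Complex.exp (-bilin (l • w) (l • w) / 2) * (-l * bilin w w)) l := by
    intro w l
    have h1 : HasDerivAt (fun l : ℂ => -bilin (l • w) (l • w) / 2) (-l * bilin w w) l := by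
      have : (fun l : ℂ => -bilin (l • w) (l • w) / 2) = fun l => l ^ 2 * (-bilin w w / 2) := by
        ext l
        rw [bilin_smul_left, map_smul, smul_eq_mul]
        ring
      rw [this]
      convert! ((hasDerivAt_id l).pow 2).mul_const (-bilin w w / 2) using 1
      simp
      ring
    exact h1.cexp
  refine ⟨fun w l => ((hexp w l).mul (hder w l).2).differentiableAt, fun w l => ?_, fun r => ?_⟩
  · rw [((hexp w l).fun_mul (hder w l).2).deriv]
    have hσ : ∀ α ∈ R, bilin (l • reflC α w) (l • reflC α w) = bilin (l • w) (l • w) := by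
      intro α hα
      rw [← map_smul, bilin_reflC_reflC (hR.norm_sq α hα)]
    have hmain : l * (∫ q : RSpace N, E (toC q) z * deriv (fun l : ℂ => E (toC q) (l • w)) l *
          (gaussWeight R μ 0 q : ℂ)) + (1 / 2) * ∑ α ∈ R, (μ α : ℂ) *
            (gaussPairing R μ E z (l • w) - gaussPairing R μ E z (l • reflC α w)) =
        l * (bilin w (z + l • w) * gaussPairing R μ E z (l • w)) := by
      rw [← integral_bilin_mul hR hμ hE, ← integral_const_mul, ← integral_const_mul]
      have hip := fun w => integrable_pairing hR hμ hEe z w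
      have e1 : ∀ α ∈ R, (μ α : ℂ) *
            (gaussPairing R μ E z (l • w) - gaussPairing R μ E z (l • reflC α w)) =
          ∫ q : RSpace N, (μ α : ℂ) * (E (toC q) z * E (toC q) (l • w) * (gaussWeight R μ 0 q : ℂ) -
            E (toC q) z * E (toC q) (l • reflC α w) * (gaussWeight R μ 0 q : ℂ)) := by
        intro α _
        rw [integral_const_mul, integral_sub (hip _) (hip _)]
        rfl
      have hi : ∀ α ∈ R, Integrable fun q : RSpace N => (μ α : ℂ) *
          (E (toC q) z * E (toC q) (l • w) * (gaussWeight R μ 0 q : ℂ) -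
            E (toC q) z * E (toC q) (l • reflC α w) * (gaussWeight R μ 0 q : ℂ)) := fun α _ =>
        ((hip _).sub (hip _)).const_mul _
      rw [Finset.sum_congr rfl e1, ← integral_finsetSum _ hi, ← integral_const_mul,
        ← integral_add ((hder w l).1.const_mul _) ((integrable_finsetSum _ hi).const_mul _)]
      refine integral_congr_ae (Filter.Eventually.of_forall fun q => ?_)
      have h := (hEe.isEulerSolution_right hR hμ (toC q)).equation w l
      have e2 : ∑ α ∈ R, (μ α : ℂ) *
          (E (toC q) z * E (toC q) (l • w) * (gaussWeight R μ 0 q : ℂ) -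
            E (toC q) z * E (toC q) (l • reflC α w) * (gaussWeight R μ 0 q : ℂ)) =
          (E (toC q) z * (gaussWeight R μ 0 q : ℂ)) *
            ∑ α ∈ R, (μ α : ℂ) * (E (toC q) (l • w) - E (toC q) (l • reflC α w)) := by
        rw [Finset.mul_sum]
        exact Finset.sum_congr rfl fun α _ => by ring
      simp only [e2]
      linear_combination (E (toC q) z * (gaussWeight R μ 0 q : ℂ)) * h
    have e3 : ∑ α ∈ R, (μ α : ℂ) * (Complex.exp (-bilin (l • w) (l • w) / 2) *
        gaussPairing R μ E z (l • w) - Complex.exp (-bilin (l • reflC α w) (l • reflC α w) / 2) *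
          gaussPairing R μ E z (l • reflC α w)) = Complex.exp (-bilin (l • w) (l • w) / 2) *
        ∑ α ∈ R, (μ α : ℂ) *
          (gaussPairing R μ E z (l • w) - gaussPairing R μ E z (l • reflC α w)) := by
      rw [Finset.mul_sum]
      refine Finset.sum_congr rfl fun α hα => ?_
      rw [hσ α hα]
      ring
    rw [e3]
    rw [map_add, map_smul, smul_eq_mul] at hmain
    linear_combination Complex.exp (-bilin (l • w) (l • w) / 2) * hmain
  · obtain ⟨b, hb, hle⟩ := hEe.exists_pairing_bound hR hμ z (r := |r|) (abs_nonneg r)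
    refine ⟨Real.exp (r ^ 2) * ∫ q, b q, fun w hw => ?_⟩
    rw [norm_mul]
    have h1 : ‖Complex.exp (-bilin w w / 2)‖ ≤ Real.exp (r ^ 2) := by
      refine (Complex.norm_exp_le_exp_norm _).trans (Real.exp_le_exp.2 ?_)
      rw [norm_div, norm_neg]
      have h2 := norm_bilin_le w w
      have h3 : ‖w‖ * ‖w‖ ≤ r ^ 2 := by nlinarith [norm_nonneg w]
      norm_num
      nlinarith [norm_nonneg (bilin w w)]
    have h2 : ‖gaussPairing R μ E z w‖ ≤ ∫ q, b q :=
      norm_integral_le_of_norm_le hb (Filter.Eventually.of_forall fun q =>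
        hle q w (hw.trans (le_abs_self r)))
    gcongr

/-- The Gaussian reproducing identity of the Dunkl kernel. -/
lemma gaussPairing_eq (hR : IsRootSystem R) (hμ : IsMultiplicity R μ)
    (hE : IsDunklKernel R μ E) (z w : CSpace N) :
    gaussPairing R μ E z w =
      Complex.exp ((bilin z z + bilin w w) / 2) * (gaussPairing R μ E 0 0 * E z w) := by
  have hEe := hE.isEulerKernel hR
  -- Uniqueness fixes the pairing up to its value at w = 0. Symmetry of the pairing and a second use
  -- with (0,z) reduce that value to the pairing at (0,0).
  have step : ∀ z w, gaussPairing R μ E z w =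
      Complex.exp (bilin w w / 2) * (gaussPairing R μ E z 0 * E w z) := by
    intro z w
    have h := congrFun ((gaussPairing_isEulerSolution hR hμ hE z).eq_of_zero hR hμ
      ((hEe.isEulerSolution z).const_mul (gaussPairing R μ E z 0))
      (by simp [hEe.normalized])) w
    rw [← h, ← mul_assoc, ← Complex.exp_add]
    rw [show bilin w w / 2 + -bilin w w / 2 = 0 by ring, Complex.exp_zero, one_mul]
  rw [step z w, gaussPairing_comm z 0, step 0 z, hEe.right_zero hR hμ, mul_one,
    hEe.symm hR hμ w z, add_div, Complex.exp_add]
  ring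

lemma weightTilde_one (x : RSpace N) : weightTilde R μ 1 x = regWeight R μ 0 x := by
  rw [weightTilde, Real.one_rpow, one_mul, regWeight_zero]

lemma mmsConst_eq : mmsConst R μ = ∫ x, gaussWeight R μ 0 x := by
  unfold mmsConst gaussWeight
  simp only [weightTilde_one, mul_comm]

lemma gaussPairing_zero_zero (hR : IsRootSystem R) (hμ : IsMultiplicity R μ)
    (hE : IsEulerKernel R μ E) : gaussPairing R μ E 0 0 = (mmsConst R μ : ℂ) := by
  rw [mmsConst_eq, ← integral_complex_ofReal]
  simp [gaussPairing, hE.right_zero hR hμ]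

lemma mmsConst_pos (hR : IsRootSystem R) (hμ : IsMultiplicity R μ) : 0 < mmsConst R μ := by
  rw [mmsConst_eq]
  have hi : Integrable (gaussWeight R μ 0 : RSpace N → ℝ) := by
    have := ((ExpBdd.const (N := N) (1 : ℂ)).integrable hR hμ
      aestronglyMeasurable_const le_rfl zero_le_one).re
    simpa using! this
  rw [integral_pos_iff_support_of_nonneg (fun x => gaussWeight_nonneg le_rfl x) hi]
  refine IsOpen.measure_pos _ ((continuous_gaussWeight hμ 0).isOpen_support) ?_
  -- Finitely many root hyperplanes do not cover ℝᴺ. At a point off all of them the continuous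
  -- weight is positive, so its open support is non-empty.
  obtain ⟨x, hx⟩ := Module.Dual.exists_forall_ne_zero_of_forall_exists (K := ℝ)
    (fun α : R => (innerₛₗ ℝ (α : RSpace N))) (fun α => ⟨α, by simpa using hR.ne_zero α α.2⟩)
  refine ⟨x, ?_⟩
  rw [Function.mem_support, gaussWeight, regWeight_zero]
  refine mul_ne_zero (Real.exp_ne_zero _) (Finset.prod_ne_zero_iff.2 fun α hα => ?_)
  exact (Real.rpow_pos_of_pos (abs_pos.2 (hx ⟨α, hα⟩)) _).ne'

end Gaussian

/-! ### Dunkl operators on polynomials -/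

section Existence

variable {R : Finset (RSpace N)} {μ : RSpace N → ℝ}

lemma diffQuot_add (α : RSpace N) {f g : RSpace N → ℂ} (hf : Differentiable ℝ f)
    (hg : Differentiable ℝ g) (x : RSpace N) :
    diffQuot α (fun x => f x + g x) x = diffQuot α f x + diffQuot α g x := by
  unfold diffQuot
  split_ifs with h
  · rw [fderiv_fun_add (hf x) (hg x)]
    simp [mul_add]
  · ring

lemma diffQuot_const_mul (α : RSpace N) {f : RSpace N → ℂ} (hf : Differentiable ℝ f) (c : ℂ)
    (x : RSpace N) : diffQuot α (fun x => c * f x) x = c * diffQuot α f x := by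
  unfold diffQuot
  split_ifs with h
  · rw [fderiv_const_mul (hf x)]
    simp
    ring
  · ring

lemma dunklOp_add (ξ : RSpace N) {f g : RSpace N → ℂ} (hf : Differentiable ℝ f)
    (hg : Differentiable ℝ g) (x : RSpace N) :
    dunklOp R μ ξ (fun x => f x + g x) x = dunklOp R μ ξ f x + dunklOp R μ ξ g x := by
  unfold dunklOp
  simp only [diffQuot_add _ hf hg, mul_add, Finset.sum_add_distrib]
  rw [fderiv_fun_add (hf x) (hg x), add_apply]
  ring

lemma dunklOp_const_mul (ξ : RSpace N) {f : RSpace N → ℂ} (hf : Differentiable ℝ f) (c : ℂ)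
    (x : RSpace N) : dunklOp R μ ξ (fun x => c * f x) x = c * dunklOp R μ ξ f x := by
  unfold dunklOp
  simp only [diffQuot_const_mul _ hf, mul_add, mul_left_comm _ c, ← Finset.mul_sum]
  rw [fderiv_const_mul (hf x)]
  simp

lemma dunklOp_zero (ξ x : RSpace N) : dunklOp R μ ξ (fun _ => 0) x = 0 := by
  simpa using dunklOp_const_mul (R := R) (μ := μ) ξ (f := fun _ => 0) (differentiable_const _) 0 x

lemma dunklOp_sum {ι : Type*} (s : Finset ι) (ξ : RSpace N) {f : ι → RSpace N → ℂ}
    (hf : ∀ i, Differentiable ℝ (f i)) (x : RSpace N) :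
    dunklOp R μ ξ (fun x => ∑ i ∈ s, f i x) x = ∑ i ∈ s, dunklOp R μ ξ (f i) x := by
  classical
  induction s using Finset.induction_on with
  | empty => simpa using dunklOp_zero ξ x
  | insert i s hi ih =>
    simp only [Finset.sum_insert hi]
    rw [dunklOp_add ξ (hf i) (Differentiable.fun_sum fun i _ => hf i), ih]

lemma dunklOp_const (ξ : RSpace N) (c : ℂ) (x : RSpace N) : dunklOp R μ ξ (fun _ => c) x = 0 := by
  simp [dunklOp, diffQuot]

lemma dunklOp_add_left (ξ η : RSpace N) (f : RSpace N → ℂ) (x : RSpace N) :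
    dunklOp R μ (ξ + η) f x = dunklOp R μ ξ f x + dunklOp R μ η f x := by
  simp only [dunklOp, map_add, inner_add_right, Complex.ofReal_add, mul_add, add_mul,
    Finset.sum_add_distrib]
  ring

lemma dunklOp_smul_left (c : ℝ) (ξ : RSpace N) (f : RSpace N → ℂ) (x : RSpace N) :
    dunklOp R μ (c • ξ) f x = c * dunklOp R μ ξ f x := by
  simp only [dunklOp, map_smul, inner_smul_right, Complex.ofReal_mul, Complex.real_smul, mul_add,
    Finset.mul_sum]
  congr 1
  exact Finset.sum_congr rfl fun α _ => by ring

/-- The Dunkl operators depend linearly on the direction. -/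
noncomputable def dunklOpLeft (R : Finset (RSpace N)) (μ : RSpace N → ℝ) (f : RSpace N → ℂ)
    (x : RSpace N) : RSpace N →ₗ[ℝ] ℂ where
  toFun ξ := dunklOp R μ ξ f x
  map_add' ξ η := dunklOp_add_left ξ η f x
  map_smul' c ξ := by simpa using dunklOp_smul_left c ξ f x

lemma dunklOp_eq_sum (ξ : RSpace N) (f : RSpace N → ℂ) (x : RSpace N) :
    dunklOp R μ ξ f x = ∑ i, ((ξ i : ℝ) : ℂ) * dunklOp R μ (EuclideanSpace.single i 1) f x := by
  have h : ξ = ∑ i, ξ i • EuclideanSpace.single i (1 : ℝ) := by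
    ext j
    simp [Pi.single_apply]
  have h2 := congrArg (dunklOpLeft R μ f x) h
  rw [map_sum] at h2
  simp only [map_smul, Complex.real_smul] at h2
  exact h2

lemma dunklOp_rootRefl_left {α : RSpace N} (hα : ‖α‖ ^ 2 = 2) (ξ : RSpace N) (f : RSpace N → ℂ)
    (x : RSpace N) : dunklOp R μ (rootRefl α ξ) f x =
      dunklOp R μ ξ f x - ((inner ℝ α ξ : ℝ) : ℂ) * dunklOp R μ α f x := by
  have h : ξ = rootRefl α ξ + (inner ℝ α ξ : ℝ) • α := by rw [rootRefl_apply hα]; abel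
  conv_rhs => rw [h, dunklOp_add_left, dunklOp_smul_left]
  rw [← h]
  ring

lemma differentiable_inner_ofReal (v : RSpace N) :
    Differentiable ℝ fun x : RSpace N => ((inner ℝ v x : ℝ) : ℂ) := by
  have : (fun x : RSpace N => ((inner ℝ v x : ℝ) : ℂ)) = Complex.ofRealCLM ∘ fun x => inner ℝ v x :=
    rfl
  rw [this]
  exact Complex.ofRealCLM.differentiable.comp (innerSL ℝ v).differentiable

lemma fderiv_inner_ofReal (v x ξ : RSpace N) :
    fderiv ℝ (fun x : RSpace N => ((inner ℝ v x : ℝ) : ℂ)) x ξ = ((inner ℝ v ξ : ℝ) : ℂ) := by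
  have h := (Complex.ofRealCLM.hasFDerivAt).comp x (innerSL ℝ v).hasFDerivAt
  have h' : HasFDerivAt (fun x : RSpace N => ((inner ℝ v x : ℝ) : ℂ)) _ x := h
  rw [h'.fderiv]
  simp

/-- The commutation relation of the Dunkl operators with coordinate multiplications. -/
lemma dunklOp_inner_mul (hR : IsRootSystem R) (ξ v : RSpace N) {p : RSpace N → ℂ}
    (hp : Differentiable ℝ p) (x : RSpace N) :
    dunklOp R μ ξ (fun x => ((inner ℝ v x : ℝ) : ℂ) * p x) x =
      ((inner ℝ v x : ℝ) : ℂ) * dunklOp R μ ξ p x + ((inner ℝ ξ v : ℝ) : ℂ) * p x +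
        (1 / 2) * ∑ α ∈ R, (μ α : ℂ) * ((inner ℝ α ξ : ℝ) : ℂ) * ((inner ℝ α v : ℝ) : ℂ) *
          p (rootRefl α x) := by
  have hv := differentiable_inner_ofReal v
  have hq : ∀ α ∈ R, diffQuot α (fun x => ((inner ℝ v x : ℝ) : ℂ) * p x) x =
      ((inner ℝ v x : ℝ) : ℂ) * diffQuot α p x + ((inner ℝ α v : ℝ) : ℂ) * p (rootRefl α x) := by
    intro α hα
    have hα2 := hR.norm_sq α hα
    have h1 := diffQuot_mul hα2 hp hv x
    have h2 := inner_mul_diffQuot hα2 p x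
    have h3 : ((inner ℝ v x : ℝ) : ℂ) - ((inner ℝ v (rootRefl α x) : ℝ) : ℂ) =
        ((inner ℝ α x : ℝ) : ℂ) * ((inner ℝ α v : ℝ) : ℂ) := by
      rw [rootRefl_apply hα2, inner_sub_right, inner_smul_right, real_inner_comm α v]
      push_cast
      ring
    have h4 : diffQuot α (fun x : RSpace N => ((inner ℝ v x : ℝ) : ℂ)) x =
        ((inner ℝ α v : ℝ) : ℂ) := by
      unfold diffQuot
      split_ifs with h
      · rw [fderiv_inner_ofReal, hα2, real_inner_comm]; simp
      · rw [h3, mul_div_cancel_left₀]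
        exact_mod_cast h
    -- With p as the first factor, the Leibniz defect contains ⟨v,x⟩ - ⟨v,σ_αx⟩ = ⟨α,x⟩⟨α,v⟩, which
    -- cancels the denominator in the quotient of p.
    simp only [mul_comm _ (p _)]
    rw [h1, h3, h4]
    linear_combination (-((inner ℝ α v : ℝ) : ℂ)) * h2
  unfold dunklOp
  rw [Finset.sum_congr rfl fun α hα => by rw [hq α hα], fderiv_fun_mul (hv x) (hp x)]
  simp only [add_apply, smul_apply, smul_eq_mul,
    fderiv_inner_ofReal, mul_add, Finset.sum_add_distrib, real_inner_comm ξ v]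
  have e1 : ∀ α, (μ α : ℂ) * ((inner ℝ α ξ : ℝ) : ℂ) * (((inner ℝ v x : ℝ) : ℂ) * diffQuot α p x) =
      ((inner ℝ v x : ℝ) : ℂ) * ((μ α : ℂ) * ((inner ℝ α ξ : ℝ) : ℂ) * diffQuot α p x) :=
    fun α => by ring
  have e2 : ∀ α, (μ α : ℂ) * ((inner ℝ α ξ : ℝ) : ℂ) *
      (((inner ℝ α v : ℝ) : ℂ) * p (rootRefl α x)) = (μ α : ℂ) * ((inner ℝ α ξ : ℝ) : ℂ) *
        ((inner ℝ α v : ℝ) : ℂ) * p (rootRefl α x) := fun α => by ring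
  simp only [e1, e2, ← Finset.mul_sum]
  ring

lemma rootRefl_rootRefl_apply {α β : RSpace N} (hα : ‖α‖ ^ 2 = 2) (x : RSpace N) :
    rootRefl (rootRefl β α) (rootRefl β x) = rootRefl β (rootRefl α x) := by
  rw [rootRefl_apply (α := rootRefl β α) (by rw [LinearIsometryEquiv.norm_map, hα]),
    inner_rootRefl_rootRefl, rootRefl_apply hα x, map_sub, map_smul]

/-- The Dunkl operators are equivariant under the reflections. -/
lemma dunklOp_comp_rootRefl (hR : IsRootSystem R) (hμ : IsMultiplicity R μ) {β : RSpace N}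
    (hβ : β ∈ R) (ξ : RSpace N) {p : RSpace N → ℂ} (hp : Differentiable ℝ p) (x : RSpace N) :
    dunklOp R μ ξ (fun x => p (rootRefl β x)) x = dunklOp R μ (rootRefl β ξ) p (rootRefl β x) := by
  have hfd : ∀ v, fderiv ℝ (fun x => p (rootRefl β x)) x v =
      fderiv ℝ p (rootRefl β x) (rootRefl β v) := by
    intro v
    have h := (hp (rootRefl β x)).hasFDerivAt.comp x
      (rootRefl β).toContinuousLinearEquiv.hasFDerivAt
    have h' : HasFDerivAt (fun x => p (rootRefl β x)) _ x := h
    rw [h'.fderiv]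
    rfl
  have hq : ∀ α ∈ R, diffQuot α (fun x => p (rootRefl β x)) x =
      diffQuot (rootRefl β α) p (rootRefl β x) := by
    intro α hα
    unfold diffQuot
    rw [inner_rootRefl_rootRefl, hfd, LinearIsometryEquiv.norm_map,
      rootRefl_rootRefl_apply (hR.norm_sq α hα)]
  unfold dunklOp
  rw [hfd, ← sum_rootRefl hR hβ (fun α => (μ α : ℂ) * ((inner ℝ α (rootRefl β ξ) : ℝ) : ℂ) *
    diffQuot α p (rootRefl β x))]
  congr 2
  refine Finset.sum_congr rfl fun α hα => ?_
  rw [hq α hα, hμ.rootRefl_eq hβ hα, inner_rootRefl_rootRefl]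

/-- Homogeneous complex polynomial functions of degree `n` on `ℝᴺ`. -/
noncomputable def polyFun (N : ℕ) : ℕ → Submodule ℂ (RSpace N → ℂ)
  | 0 => Submodule.span ℂ {fun _ => 1}
  | n + 1 => Submodule.span ℂ
      {f | ∃ v : RSpace N, ∃ p ∈ polyFun N n, f = fun x => ((inner ℝ v x : ℝ) : ℂ) * p x}

lemma inner_mul_mem_polyFun {n : ℕ} (v : RSpace N) {p : RSpace N → ℂ} (hp : p ∈ polyFun N n) :
    (fun x => ((inner ℝ v x : ℝ) : ℂ) * p x) ∈ polyFun N (n + 1) :=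
  Submodule.subset_span ⟨v, p, hp, rfl⟩

lemma mem_polyFun_zero {p : RSpace N → ℂ} (hp : p ∈ polyFun N 0) : ∃ c, p = fun _ => c := by
  obtain ⟨c, rfl⟩ := Submodule.mem_span_singleton.1 hp
  exact ⟨c, by ext; simp⟩

lemma polyFun_add_mem {n : ℕ} {f g : RSpace N → ℂ} (hf : f ∈ polyFun N n) (hg : g ∈ polyFun N n) :
    (fun x => f x + g x) ∈ polyFun N n := add_mem hf hg

lemma polyFun_const_mul_mem {n : ℕ} {f : RSpace N → ℂ} (c : ℂ) (hf : f ∈ polyFun N n) :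
    (fun x => c * f x) ∈ polyFun N n := Submodule.smul_mem _ c hf

lemma polyFun_sum_mem {ι : Type*} (s : Finset ι) {n : ℕ} {f : ι → RSpace N → ℂ}
    (hf : ∀ i ∈ s, f i ∈ polyFun N n) : (fun x => ∑ i ∈ s, f i x) ∈ polyFun N n := by
  have := Submodule.sum_mem _ hf
  convert! this using 1
  ext x
  simp

lemma polyFun_succ_induction {n : ℕ} {C : (RSpace N → ℂ) → Prop}
    (h : ∀ (v : RSpace N), ∀ p ∈ polyFun N n, C fun x => ((inner ℝ v x : ℝ) : ℂ) * p x)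
    (hadd : ∀ f ∈ polyFun N (n + 1), ∀ g ∈ polyFun N (n + 1), C f → C g → C fun x => f x + g x)
    (hmul : ∀ c : ℂ, ∀ f ∈ polyFun N (n + 1), C f → C fun x => c * f x)
    {p : RSpace N → ℂ} (hp : p ∈ polyFun N (n + 1)) : C p := by
  refine Submodule.span_induction (p := fun f _ => C f) ?_ ?_ ?_ ?_ hp
  · rintro _ ⟨v, p, hp, rfl⟩
    exact h v p hp
  · refine (congrArg C (funext fun x => ?_)).mp (h 0 0 (Submodule.zero_mem _))
    simp
  · exact fun f g hf hg h1 h2 => hadd f hf g hg h1 h2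
  · exact fun c f hf h1 => hmul c f hf h1

lemma polyFun_differentiable {n : ℕ} {p : RSpace N → ℂ} (hp : p ∈ polyFun N n) :
    Differentiable ℝ p := by
  induction n generalizing p with
  | zero =>
    obtain ⟨c, rfl⟩ := mem_polyFun_zero hp
    exact differentiable_const c
  | succ n ih =>
    refine polyFun_succ_induction (fun v p hp => ?_) (fun f _ g _ h1 h2 => h1.fun_add h2)
      (fun c f _ h => h.const_mul c) hp
    exact (differentiable_inner_ofReal v).fun_mul (ih hp)

lemma polyFun_comp_rootRefl {n : ℕ} {p : RSpace N → ℂ} (α : RSpace N) (hp : p ∈ polyFun N n) :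
    (fun x => p (rootRefl α x)) ∈ polyFun N n := by
  induction n generalizing p with
  | zero =>
    obtain ⟨c, rfl⟩ := mem_polyFun_zero hp
    exact hp
  | succ n ih =>
    refine polyFun_succ_induction (C := fun p => (fun x => p (rootRefl α x)) ∈ polyFun N (n + 1))
      (fun v p hp => ?_) (fun f _ g _ h1 h2 => polyFun_add_mem h1 h2)
      (fun c f _ h => polyFun_const_mul_mem c h) hp
    have := inner_mul_mem_polyFun (rootRefl α v) (ih hp)
    refine (congrArg (· ∈ polyFun N (n + 1)) (funext fun x => ?_)).mp this
    rw [← inner_rootRefl_rootRefl α (rootRefl α v), rootRefl_involutive]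

lemma dunklOp_polyFun_zero (ξ : RSpace N) {p : RSpace N → ℂ} (hp : p ∈ polyFun N 0) :
    dunklOp R μ ξ p = 0 := by
  obtain ⟨c, rfl⟩ := mem_polyFun_zero hp
  exact funext fun x => dunklOp_const ξ c x

/-- The Dunkl operators lower the degree of homogeneous polynomials by one. -/
lemma dunklOp_mem_polyFun (hR : IsRootSystem R) (ξ : RSpace N) {n : ℕ} {p : RSpace N → ℂ}
    (hp : p ∈ polyFun N (n + 1)) : dunklOp R μ ξ p ∈ polyFun N n := by
  induction n generalizing p with
  | zero =>
    refine polyFun_succ_induction (C := fun p => dunklOp R μ ξ p ∈ polyFun N 0)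
      (fun v p hp => ?_) (fun f hf g hg h1 h2 => ?_) (fun c f hf h => ?_) hp
    · rw [show dunklOp R μ ξ (fun x => ((inner ℝ v x : ℝ) : ℂ) * p x) = _ from
        funext fun x => dunklOp_inner_mul hR ξ v (polyFun_differentiable hp) x]
      -- In the commutation relation the term ⟨v,x⟩T_ξp vanishes for constant p; the other terms are
      -- constants.
      rw [dunklOp_polyFun_zero ξ hp]
      simp only [Pi.zero_apply, mul_zero, zero_add]
      exact polyFun_add_mem (polyFun_const_mul_mem _ hp) (polyFun_const_mul_mem _
        (polyFun_sum_mem _ fun α _ => polyFun_const_mul_mem _ (polyFun_comp_rootRefl α hp)))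
    · rw [show dunklOp R μ ξ (fun x => f x + g x) = _ from funext fun x =>
        dunklOp_add ξ (polyFun_differentiable hf) (polyFun_differentiable hg) x]
      exact polyFun_add_mem h1 h2
    · rw [show dunklOp R μ ξ (fun x => c * f x) = _ from funext fun x =>
        dunklOp_const_mul ξ (polyFun_differentiable hf) c x]
      exact polyFun_const_mul_mem c h
  | succ n ih =>
    refine polyFun_succ_induction (C := fun p => dunklOp R μ ξ p ∈ polyFun N (n + 1))
      (fun v p hp => ?_) (fun f hf g hg h1 h2 => ?_) (fun c f hf h => ?_) hp
    · rw [show dunklOp R μ ξ (fun x => ((inner ℝ v x : ℝ) : ℂ) * p x) = _ from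
        funext fun x => dunklOp_inner_mul hR ξ v (polyFun_differentiable hp) x]
      exact polyFun_add_mem (polyFun_add_mem (inner_mul_mem_polyFun v (ih hp))
        (polyFun_const_mul_mem _ hp)) (polyFun_const_mul_mem _
        (polyFun_sum_mem _ fun α _ => polyFun_const_mul_mem _ (polyFun_comp_rootRefl α hp)))
    · rw [show dunklOp R μ ξ (fun x => f x + g x) = _ from funext fun x =>
        dunklOp_add ξ (polyFun_differentiable hf) (polyFun_differentiable hg) x]
      exact polyFun_add_mem h1 h2
    · rw [show dunklOp R μ ξ (fun x => c * f x) = _ from funext fun x =>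
        dunklOp_const_mul ξ (polyFun_differentiable hf) c x]
      exact polyFun_const_mul_mem c h

lemma differentiable_dunklOp_polyFun (hR : IsRootSystem R) (ξ : RSpace N) {n : ℕ}
    {p : RSpace N → ℂ} (hp : p ∈ polyFun N n) : Differentiable ℝ (dunklOp R μ ξ p) := by
  cases n with
  | zero => rw [dunklOp_polyFun_zero ξ hp]; exact differentiable_const 0
  | succ n => exact polyFun_differentiable (dunklOp_mem_polyFun hR ξ hp)

/-- The Dunkl operators commute on polynomials. -/
lemma dunklOp_comm (hR : IsRootSystem R) (hμ : IsMultiplicity R μ) (ξ η : RSpace N) {n : ℕ}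
    {p : RSpace N → ℂ} (hp : p ∈ polyFun N n) (x : RSpace N) :
    dunklOp R μ ξ (dunklOp R μ η p) x = dunklOp R μ η (dunklOp R μ ξ p) x := by
  induction n generalizing p x with
  | zero =>
    rw [dunklOp_polyFun_zero ξ hp, dunklOp_polyFun_zero η hp]
    exact (dunklOp_const ξ 0 x).trans (dunklOp_const η 0 x).symm
  | succ n ih =>
    refine polyFun_succ_induction (C := fun p => ∀ x, dunklOp R μ ξ (dunklOp R μ η p) x =
      dunklOp R μ η (dunklOp R μ ξ p) x) (fun v p hp => ?_) (fun f hf g hg h1 h2 x => ?_)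
      (fun c f hf h x => ?_) hp x
    · have hd := polyFun_differentiable hp
      -- The commutation relation is used twice, and equivariance rewrites T_ξ(p∘σ_α) as (T_ξp -
      -- ⟨α,ξ⟩T_αp)∘σ_α. Apart from T_ξT_ηp, which the induction handles, the result is symmetric in
      -- ξ and η.
      have key : ∀ (ξ η x : RSpace N),
          dunklOp R μ ξ (dunklOp R μ η (fun x => ((inner ℝ v x : ℝ) : ℂ) * p x)) x =
          ((inner ℝ v x : ℝ) : ℂ) * dunklOp R μ ξ (dunklOp R μ η p) x +
            ((inner ℝ ξ v : ℝ) : ℂ) * dunklOp R μ η p x +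
            ((inner ℝ η v : ℝ) : ℂ) * dunklOp R μ ξ p x +
          (1 / 2) * ∑ α ∈ R, (μ α : ℂ) * ((inner ℝ α v : ℝ) : ℂ) *
            (((inner ℝ α ξ : ℝ) : ℂ) * dunklOp R μ η p (rootRefl α x) +
            ((inner ℝ α η : ℝ) : ℂ) * dunklOp R μ ξ p (rootRefl α x) -
            ((inner ℝ α η : ℝ) : ℂ) * ((inner ℝ α ξ : ℝ) : ℂ) *
              dunklOp R μ α p (rootRefl α x)) := by
        intro ξ η x
        have hdη : Differentiable ℝ (dunklOp R μ η p) := differentiable_dunklOp_polyFun hR η hp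
        have hc : ∀ α, Differentiable ℝ fun x => p (rootRefl α x) := fun α =>
          polyFun_differentiable (polyFun_comp_rootRefl α hp)
        rw [show dunklOp R μ η (fun x => ((inner ℝ v x : ℝ) : ℂ) * p x) = _ from
          funext fun x => dunklOp_inner_mul hR η v hd x]
        have d1 : Differentiable ℝ fun x => ((inner ℝ v x : ℝ) : ℂ) * dunklOp R μ η p x :=
          (differentiable_inner_ofReal v).fun_mul hdη
        have d2 : Differentiable ℝ fun x => ((inner ℝ η v : ℝ) : ℂ) * p x := hd.const_mul _
        have d3 : ∀ α, Differentiable ℝ fun x => (μ α : ℂ) * ((inner ℝ α η : ℝ) : ℂ) *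
            ((inner ℝ α v : ℝ) : ℂ) * p (rootRefl α x) := fun α => (hc α).const_mul _
        have d4 : Differentiable ℝ fun x => ∑ α ∈ R, (μ α : ℂ) * ((inner ℝ α η : ℝ) : ℂ) *
            ((inner ℝ α v : ℝ) : ℂ) * p (rootRefl α x) := Differentiable.fun_sum fun α _ => d3 α
        rw [dunklOp_add ξ (d1.fun_add d2) (d4.const_mul _), dunklOp_add ξ d1 d2,
          dunklOp_inner_mul hR ξ v hdη, dunklOp_const_mul ξ hd, dunklOp_const_mul ξ d4,
          dunklOp_sum R ξ d3]
        have e : ∀ α ∈ R, dunklOp R μ ξ (fun x => (μ α : ℂ) * ((inner ℝ α η : ℝ) : ℂ) *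
            ((inner ℝ α v : ℝ) : ℂ) * p (rootRefl α x)) x =
            (μ α : ℂ) * ((inner ℝ α η : ℝ) : ℂ) * ((inner ℝ α v : ℝ) : ℂ) *
            (dunklOp R μ ξ p (rootRefl α x) - ((inner ℝ α ξ : ℝ) : ℂ) *
              dunklOp R μ α p (rootRefl α x)) := by
          intro α hα
          rw [dunklOp_const_mul ξ (hc α), dunklOp_comp_rootRefl hR hμ hα ξ hd,
            dunklOp_rootRefl_left (hR.norm_sq α hα)]
        rw [Finset.sum_congr rfl e]
        have e2 : ∑ α ∈ R, (μ α : ℂ) * ((inner ℝ α v : ℝ) : ℂ) *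
            (((inner ℝ α ξ : ℝ) : ℂ) * dunklOp R μ η p (rootRefl α x) +
            ((inner ℝ α η : ℝ) : ℂ) * dunklOp R μ ξ p (rootRefl α x) -
            ((inner ℝ α η : ℝ) : ℂ) * ((inner ℝ α ξ : ℝ) : ℂ) *
              dunklOp R μ α p (rootRefl α x)) =
            ∑ α ∈ R, (μ α : ℂ) * ((inner ℝ α ξ : ℝ) : ℂ) * ((inner ℝ α v : ℝ) : ℂ) *
              dunklOp R μ η p (rootRefl α x) +
            ∑ α ∈ R, (μ α : ℂ) * ((inner ℝ α η : ℝ) : ℂ) * ((inner ℝ α v : ℝ) : ℂ) *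
            (dunklOp R μ ξ p (rootRefl α x) - ((inner ℝ α ξ : ℝ) : ℂ) *
              dunklOp R μ α p (rootRefl α x)) := by
          rw [← Finset.sum_add_distrib]
          exact Finset.sum_congr rfl fun α _ => by ring
        rw [e2]
        ring
      intro x
      rw [key, key, ih hp]
      have e : ∀ α, (((inner ℝ α ξ : ℝ) : ℂ) * dunklOp R μ η p (rootRefl α x) +
            ((inner ℝ α η : ℝ) : ℂ) * dunklOp R μ ξ p (rootRefl α x) -
            ((inner ℝ α η : ℝ) : ℂ) * ((inner ℝ α ξ : ℝ) : ℂ) *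
              dunklOp R μ α p (rootRefl α x)) =
            (((inner ℝ α η : ℝ) : ℂ) * dunklOp R μ ξ p (rootRefl α x) +
            ((inner ℝ α ξ : ℝ) : ℂ) * dunklOp R μ η p (rootRefl α x) -
            ((inner ℝ α ξ : ℝ) : ℂ) * ((inner ℝ α η : ℝ) : ℂ) *
              dunklOp R μ α p (rootRefl α x)) := fun α => by ring
      simp only [e]
      ring
    · have hf' := polyFun_differentiable hf
      have hg' := polyFun_differentiable hg
      have k : ∀ ζ, dunklOp R μ ζ (fun x => f x + g x) =
          fun x => dunklOp R μ ζ f x + dunklOp R μ ζ g x := fun ζ =>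
        funext fun x => dunklOp_add ζ hf' hg' x
      rw [k, k, dunklOp_add _ (differentiable_dunklOp_polyFun hR _ hf)
        (differentiable_dunklOp_polyFun hR _ hg), dunklOp_add _
        (differentiable_dunklOp_polyFun hR _ hf) (differentiable_dunklOp_polyFun hR _ hg), h1, h2]
    · have hf' := polyFun_differentiable hf
      have k : ∀ ζ, dunklOp R μ ζ (fun x => c * f x) = fun x => c * dunklOp R μ ζ f x := fun ζ =>
        funext fun x => dunklOp_const_mul ζ hf' c x
      rw [k, k, dunklOp_const_mul _ (differentiable_dunklOp_polyFun hR _ hf),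
        dunklOp_const_mul _ (differentiable_dunklOp_polyFun hR _ hf), h]

/-- Euler's identity for homogeneous functions. -/
lemma fderiv_polyFun_self {n : ℕ} {p : RSpace N → ℂ} (hp : p ∈ polyFun N n) (x : RSpace N) :
    fderiv ℝ p x x = n * p x := by
  induction n generalizing p with
  | zero =>
    obtain ⟨c, rfl⟩ := mem_polyFun_zero hp
    simp
  | succ n ih =>
    refine polyFun_succ_induction (C := fun p => fderiv ℝ p x x = ((n + 1 : ℕ) : ℂ) * p x)
      (fun v p hp => ?_) (fun f hf g hg h1 h2 => ?_) (fun c f hf h => ?_) hp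
    · rw [fderiv_fun_mul (differentiable_inner_ofReal v x) (polyFun_differentiable hp x)]
      simp only [add_apply, smul_apply, smul_eq_mul,
        fderiv_inner_ofReal, ih hp]
      push_cast
      ring
    · rw [fderiv_fun_add (polyFun_differentiable hf x) (polyFun_differentiable hg x),
        add_apply, h1, h2]
      ring
    · rw [fderiv_const_mul (polyFun_differentiable hf x), smul_apply, h,
        smul_eq_mul]
      ring

/-- The Dunkl operator in the radial direction. -/
lemma dunklOp_self (hR : IsRootSystem R) {n : ℕ} {p : RSpace N → ℂ} (hp : p ∈ polyFun N n)
    (x : RSpace N) : dunklOp R μ x p x =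
      n * p x + (1 / 2) * ∑ α ∈ R, (μ α : ℂ) * (p x - p (rootRefl α x)) := by
  rw [dunklOp, fderiv_polyFun_self hp]
  congr 2
  refine Finset.sum_congr rfl fun α hα => ?_
  rw [mul_assoc, inner_mul_diffQuot (hR.norm_sq α hα)]

lemma inner_single (i : Fin N) (x : RSpace N) :
    (inner ℝ (EuclideanSpace.single i (1 : ℝ)) x : ℝ) = x i := by
  simp [EuclideanSpace.inner_single_left]

/-- The Dunkl operators applied to the radial Dunkl derivative of a polynomial. -/
lemma dunklOp_radial (hR : IsRootSystem R) (ξ : RSpace N) {n : ℕ} {p : RSpace N → ℂ}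
    (hp : p ∈ polyFun N n) (x : RSpace N) :
    dunklOp R μ ξ (fun y => dunklOp R μ y p y) x = dunklOp R μ ξ (dunklOp R μ x p) x +
      dunklOp R μ ξ p x + (1 / 2) * ∑ α ∈ R, (μ α : ℂ) * ((inner ℝ α ξ : ℝ) : ℂ) *
        dunklOp R μ α p (rootRefl α x) := by
  have hd : ∀ i, Differentiable ℝ (dunklOp R μ (EuclideanSpace.single i 1) p) := fun i =>
    differentiable_dunklOp_polyFun hR _ hp
  have e1 : (fun y => dunklOp R μ y p y) = fun y => ∑ i, ((inner ℝ (EuclideanSpace.single i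
      (1 : ℝ)) y : ℝ) : ℂ) * dunklOp R μ (EuclideanSpace.single i 1) p y := by
    ext y
    rw [dunklOp_eq_sum]
    simp only [inner_single]
  have e2 : dunklOp R μ x p = fun y => ∑ i, ((x i : ℝ) : ℂ) *
      dunklOp R μ (EuclideanSpace.single i 1) p y := funext fun y => dunklOp_eq_sum x p y
  rw [e1, dunklOp_sum _ _ fun i => (differentiable_inner_ofReal _).fun_mul (hd i), e2,
    dunklOp_sum _ _ fun i => (hd i).const_mul _]
  have hsi : ∀ (v : RSpace N) i, (inner ℝ v (EuclideanSpace.single i (1 : ℝ)) : ℝ) = v i :=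
    fun v i => by rw [real_inner_comm, inner_single]
  simp only [dunklOp_inner_mul hR ξ _ (hd _), dunklOp_const_mul ξ (hd _),
    Finset.sum_add_distrib]
  have e3 : ∑ i, ((inner ℝ ξ (EuclideanSpace.single i (1 : ℝ)) : ℝ) : ℂ) *
      dunklOp R μ (EuclideanSpace.single i 1) p x = dunklOp R μ ξ p x := by
    rw [dunklOp_eq_sum ξ]
    simp only [hsi]
  have e4 : ∑ i, (1 / 2 : ℂ) * ∑ α ∈ R, (μ α : ℂ) * ((inner ℝ α ξ : ℝ) : ℂ) *
      ((inner ℝ α (EuclideanSpace.single i (1 : ℝ)) : ℝ) : ℂ) *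
        dunklOp R μ (EuclideanSpace.single i 1) p (rootRefl α x) =
      (1 / 2) * ∑ α ∈ R, (μ α : ℂ) * ((inner ℝ α ξ : ℝ) : ℂ) *
        dunklOp R μ α p (rootRefl α x) := by
    rw [← Finset.mul_sum, Finset.sum_comm]
    congr 1
    refine Finset.sum_congr rfl fun α _ => ?_
    rw [dunklOp_eq_sum α, Finset.mul_sum]
    refine Finset.sum_congr rfl fun i _ => ?_
    rw [hsi]
    ring
  rw [e3, e4]
  simp only [inner_single]

/-- The induction step for the eigenvalue equations of the homogeneous parts of the Dunkl kernel. -/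
lemma dunklOp_eq_of_radial (hR : IsRootSystem R) (hμ : IsMultiplicity R μ) {n : ℕ}
    {f g g' : RSpace N → ℂ} (hf : f ∈ polyFun N (n + 1)) (hg : g ∈ polyFun N n) {y : RSpace N}
    (hDf : ∀ x, dunklOp R μ x f x = ((inner ℝ y x : ℝ) : ℂ) * g x)
    (hDg : ∀ x, dunklOp R μ x g x = ((inner ℝ y x : ℝ) : ℂ) * g' x)
    (hTg : ∀ ξ x, dunklOp R μ ξ g x = ((inner ℝ ξ y : ℝ) : ℂ) * g' x) (ξ x : RSpace N) :
    dunklOp R μ ξ f x = ((inner ℝ ξ y : ℝ) : ℂ) * g x := by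
  -- The defect in the desired equation. It is homogeneous of degree n in x and linear in ξ.
  set u : RSpace N → RSpace N → ℂ := fun ξ x => dunklOp R μ ξ f x + -((inner ℝ ξ y : ℝ) : ℂ) * g x
    with hu
  have humem : ∀ ξ, u ξ ∈ polyFun N n := fun ξ =>
    polyFun_add_mem (dunklOp_mem_polyFun hR ξ hf) (polyFun_const_mul_mem _ hg)
  have hfd := polyFun_differentiable hf
  have hgd := polyFun_differentiable hg
  have hrefl : ∀ α ∈ R, ∀ ξ x, u (rootRefl α ξ) x = u ξ x - ((inner ℝ α ξ : ℝ) : ℂ) * u α x := by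
    intro α hα ξ x
    simp only [hu]
    rw [dunklOp_rootRefl_left (hR.norm_sq α hα), rootRefl_apply (hR.norm_sq α hα), inner_sub_left,
      inner_smul_left]
    simp
    ring
  -- Compute T_xu_ξ in two ways: by Euler's identity, and by moving T_ξ past T_x and applying it to
  -- the radial equation. Differentiating the direction x gives the extra +1 and reflection terms,
  -- which combine into a simultaneous reflection of x and ξ.
  have hmain : ∀ ξ x, ((n : ℂ) + 1) * u ξ x + (1 / 2) * ∑ α ∈ R, (μ α : ℂ) *
      (u ξ x - u (rootRefl α ξ) (rootRefl α x)) = 0 := by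
    intro ξ x
    have h1 := dunklOp_self (μ := μ) hR (humem ξ) x
    have h2 : dunklOp R μ x (u ξ) x = dunklOp R μ x (dunklOp R μ ξ f) x +
        -((inner ℝ ξ y : ℝ) : ℂ) * dunklOp R μ x g x := by
      simp only [hu]
      rw [dunklOp_add x (differentiable_dunklOp_polyFun hR ξ hf) (hgd.const_mul _),
        dunklOp_const_mul x hgd]
    have h3 := dunklOp_radial (μ := μ) hR ξ hf x
    rw [show (fun y => dunklOp R μ y f y) = _ from funext hDf, dunklOp_inner_mul hR ξ y hgd] at h3
    rw [dunklOp_comm hR hμ x ξ hf] at h2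
    have h4 := hTg ξ x
    have h5 := hDg x
    have e1 : ∑ α ∈ R, (μ α : ℂ) * (u ξ x - u (rootRefl α ξ) (rootRefl α x)) =
        ∑ α ∈ R, (μ α : ℂ) * (u ξ x - u ξ (rootRefl α x)) +
        ∑ α ∈ R, (μ α : ℂ) * ((inner ℝ α ξ : ℝ) : ℂ) * u α (rootRefl α x) := by
      rw [← Finset.sum_add_distrib]
      refine Finset.sum_congr rfl fun α hα => ?_
      rw [hrefl α hα]
      ring
    have e2 : ∑ α ∈ R, (μ α : ℂ) * ((inner ℝ α ξ : ℝ) : ℂ) * u α (rootRefl α x) =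
        ∑ α ∈ R, (μ α : ℂ) * ((inner ℝ α ξ : ℝ) : ℂ) * dunklOp R μ α f (rootRefl α x) -
        ∑ α ∈ R, (μ α : ℂ) * ((inner ℝ α ξ : ℝ) : ℂ) * ((inner ℝ α y : ℝ) : ℂ) *
          g (rootRefl α x) := by
      rw [← Finset.sum_sub_distrib]
      refine Finset.sum_congr rfl fun α hα => ?_
      simp only [hu]
      ring
    have e3 : u ξ x = dunklOp R μ ξ f x + -((inner ℝ ξ y : ℝ) : ℂ) * g x := rfl
    rw [e1, e2, mul_add]
    linear_combination -h1 + h2 - h3 + e3 + ((inner ℝ y x : ℝ) : ℂ) * h4 -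
      ((inner ℝ ξ y : ℝ) : ℂ) * h5
  have hbound : ∃ B, ∀ q ∈ {q : RSpace N × RSpace N | ‖q.1‖ = ‖x‖ ∧ ‖q.2‖ = ‖ξ‖},
      ‖u q.2 q.1‖ ≤ B := by
    have hlin : ∀ ξ x, u ξ x = ∑ i, ((ξ i : ℝ) : ℂ) * u (EuclideanSpace.single i 1) x := by
      intro ξ x
      simp only [hu, mul_add, Finset.sum_add_distrib]
      rw [← dunklOp_eq_sum]
      congr 1
      rw [PiLp.inner_apply]
      simp only [EuclideanSpace.inner_single_left]
      push_cast
      rw [← Finset.sum_neg_distrib, Finset.sum_mul]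
      refine Finset.sum_congr rfl fun i _ => ?_
      simp
      ring
    have hb : ∀ i, ∃ C, ∀ z : RSpace N, ‖z‖ = ‖x‖ → ‖u (EuclideanSpace.single i 1) z‖ ≤ C := by
      intro i
      obtain ⟨C, hC⟩ := (isCompact_closedBall (0 : RSpace N) ‖x‖).exists_bound_of_continuousOn
        (polyFun_differentiable (humem (EuclideanSpace.single i 1))).continuous.continuousOn
      exact ⟨C, fun z hz => hC z (by simp [hz])⟩
    choose C hC using hb
    refine ⟨∑ i, ‖ξ‖ * C i, fun q hq => ?_⟩
    rw [hlin]
    refine (norm_sum_le _ _).trans (Finset.sum_le_sum fun i _ => ?_)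
    rw [norm_mul, Complex.norm_real]
    have h1 : ‖q.2 i‖ ≤ ‖ξ‖ := hq.2 ▸ PiLp.norm_apply_le q.2 i
    exact mul_le_mul h1 (hC i _ hq.1) (norm_nonneg _) (norm_nonneg _)
  obtain ⟨B, hB⟩ := hbound
  -- The maximum principle on pairs (x,ξ) of fixed norms, with right-hand side 0, kills the defect.
  have h0 := norm_le_of_reflection_equation hμ
    (fun α (q : RSpace N × RSpace N) => (rootRefl α q.1, rootRefl α q.2))
    {q : RSpace N × RSpace N | ‖q.1‖ = ‖x‖ ∧ ‖q.2‖ = ‖ξ‖}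
    (fun α _ q hq => by simpa using hq) (fun q => u q.2 q.1) hB (n := n + 1) (by positivity) (C := 0)
    (fun q _ => by
      have := hmain q.2 q.1
      push_cast
      rw [this]
      simp) (x, ξ) ⟨rfl, rfl⟩
  have h1 : u ξ x = 0 := norm_le_zero_iff.1 h0
  simp only [hu] at h1
  linear_combination h1

end Existence

/-! ### Termwise differentiation of series of entire functions -/

/-- A Cauchy estimate for the derivative of an entire function. -/
lemma norm_fderiv_le_of_entire {V : Type*} [NormedAddCommGroup V] [NormedSpace ℂ V] {f : V → ℂ}
    (hf : Differentiable ℂ f) {p : V} {C : ℝ} (hC : ∀ q, ‖q‖ ≤ ‖p‖ + 1 → ‖f q‖ ≤ C) :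
    ‖fderiv ℂ f p‖ ≤ C := by
  have hC0 : 0 ≤ C := (norm_nonneg _).trans (hC p (by linarith))
  refine ContinuousLinearMap.opNorm_le_bound _ hC0 fun v => ?_
  rcases eq_or_ne v 0 with rfl | hv
  · simp
  have hv' : 0 < ‖v‖ := norm_pos_iff.2 hv
  have h := Complex.norm_deriv_le_of_forall_mem_sphere_norm_le (inv_pos.2 hv')
    (differentiable_line hf p v).diffContOnCl (c := 0) (C := C) (fun l hl => hC _ (by
      have hl' : ‖l‖ = ‖v‖⁻¹ := by simpa using hl
      refine (norm_add_le _ _).trans ?_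
      rw [norm_smul, hl', inv_mul_cancel₀ hv'.ne']))
  rw [(hasDerivAt_line hf p v 0).deriv, zero_smul, add_zero, div_inv_eq_mul] at h
  exact h

/-- A locally normally convergent series of entire functions may be differentiated termwise. -/
lemma hasFDerivAt_tsum_of_entire {V : Type*} [NormedAddCommGroup V] [NormedSpace ℂ V]
    {F : ℕ → V → ℂ} (hF : ∀ n, Differentiable ℂ (F n)) {u : ℝ → ℕ → ℝ} (hu : ∀ r, Summable (u r))
    (hb : ∀ r n p, ‖p‖ ≤ r → ‖F n p‖ ≤ u r n) (p : V) :
    Summable (fun n => fderiv ℂ (F n) p) ∧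
      HasFDerivAt (fun q => ∑' n, F n q) (∑' n, fderiv ℂ (F n) p) p := by
  have hs : ∀ q, Summable fun n => F n q := fun q =>
    Summable.of_norm_bounded (hu ‖q‖) fun n => hb _ n q le_rfl
  have hd : ∀ n q, q ∈ Metric.ball p 1 → ‖fderiv ℂ (F n) q‖ ≤ u (‖p‖ + 2) n := by
    intro n q hq
    refine norm_fderiv_le_of_entire (hF n) fun q' hq' => hb _ n q' (hq'.trans ?_)
    have h1 : ‖q - p‖ < 1 := by simpa [dist_eq_norm] using hq
    have h2 := norm_sub_norm_le q p
    linarith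
  have hp : p ∈ Metric.ball p 1 := Metric.mem_ball_self one_pos
  exact ⟨Summable.of_norm_bounded (hu _) fun n => hd n p hp,
    hasFDerivAt_tsum_of_isPreconnected (hu (‖p‖ + 2)) Metric.isOpen_ball
      (convex_ball p 1).isPreconnected (fun n q _ => (hF n q).hasFDerivAt) hd hp (hs p) hp⟩

/-! ### Construction of the Dunkl kernel as a power series -/

section Existence

variable {R : Finset (RSpace N)} {μ : RSpace N → ℝ}

/-- Multiplication by `zᵢ wⱼ` on functions on `ℂᴺ × ℂᴺ`. -/
def mulCoord (i j : Fin N) :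
    (CSpace N → CSpace N → ℂ) →ₗ[ℂ] (CSpace N → CSpace N → ℂ) where
  toFun q z w := z i * w j * q z w
  map_add' p q := by ext; simp [mul_add]
  map_smul' c q := by ext; simp [mul_left_comm]

/-- Polynomial functions on `ℂᴺ × ℂᴺ`, homogeneous of degree `n` in both arguments. -/
noncomputable def biPoly (N : ℕ) : ℕ → Submodule ℂ (CSpace N → CSpace N → ℂ)
  | 0 => Submodule.span ℂ {fun _ _ => 1}
  | n + 1 => ⨆ i, ⨆ j, (biPoly N n).map (mulCoord i j)

instance finiteDimensional_biPoly (n : ℕ) : FiniteDimensional ℂ (biPoly N n) := by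
  induction n with
  | zero => rw [biPoly]; infer_instance
  | succ n ih => rw [biPoly]; infer_instance

lemma mem_biPoly_zero {q : CSpace N → CSpace N → ℂ} (hq : q ∈ biPoly N 0) :
    ∃ c, q = fun _ _ => c := by
  obtain ⟨c, rfl⟩ := Submodule.mem_span_singleton.1 hq
  exact ⟨c, by ext; simp⟩

lemma mulCoord_mem_biPoly {n : ℕ} (i j : Fin N) {q : CSpace N → CSpace N → ℂ}
    (hq : q ∈ biPoly N n) : mulCoord i j q ∈ biPoly N (n + 1) :=
  Submodule.mem_iSup_of_mem i (Submodule.mem_iSup_of_mem j (Submodule.mem_map_of_mem hq))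

lemma biPoly_succ_induction {n : ℕ} {C : (CSpace N → CSpace N → ℂ) → Prop}
    (h : ∀ i j, ∀ q ∈ biPoly N n, C (mulCoord i j q)) (h0 : C 0)
    (hadd : ∀ f g, C f → C g → C (f + g))
    {q : CSpace N → CSpace N → ℂ} (hq : q ∈ biPoly N (n + 1)) : C q := by
  refine Submodule.iSup_induction _ (motive := C) hq (fun i f hf => ?_) h0 hadd
  refine Submodule.iSup_induction _ (motive := C) hf (fun j f hf => ?_) h0 hadd
  obtain ⟨q, hq, rfl⟩ := Submodule.mem_map.1 hf
  exact h i j q hq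

lemma biPoly_differentiable {n : ℕ} {q : CSpace N → CSpace N → ℂ} (hq : q ∈ biPoly N n) :
    Differentiable ℂ fun p : CSpace N × CSpace N => q p.1 p.2 := by
  induction n generalizing q with
  | zero =>
    obtain ⟨c, rfl⟩ := mem_biPoly_zero hq
    exact differentiable_const c
  | succ n ih =>
    refine biPoly_succ_induction
      (C := fun q => Differentiable ℂ fun p : CSpace N × CSpace N => q p.1 p.2)
      (fun i j q hq => ?_) (differentiable_const 0) (fun f g h1 h2 => h1.add h2) hq
    have := ih hq
    simp only [mulCoord, LinearMap.coe_mk, AddHom.coe_mk]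
    fun_prop

lemma biPoly_comp_toC {n : ℕ} {q : CSpace N → CSpace N → ℂ} (hq : q ∈ biPoly N n)
    (w : CSpace N) : (fun x => q (toC x) w) ∈ polyFun N n := by
  induction n generalizing q with
  | zero =>
    obtain ⟨c, rfl⟩ := mem_biPoly_zero hq
    exact Submodule.mem_span_singleton.2 ⟨c, by ext; simp⟩
  | succ n ih =>
    refine biPoly_succ_induction (C := fun q => (fun x => q (toC x) w) ∈ polyFun N (n + 1))
      (fun i j q hq => ?_) (Submodule.zero_mem _) (fun f g h1 h2 => add_mem h1 h2) hq
    have := inner_mul_mem_polyFun (EuclideanSpace.single i 1) (polyFun_const_mul_mem (w j) (ih hq))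
    simpa [mulCoord, inner_single, mul_assoc] using this

/-- Needed because a reflection replaces the coordinate zᵢ by a general linear form. -/
lemma linearMap_mul_mem_biPoly {n : ℕ} (L : CSpace N →ₗ[ℂ] ℂ) (j : Fin N)
    {q : CSpace N → CSpace N → ℂ} (hq : q ∈ biPoly N n) :
    (fun z w => L z * w j * q z w) ∈ biPoly N (n + 1) := by
  have h : (fun z w => L z * w j * q z w) =
      ∑ i, L (EuclideanSpace.single i 1) • mulCoord i j q := by
    ext z w
    have hz : z = ∑ i, z i • EuclideanSpace.single i (1 : ℂ) := by
      ext k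
      simp [Pi.single_apply]
    have hL := congrArg L hz
    simp only [map_sum, map_smul, smul_eq_mul] at hL
    rw [hL]
    simp only [Finset.sum_apply, Pi.smul_apply, mulCoord, LinearMap.coe_mk, AddHom.coe_mk,
      smul_eq_mul, Finset.sum_mul]
    exact Finset.sum_congr rfl fun i _ => by ring
  rw [h]
  exact Submodule.sum_mem _ fun i _ => Submodule.smul_mem _ _ (mulCoord_mem_biPoly i j hq)

lemma bilin_mul_mem_biPoly {n : ℕ} {q : CSpace N → CSpace N → ℂ} (hq : q ∈ biPoly N n) :
    (fun z w => bilin z w * q z w) ∈ biPoly N (n + 1) := by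
  have h : (fun z w => bilin z w * q z w) = ∑ i, mulCoord i i q := by
    ext z w
    simp [bilin_apply, mulCoord, Finset.sum_mul]
  rw [h]
  exact Submodule.sum_mem _ fun i _ => mulCoord_mem_biPoly i i hq

lemma biPoly_comp_reflC {n : ℕ} {q : CSpace N → CSpace N → ℂ} (α : RSpace N)
    (hq : q ∈ biPoly N n) : (fun z w => q (reflC α z) w) ∈ biPoly N n := by
  induction n generalizing q with
  | zero =>
    obtain ⟨c, rfl⟩ := mem_biPoly_zero hq
    exact hq
  | succ n ih =>
    refine biPoly_succ_induction (C := fun q => (fun z w => q (reflC α z) w) ∈ biPoly N (n + 1))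
      (fun i j q hq => ?_) (Submodule.zero_mem _) (fun f g h1 h2 => add_mem h1 h2) hq
    let L : CSpace N →ₗ[ℂ] ℂ :=
      { toFun := fun z => reflC α z i
        map_add' := fun z w => by simp
        map_smul' := fun c z => by simp }
    have h := linearMap_mul_mem_biPoly L j (ih hq)
    exact h

/-- The operator `c + ½ ∑ μ(α) (1 - σ_α)`, the reflections acting on the first argument. -/
noncomputable def radialOp (R : Finset (RSpace N)) (μ : RSpace N → ℝ) (c : ℂ) :
    (CSpace N → CSpace N → ℂ) →ₗ[ℂ] (CSpace N → CSpace N → ℂ) where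
  toFun q z w := c * q z w + (1 / 2) * ∑ α ∈ R, (μ α : ℂ) * (q z w - q (reflC α z) w)
  map_add' p q := by
    ext z w
    simp only [Pi.add_apply, add_sub_add_comm, mul_add, Finset.sum_add_distrib]
    ring
  map_smul' a q := by
    ext z w
    simp only [Pi.smul_apply, smul_eq_mul, RingHom.id_apply, ← mul_sub, mul_left_comm _ a,
      ← Finset.mul_sum, mul_add]

lemma radialOp_mem_biPoly (c : ℂ) {n : ℕ} {q : CSpace N → CSpace N → ℂ} (hq : q ∈ biPoly N n) :
    radialOp R μ c q ∈ biPoly N n := by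
  have h : radialOp R μ c q = c • q + (1 / 2 : ℂ) • ∑ α ∈ R, (μ α : ℂ) •
      (q - fun z w => q (reflC α z) w) := by
    ext z w
    simp [radialOp]
  rw [h]
  exact add_mem (Submodule.smul_mem _ _ hq) (Submodule.smul_mem _ _ (Submodule.sum_mem _
    fun α _ => Submodule.smul_mem _ _ (sub_mem hq (biPoly_comp_reflC α hq))))

lemma norm_le_of_radialOp (hR : IsRootSystem R) (hμ : IsMultiplicity R μ) {n : ℕ}
    {q : CSpace N → CSpace N → ℂ} (hq : q ∈ biPoly N n) {c : ℝ} (hc : 0 < c) (z w : CSpace N)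
    {C : ℝ} (h : ∀ z', ‖z'‖ = ‖z‖ → ‖radialOp R μ c q z' w‖ ≤ c * C) : ‖q z w‖ ≤ C := by
  obtain ⟨B, hB⟩ := (isCompact_closedBall (0 : CSpace N) ‖z‖).exists_bound_of_continuousOn
    (differentiable_left (biPoly_differentiable hq) w).continuous.continuousOn
  exact norm_le_of_reflection_equation hμ (fun α z => reflC α z) {y | ‖y‖ = ‖z‖}
    (fun α hα y hy => (norm_reflC (hR.norm_sq α hα) y).trans hy) (fun z => q z w)
    (fun y hy => hB y (by simpa using (show ‖y‖ = ‖z‖ from hy).le)) hc h z rfl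

/-- Reflections preserve the degree, so the operator acts on a finite-dimensional space. The maximum
principle with right-hand side 0 makes it injective, hence surjective. -/
lemma exists_radialOp_eq (hR : IsRootSystem R) (hμ : IsMultiplicity R μ) {c : ℝ} (hc : 0 < c)
    {n : ℕ} {f : CSpace N → CSpace N → ℂ} (hf : f ∈ biPoly N n) :
    ∃ q ∈ biPoly N n, radialOp R μ c q = f := by
  set T : biPoly N n →ₗ[ℂ] biPoly N n :=
    (radialOp R μ c).restrict fun q hq => radialOp_mem_biPoly (c : ℂ) hq with hT
  have hinj : Function.Injective T := by
    rw [injective_iff_map_eq_zero]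
    intro q hq
    have hq' : radialOp R μ c q.1 = 0 := congrArg Subtype.val hq
    refine Subtype.ext (funext fun z => funext fun w => norm_le_zero_iff.1 ?_)
    exact norm_le_of_radialOp hR hμ q.2 hc z w fun z' _ => by simp [hq']
  obtain ⟨q, hq⟩ := LinearMap.injective_iff_surjective.1 hinj ⟨f, hf⟩
  exact ⟨q.1, q.2, congrArg Subtype.val hq⟩

/-- The homogeneous parts of the Dunkl kernel. -/
lemma exists_kernelTerms (hR : IsRootSystem R) (hμ : IsMultiplicity R μ) :
    ∃ a : ℕ → CSpace N → CSpace N → ℂ, (a 0 = fun _ _ => 1) ∧ (∀ n, a n ∈ biPoly N n) ∧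
      ∀ n z w, radialOp R μ ((n + 1 : ℕ) : ℝ) (a (n + 1)) z w = bilin z w * a n z w := by
  have hstep : ∀ (n : ℕ) (q : CSpace N → CSpace N → ℂ), q ∈ biPoly N n →
      ∃ q' ∈ biPoly N (n + 1), radialOp R μ ((n + 1 : ℕ) : ℝ) q' = fun z w => bilin z w * q z w :=
    fun n q hq => exists_radialOp_eq hR hμ (by positivity) (bilin_mul_mem_biPoly hq)
  choose! next hmem hnext using hstep
  set a : ℕ → CSpace N → CSpace N → ℂ := fun n => Nat.rec (fun _ _ => 1) (fun n q => next n q) n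
  have ha : ∀ n, a n ∈ biPoly N n := by
    intro n
    induction n with
    | zero => exact Submodule.mem_span_singleton_self _
    | succ n ih => exact hmem n _ ih
  exact ⟨a, rfl, ha, fun n z w => congrFun (congrFun (hnext n _ (ha n)) z) w⟩

/-- Each degree costs a factor ‖z‖‖w‖ from the bilinear form and gains 1/(n+1) from the maximum
principle. -/
lemma norm_kernelTerms_le (hR : IsRootSystem R) (hμ : IsMultiplicity R μ)
    {a : ℕ → CSpace N → CSpace N → ℂ} (h0 : a 0 = fun _ _ => 1) (hmem : ∀ n, a n ∈ biPoly N n)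
    (ha : ∀ n z w, radialOp R μ ((n + 1 : ℕ) : ℝ) (a (n + 1)) z w = bilin z w * a n z w) (n : ℕ)
    (z w : CSpace N) : ‖a n z w‖ ≤ (‖z‖ * ‖w‖) ^ n / n.factorial := by
  induction n generalizing z with
  | zero => simp [h0]
  | succ n ih =>
    refine norm_le_of_radialOp hR hμ (hmem (n + 1)) (c := (n + 1 : ℕ)) (by positivity) z w
      fun z' hz' => ?_
    rw [ha, norm_mul]
    refine (mul_le_mul (norm_bilin_le z' w) (ih z') (norm_nonneg _) (by positivity)).trans_eq ?_
    rw [hz', Nat.factorial_succ]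
    push_cast
    field_simp
    ring

/-- By construction the terms satisfy only the equation with ξ = x. `dunklOp_eq_of_radial` upgrades
it to all ξ by induction on the degree, which starts with 0 in place of the term preceding the
constant one. -/
lemma dunklOp_kernelTerms (hR : IsRootSystem R) (hμ : IsMultiplicity R μ)
    {a : ℕ → CSpace N → CSpace N → ℂ} (h0 : a 0 = fun _ _ => 1) (hmem : ∀ n, a n ∈ biPoly N n)
    (ha : ∀ n z w, radialOp R μ ((n + 1 : ℕ) : ℝ) (a (n + 1)) z w = bilin z w * a n z w) (n : ℕ)
    (ξ x y : RSpace N) : dunklOp R μ ξ (fun x => a (n + 1) (toC x) (toC y)) x =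
      ((inner ℝ ξ y : ℝ) : ℂ) * a n (toC x) (toC y) := by
  have hD : ∀ n x, dunklOp R μ x (fun x => a (n + 1) (toC x) (toC y)) x =
      ((inner ℝ y x : ℝ) : ℂ) * a n (toC x) (toC y) := by
    intro n x
    rw [dunklOp_self hR (biPoly_comp_toC (hmem (n + 1)) (toC y)), real_inner_comm, ← bilin_toC,
      ← ha n]
    simp only [radialOp, LinearMap.coe_mk, AddHom.coe_mk]
    congr 2
    refine Finset.sum_congr rfl fun α hα => ?_
    rw [toC_rootRefl (hR.norm_sq α hα)]
  induction n generalizing ξ x with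
  | zero =>
    refine dunklOp_eq_of_radial hR hμ (biPoly_comp_toC (hmem 1) (toC y))
      (biPoly_comp_toC (hmem 0) (toC y)) (g' := fun _ => 0) (hD 0) (fun x => ?_) (fun ξ x => ?_) ξ x
    all_goals rw [h0, dunklOp_const, mul_zero]
  | succ n ih =>
    exact dunklOp_eq_of_radial hR hμ (biPoly_comp_toC (hmem (n + 2)) (toC y))
      (biPoly_comp_toC (hmem (n + 1)) (toC y)) (g' := fun x => a n (toC x) (toC y)) (hD (n + 1))
      (hD n) (fun ξ x => ih ξ x) ξ x

lemma hasSum_dunklOp (hR : IsRootSystem R) {a : ℕ → CSpace N → ℂ} {f : CSpace N → ℂ}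
    (ha : ∀ n, Differentiable ℂ (a n)) (hf : Differentiable ℂ f)
    (hs : ∀ z, HasSum (fun n => a n z) (f z))
    (hd : ∀ z v, HasSum (fun n => fderiv ℂ (a n) z v) (fderiv ℂ f z v)) (ξ x : RSpace N) :
    HasSum (fun n => dunklOp R μ ξ (fun x => a n (toC x)) x)
      (dunklOp R μ ξ (fun x => f (toC x)) x) := by
  unfold dunklOp
  simp only [fderiv_comp_toC hf, fderiv_comp_toC (ha _)]
  refine (hd _ _).add (HasSum.mul_left _ (hasSum_sum fun α hα => HasSum.mul_left _ ?_))
  simp only [diffQuot_comp_toC (hR.norm_sq α hα) hf, diffQuot_comp_toC (hR.norm_sq α hα) (ha _)]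
  split_ifs with h
  · exact hd _ _
  · exact ((hs _).sub (hs _)).div_const _

/-- Existence of the Dunkl kernel. -/
theorem exists_isDunklKernel (hR : IsRootSystem R) (hμ : IsMultiplicity R μ) :
    ∃ E, IsDunklKernel R μ E := by
  obtain ⟨a, h0, hmem, ha⟩ := exists_kernelTerms hR hμ
  have hle := norm_kernelTerms_le hR hμ h0 hmem ha
  set E : CSpace N → CSpace N → ℂ := fun z w => ∑' n, a n z w with hE
  have hdiff := fun n => biPoly_differentiable (hmem n)
  have hsum := hasFDerivAt_tsum_of_entire (u := fun r n => (r * r) ^ n / n.factorial) hdiff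
    (fun r => Real.summable_pow_div_factorial (r * r)) (fun r n p hp => by
      refine (hle n p.1 p.2).trans ?_
      have h1 : ‖p.1‖ ≤ r := (norm_fst_le p).trans hp
      have h2 : ‖p.2‖ ≤ r := (norm_snd_le p).trans hp
      have h3 : 0 ≤ r := (norm_nonneg p).trans hp
      gcongr)
  have hhol : Differentiable ℂ fun p : CSpace N × CSpace N => E p.1 p.2 :=
    fun p => (hsum p).2.differentiableAt
  have hs : ∀ z w, HasSum (fun n => a n z w) (E z w) := fun z w =>
    (Summable.of_norm_bounded (Real.summable_pow_div_factorial (‖z‖ * ‖w‖))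
      fun n => hle n z w).hasSum
  have hnorm : ∀ w, E 0 w = 1 := by
    intro w
    rw [hE]
    dsimp only
    rw [tsum_eq_single 0, h0]
    intro n hn
    have := hle n 0 w
    rw [norm_zero, zero_mul, zero_pow hn, zero_div, norm_le_zero_iff] at this
    exact this
  have heig : ∀ x y ξ : RSpace N, dunklOp R μ ξ (fun x' => E (toC x') (toC y)) x
      = ((inner ℝ ξ y : ℝ) : ℂ) * E (toC x) (toC y) := by
    intro x y ξ
    have h1 := hasSum_dunklOp (μ := μ) hR (a := fun n z => a n z (toC y))
      (fun n => differentiable_left (hdiff n) _) (differentiable_left hhol (toC y))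
      (fun z => hs z _) (fun z v => by
        simp only [fderiv_left_eq hhol, fderiv_left_eq (hdiff _)]
        rw [(hsum (z, toC y)).2.fderiv]
        exact (hsum (z, toC y)).1.hasSum.mapL
          (ContinuousLinearMap.apply ℂ ℂ ((v, 0) : CSpace N × CSpace N))) ξ x
    -- The constant term is annihilated and the others shift down by one degree, so the
    -- differentiated series is ⟨ξ,y⟩ times the original.
    rw [← hasSum_nat_add_iff' 1] at h1
    simp only [dunklOp_kernelTerms hR hμ h0 hmem ha, Finset.sum_range_one, h0, dunklOp_const,
      sub_zero] at h1
    exact h1.unique ((hs _ _).mul_left _)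
  have heuler := isEulerKernel_of_eigen hR hhol heig fun y => hnorm _
  refine ⟨E, hhol, fun x y => ?_, heig, fun y => hnorm _⟩
  have h := heuler.conj_eq hR hμ (toC x) (toC y)
  rw [conjC_toC, conjC_toC] at h
  exact Complex.conj_eq_iff_im.1 h

end Existence

/-! ### Gram matrices and reproducing kernels -/

section HilbertSpace

variable {X K : Type*} [NormedAddCommGroup K] [InnerProductSpace ℂ K]

/-- A family of vectors whose Gram matrix is the kernel of a reproducing kernel Hilbert space
induces a bounded operator to that space. -/
lemma exists_clm_of_gram [CompleteSpace K] {H : Type*} [NormedAddCommGroup H]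
    [InnerProductSpace ℂ H] [CompleteSpace H] [RKHS ℂ H X ℂ] (k : X → K)
    (hk : ∀ x y, inner ℂ (k x) (k y) = RKHS.kernel H x y 1) :
    ∃ A : K →L[ℂ] H, ∀ ψ x, A ψ x = inner ℂ (k x) ψ := by
  set e : (X →₀ ℂ) →ₗ[ℂ] H := Finsupp.linearCombination ℂ fun x => RKHS.kerFun H x (1 : ℂ) with he
  set f : (X →₀ ℂ) →ₗ[ℂ] K := Finsupp.linearCombination ℂ k with hf
  have hgram : ∀ x y, inner ℂ (k x) (k y) =
      inner ℂ (RKHS.kerFun H x (1 : ℂ)) (RKHS.kerFun H y (1 : ℂ)) := by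
    intro x y
    rw [hk, RKHS.kerFun_inner, RKHS.kerFun_apply]
    simp
  have hin : ∀ a, inner ℂ (f a) (f a) = inner ℂ (e a) (e a) := by
    intro a
    simp only [he, hf, Finsupp.linearCombination_apply, Finsupp.sum_inner, Finsupp.inner_sum,
      hgram, inner_smul_left, inner_smul_right]
  have hnorm : ∀ a, ‖f a‖ = ‖e a‖ := by
    intro a
    have h1 := hin a
    rw [inner_self_eq_norm_sq_to_K, inner_self_eq_norm_sq_to_K] at h1
    have h2 : ‖f a‖ ^ 2 = ‖e a‖ ^ 2 := by exact_mod_cast h1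
    exact (sq_eq_sq₀ (norm_nonneg _) (norm_nonneg _)).1 h2
  have hdense : DenseRange e := by
    have h1 : Submodule.span ℂ {y | ∃ x v, RKHS.kerFun H x v = y} ≤ LinearMap.range e := by
      rw [Submodule.span_le]
      rintro _ ⟨x, v, rfl⟩
      refine ⟨Finsupp.single x v, ?_⟩
      rw [he, Finsupp.linearCombination_single, ← map_smul, smul_eq_mul, mul_one]
    have h2 : (LinearMap.range e).topologicalClosure = ⊤ := by
      rw [eq_top_iff, ← RKHS.kerFun_dense H]
      exact Submodule.topologicalClosure_mono h1
    have h3 := Submodule.dense_iff_topologicalClosure_eq_top.2 h2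
    rwa [LinearMap.coe_range] at h3
  have hbd : ∃ C, ∀ a, ‖f a‖ ≤ C * ‖e a‖ := ⟨1, fun a => by rw [one_mul, hnorm]⟩
  -- Equal Gram matrices make e(a) ↦ f(a) isometric on the dense span of the kernel functions. The
  -- adjoint of its extension evaluates at x as the inner product with k(x).
  refine ⟨(f.extendOfNorm e).adjoint, fun ψ x => ?_⟩
  have h1 := RKHS.kerFun_inner (H := H) x (1 : ℂ) ((f.extendOfNorm e).adjoint ψ)
  rw [ContinuousLinearMap.adjoint_inner_right] at h1
  have h2 : f.extendOfNorm e (RKHS.kerFun H x (1 : ℂ)) = k x := by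
    have := LinearMap.extendOfNorm_eq hdense hbd (Finsupp.single x 1)
    simpa [he, hf, Finsupp.linearCombination_single] using this
  rw [h2] at h1
  simpa using h1.symm

/-- Gram matrices are positive semidefinite. -/
lemma posSemidef_gram (k : X → K) : (Matrix.of fun x y =>
    (inner ℂ (k x) (k y) : ℂ) • ContinuousLinearMap.id ℂ ℂ).PosSemidef := by
  have h := (RKHS.posSemidef_tfae (K := Matrix.of fun x y =>
    (inner ℂ (k x) (k y) : ℂ) • ContinuousLinearMap.id ℂ ℂ)).out 0 2
  refine h.2 ⟨?_, fun vv => ?_⟩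
  · ext x y
    have h1 : ContinuousLinearMap.adjoint (ContinuousLinearMap.id ℂ ℂ) = 1 :=
      star_one (ℂ →L[ℂ] ℂ)
    simp [Matrix.conjTranspose_apply, ContinuousLinearMap.star_eq_adjoint, h1]
  · have : (vv.sum fun x w => vv.sum fun x' w' => inner ℂ ((Matrix.of fun x y =>
        (inner ℂ (k x) (k y) : ℂ) • ContinuousLinearMap.id ℂ ℂ) x' x w) w') =
        inner ℂ (vv.sum fun x w => w • k x) (vv.sum fun x w => w • k x) := by
      rw [Finsupp.sum_inner]
      refine Finsupp.sum_congr fun x _ => ?_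
      rw [Finsupp.inner_sum]
      refine Finsupp.sum_congr fun x' _ => ?_
      change inner ℂ ((inner ℂ (k x') (k x) : ℂ) * vv x) (vv x') = _
      rw [inner_smul_left, inner_smul_right, RCLike.inner_apply, map_mul, inner_conj_symm]
      ring
    rw [this]
    exact inner_self_nonneg

end HilbertSpace

/-! ### Scaling relations and the bounded operators -/

section Operators

variable {R : Finset (RSpace N)} {μ : RSpace N → ℝ}

lemma isDunklKernel_dunklKernel (hR : IsRootSystem R) (hμ : IsMultiplicity R μ) :
    IsDunklKernel R μ (dunklKernel R μ) := by
  have h := exists_isDunklKernel hR hμ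
  rw [dunklKernel, dif_pos h]
  exact h.choose_spec

lemma isEulerKernel_dunklKernel (hR : IsRootSystem R) (hμ : IsMultiplicity R μ) :
    IsEulerKernel R μ (dunklKernel R μ) :=
  (isDunklKernel_dunklKernel hR hμ).isEulerKernel hR

lemma weight_nonneg (hR : IsRootSystem R) (hμ : IsMultiplicity R μ) {t : ℝ} (ht : 0 < t)
    (x : RSpace N) : 0 ≤ weight R μ t x := by
  unfold weight weightTilde
  have := mmsConst_pos hR hμ
  have h2 : 0 ≤ ∏ α ∈ R, |(inner ℝ α x : ℝ)| ^ μ α :=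
    Finset.prod_nonneg fun _ _ => Real.rpow_nonneg (abs_nonneg _) _
  positivity

lemma continuous_weight (hμ : IsMultiplicity R μ) (t : ℝ) : Continuous (weight R μ t) := by
  unfold weight weightTilde
  simp only [← regWeight_zero]
  exact continuous_const.mul (continuous_const.mul (continuous_regWeight hμ 0))

/-- The product contributes c^{2γ} and the power of t contributes c^{-2γ-N}; the factor c^N that
restores equality is the Jacobian of the dilation. -/
lemma weight_smul {c s : ℝ} (hc : 0 < c) (hs : 0 < s) (x : RSpace N) :
    weight R μ s x = c ^ N * weight R μ (c ^ 2 * s) (c • x) := by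
  have hp : ∏ α ∈ R, |(inner ℝ α (c • x) : ℝ)| ^ μ α =
      c ^ (2 * gammaConst R μ) * ∏ α ∈ R, |(inner ℝ α x : ℝ)| ^ μ α := by
    have : 2 * gammaConst R μ = ∑ α ∈ R, μ α := by rw [gammaConst]; ring
    rw [this, Real.rpow_sum_of_pos hc, ← Finset.prod_mul_distrib]
    refine Finset.prod_congr rfl fun α _ => ?_
    rw [inner_smul_right, abs_mul, abs_of_pos hc, Real.mul_rpow hc.le (abs_nonneg _)]
  have hq : c ^ N * (c ^ 2) ^ (-(gammaConst R μ + (N : ℝ) / 2)) * c ^ (2 * gammaConst R μ) = 1 := by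
    rw [← Real.rpow_natCast c N, ← Real.rpow_natCast_mul hc.le, ← Real.rpow_add hc,
      ← Real.rpow_add hc]
    convert Real.rpow_zero c using 2
    push_cast
    ring
  unfold weight weightTilde
  rw [hp, Real.mul_rpow (by positivity) hs.le]
  calc (mmsConst R μ)⁻¹ * (s ^ (-(gammaConst R μ + (N : ℝ) / 2)) *
        ∏ α ∈ R, |(inner ℝ α x : ℝ)| ^ μ α)
      = (c ^ N * (c ^ 2) ^ (-(gammaConst R μ + (N : ℝ) / 2)) * c ^ (2 * gammaConst R μ)) *
        ((mmsConst R μ)⁻¹ * (s ^ (-(gammaConst R μ + (N : ℝ) / 2)) *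
          ∏ α ∈ R, |(inner ℝ α x : ℝ)| ^ μ α)) := by rw [hq, one_mul]
    _ = _ := by ring

/-- Dilations are measure preserving between the weighted measures. -/
lemma measurePreserving_smul (hμ : IsMultiplicity R μ) {c s : ℝ} (hc : 0 < c) (hs : 0 < s) :
    MeasurePreserving (fun x : RSpace N => c • x) (weightMeasure R μ s)
      (weightMeasure R μ (c ^ 2 * s)) := by
  have hm : Measurable fun x : RSpace N => c • x := by fun_prop
  refine ⟨hm, Measure.ext fun A hA => ?_⟩
  have hw : ∀ t, Measurable fun x => ENNReal.ofReal (weight R μ t x) := fun t =>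
    (continuous_weight hμ t).measurable.ennreal_ofReal
  rw [Measure.map_apply hm hA, weightMeasure, withDensity_apply _ (hm hA), weightMeasure,
    withDensity_apply _ hA]
  simp only [weight_smul (R := R) (μ := μ) hc hs, ENNReal.ofReal_mul (pow_nonneg hc.le N)]
  rw [lintegral_const_mul _ (f := fun a => ENNReal.ofReal (weight R μ (c ^ 2 * s) (c • a)))
      ((hw _).comp hm),
    ← setLIntegral_map hA (hw (c ^ 2 * s)) hm, Measure.map_addHaar_smul _ hc.ne',
    Measure.restrict_smul, lintegral_smul_measure, smul_eq_mul, ← mul_assoc,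
    ← ENNReal.ofReal_mul (pow_nonneg hc.le N), abs_of_pos (by positivity)]
  simp [hc.ne']

/-- Since c/√(c²s) = 1/√s, the arguments of E do not change, and the exponents are quadratic forms
divided by c²s. -/
lemma kernelA_smul {c s : ℝ} (hc : 0 < c) (hs : 0 < s) (z : CSpace N) (q : RSpace N) :
    kernelA R μ (c ^ 2 * s) ((c : ℂ) • z) (c • q) = kernelA R μ s z q := by
  have hcc : (c : ℂ) ≠ 0 := by exact_mod_cast hc.ne'
  have hsc : (s : ℂ) ≠ 0 := by exact_mod_cast hs.ne'
  have h1 : ((Real.sqrt (c ^ 2 * s) : ℝ) : ℂ)⁻¹ * c = ((Real.sqrt s : ℝ) : ℂ)⁻¹ := by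
    rw [Real.sqrt_mul (by positivity), Real.sqrt_sq hc.le]
    push_cast
    rw [mul_inv, mul_right_comm, inv_mul_cancel₀ hcc, one_mul]
  have h2 : sqC ((c : ℂ) • z) = c ^ 2 * sqC z := by
    simp [sqC, mul_pow, Finset.mul_sum]
  unfold kernelA
  rw [toC_smul, smul_smul, smul_smul, h1, h2, norm_smul, Real.norm_of_nonneg hc.le]
  congr 2
  push_cast
  field_simp

lemma sbKernel_smul {c s : ℝ} (hc : 0 < c) (z w : CSpace N) :
    sbKernel R μ (c ^ 2 * s) ((c : ℂ) • z) ((c : ℂ) • w) = sbKernel R μ s z w := by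
  have hcc : (c : ℂ) ≠ 0 := by exact_mod_cast hc.ne'
  have h1 : ((Real.sqrt (c ^ 2 * s) : ℝ) : ℂ)⁻¹ * c = ((Real.sqrt s : ℝ) : ℂ)⁻¹ := by
    rw [Real.sqrt_mul (by positivity), Real.sqrt_sq hc.le]
    push_cast
    rw [mul_inv, mul_right_comm, inv_mul_cancel₀ hcc, one_mul]
  unfold sbKernel
  rw [conjC_smul, Complex.conj_ofReal, smul_smul, smul_smul, h1]

lemma sqC_eq_bilin (z : CSpace N) : sqC z = bilin z z := by
  simp [sqC, bilin_apply, sq]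

/-- The product of two integral kernels, in terms of the Gaussian weight. -/
lemma kernelA_mul_conj_mul_weight (hR : IsRootSystem R) (hμ : IsMultiplicity R μ)
    (z w : CSpace N) (q : RSpace N) :
    (weight R μ 1 q : ℂ) * (kernelA R μ 1 z q * conj (kernelA R μ 1 w q)) =
      Complex.exp (-(bilin z z + bilin (conjC w) (conjC w)) / 2) * (mmsConst R μ : ℂ)⁻¹ *
        (dunklKernel R μ (toC q) z * dunklKernel R μ (toC q) (conjC w) *
          (gaussWeight R μ 0 q : ℂ)) := by
  have hE := isEulerKernel_dunklKernel hR hμ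
  have e1 : conj (Complex.exp (-bilin w w / 2 - (‖q‖ : ℂ) ^ 2 / 4)) =
      Complex.exp (-bilin (conjC w) (conjC w) / 2 - (‖q‖ : ℂ) ^ 2 / 4) := by
    rw [← Complex.exp_conj, ← conj_bilin]
    simp [Complex.conj_ofNat]
  have e2 : (Real.exp (-‖q‖ ^ 2 / 2) : ℂ) = Complex.exp (-(‖q‖ : ℂ) ^ 2 / 2) := by
    push_cast; rfl
  unfold kernelA
  simp only [Real.sqrt_one, Complex.ofReal_one, inv_one, one_smul, mul_one, map_mul, e1,
    hE.conj_eq hR hμ, conjC_toC, weight, weightTilde_one, gaussWeight, Complex.ofReal_mul,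
    Complex.ofReal_inv, e2, sqC_eq_bilin]
  rw [hE.symm hR hμ z, hE.symm hR hμ (conjC w)]
  have e3 : Complex.exp (-bilin z z / 2 - (‖q‖ : ℂ) ^ 2 / 4) *
      Complex.exp (-bilin (conjC w) (conjC w) / 2 - (‖q‖ : ℂ) ^ 2 / 4) =
      Complex.exp (-(bilin z z + bilin (conjC w) (conjC w)) / 2) *
        Complex.exp (-(‖q‖ : ℂ) ^ 2 / 2) := by
    rw [← Complex.exp_add, ← Complex.exp_add]
    congr 1
    ring
  linear_combination ((mmsConst R μ : ℂ)⁻¹ * (regWeight R μ 0 q : ℂ) *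
    dunklKernel R μ (toC q) z * dunklKernel R μ (toC q) (conjC w)) * e3

lemma integrable_weightMeasure_iff (hR : IsRootSystem R) (hμ : IsMultiplicity R μ) {t : ℝ}
    (ht : 0 < t) (f : RSpace N → ℂ) : Integrable f (weightMeasure R μ t) ↔
      Integrable fun q => (weight R μ t q : ℂ) * f q := by
  rw [weightMeasure, integrable_withDensity_iff_integrable_smul'
    (continuous_weight hμ t).measurable.ennreal_ofReal (by simp)]
  simp only [ENNReal.toReal_ofReal (weight_nonneg hR hμ ht _), Complex.real_smul]

lemma integral_weightMeasure (hR : IsRootSystem R) (hμ : IsMultiplicity R μ) {t : ℝ}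
    (ht : 0 < t) (f : RSpace N → ℂ) : ∫ q, f q ∂(weightMeasure R μ t) =
      ∫ q, (weight R μ t q : ℂ) * f q := by
  rw [weightMeasure, integral_withDensity_eq_integral_toReal_smul
    (continuous_weight hμ t).measurable.ennreal_ofReal (by simp)]
  simp only [ENNReal.toReal_ofReal (weight_nonneg hR hμ ht _), Complex.real_smul]

lemma continuous_kernelA_one (hR : IsRootSystem R) (hμ : IsMultiplicity R μ) (z : CSpace N) :
    Continuous (kernelA R μ 1 z) := by
  have hE := isEulerKernel_dunklKernel hR hμ
  unfold kernelA
  refine Continuous.mul (by fun_prop) ?_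
  have h : Continuous fun q : RSpace N => ((Real.sqrt 1 : ℝ) : ℂ)⁻¹ • toC q :=
    (continuous_const_smul ((Real.sqrt 1 : ℝ) : ℂ)⁻¹).comp continuous_toC
  exact (differentiable_right hE.holomorphic _).continuous.comp h

lemma integrable_kernelA_one (hR : IsRootSystem R) (hμ : IsMultiplicity R μ) (z w : CSpace N) :
    Integrable (fun q => kernelA R μ 1 z q * conj (kernelA R μ 1 w q)) (weightMeasure R μ 1) := by
  rw [integrable_weightMeasure_iff hR hμ one_pos]
  simp only [kernelA_mul_conj_mul_weight hR hμ]
  exact (integrable_pairing hR hμ (isEulerKernel_dunklKernel hR hμ) z (conjC w)).const_mul _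

lemma memLp_kernelA_one (hR : IsRootSystem R) (hμ : IsMultiplicity R μ) (z : CSpace N) :
    MemLp (kernelA R μ 1 z) 2 (weightMeasure R μ 1) := by
  rw [memLp_two_iff_integrable_sq_norm (continuous_kernelA_one hR hμ z).aestronglyMeasurable]
  have := (integrable_kernelA_one hR hμ z z).norm
  refine this.congr (Filter.Eventually.of_forall fun q => ?_)
  simp [sq]

/-- The two factors e^{-q²/4} combine to the Gaussian e^{-q²/2}. The prefactors in z and conj w
cancel the exponential in `gaussPairing_eq`, and the normalization of the weight cancels c_μ. -/
lemma integral_kernelA_one (hR : IsRootSystem R) (hμ : IsMultiplicity R μ) (z w : CSpace N) :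
    ∫ q, kernelA R μ 1 z q * conj (kernelA R μ 1 w q) ∂(weightMeasure R μ 1) =
      dunklKernel R μ (conjC w) z := by
  have hE := isEulerKernel_dunklKernel hR hμ
  have hc : (mmsConst R μ : ℂ) ≠ 0 := by exact_mod_cast (mmsConst_pos hR hμ).ne'
  rw [integral_weightMeasure hR hμ one_pos]
  simp only [kernelA_mul_conj_mul_weight hR hμ]
  rw [integral_const_mul]
  change _ * gaussPairing R μ (dunklKernel R μ) z (conjC w) = _
  rw [gaussPairing_eq hR hμ (isDunklKernel_dunklKernel hR hμ), gaussPairing_zero_zero hR hμ hE,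
    hE.symm hR hμ z]
  have e : Complex.exp (-(bilin z z + bilin (conjC w) (conjC w)) / 2) *
      Complex.exp ((bilin z z + bilin (conjC w) (conjC w)) / 2) = 1 := by
    rw [← Complex.exp_add, neg_div, neg_add_cancel, Complex.exp_zero]
  have e' : (mmsConst R μ : ℂ)⁻¹ * (mmsConst R μ : ℂ) = 1 := inv_mul_cancel₀ hc
  linear_combination (dunklKernel R μ (conjC w) z) * (mmsConst R μ : ℂ)⁻¹ * (mmsConst R μ : ℂ) * e +
    dunklKernel R μ (conjC w) z * e'

lemma kernelA_eq_comp {t : ℝ} (ht : 0 < t) (z : CSpace N) :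
    kernelA R μ t z = kernelA R μ 1 (((Real.sqrt t)⁻¹ : ℂ) • z) ∘
      fun q => (Real.sqrt t)⁻¹ • q := by
  have hs : 0 < (Real.sqrt t)⁻¹ := inv_pos.2 (Real.sqrt_pos.2 ht)
  ext q
  have := kernelA_smul (R := R) (μ := μ) hs ht z q
  rw [inv_pow, Real.sq_sqrt ht.le, inv_mul_cancel₀ ht.ne', Complex.ofReal_inv] at this
  exact this.symm

lemma measurePreserving_sqrt_inv (hμ : IsMultiplicity R μ) {t : ℝ} (ht : 0 < t) :
    MeasurePreserving (fun x : RSpace N => (Real.sqrt t)⁻¹ • x) (weightMeasure R μ t)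
      (weightMeasure R μ 1) := by
  have hs : 0 < (Real.sqrt t)⁻¹ := inv_pos.2 (Real.sqrt_pos.2 ht)
  have := measurePreserving_smul hμ hs ht
  rwa [inv_pow, Real.sq_sqrt ht.le, inv_mul_cancel₀ ht.ne'] at this

lemma memLp_kernelA (hR : IsRootSystem R) (hμ : IsMultiplicity R μ) {t : ℝ} (ht : 0 < t)
    (z : CSpace N) : MemLp (kernelA R μ t z) 2 (weightMeasure R μ t) := by
  rw [kernelA_eq_comp ht]
  exact (memLp_kernelA_one hR hμ _).comp_measurePreserving (measurePreserving_sqrt_inv hμ ht)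

lemma measurableEmbedding_smul {c : ℝ} (hc : 0 < c) :
    MeasurableEmbedding fun x : RSpace N => c • x :=
  (Homeomorph.smulOfNeZero c hc.ne').measurableEmbedding

/-- The integral kernels reproduce the kernel of the Segal-Bargmann space. -/
lemma integral_kernelA (hR : IsRootSystem R) (hμ : IsMultiplicity R μ) {t : ℝ} (ht : 0 < t)
    (z w : CSpace N) :
    ∫ q, kernelA R μ t z q * conj (kernelA R μ t w q) ∂(weightMeasure R μ t) =
      sbKernel R μ t w z := by
  rw [kernelA_eq_comp ht, kernelA_eq_comp ht]
  have h := (measurePreserving_sqrt_inv (R := R) hμ ht).integral_comp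
    (measurableEmbedding_smul (inv_pos.2 (Real.sqrt_pos.2 ht)))
    (fun q => kernelA R μ 1 (((Real.sqrt t)⁻¹ : ℂ) • z) q *
      conj (kernelA R μ 1 (((Real.sqrt t)⁻¹ : ℂ) • w) q))
  simp only [Function.comp_apply]
  rw [h, integral_kernelA_one hR hμ, sbKernel, conjC_smul]
  simp

/-- The vectors of `L²(ω_{μ,t})` representing the point evaluations of the transform. -/
noncomputable def kernelVector (hR : IsRootSystem R) (hμ : IsMultiplicity R μ) {t : ℝ}
    (ht : 0 < t) (z : CSpace N) : L2Weight R μ t :=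
  -- Conjugated, because the inner product is conjugate-linear in its first argument.
  (memLp_kernelA hR hμ ht z).star.toLp _

lemma inner_kernelVector (hR : IsRootSystem R) (hμ : IsMultiplicity R μ) {t : ℝ}
    (ht : 0 < t) (z : CSpace N) (ψ : L2Weight R μ t) :
    inner ℂ (kernelVector hR hμ ht z) ψ = transformA R μ t ψ z := by
  rw [L2.inner_def, transformA]
  refine integral_congr_ae ?_
  filter_upwards [(memLp_kernelA hR hμ ht z).star.coeFn_toLp] with q hq
  rw [kernelVector, hq]
  simp [mul_comm]

lemma inner_kernelVector_kernelVector (hR : IsRootSystem R) (hμ : IsMultiplicity R μ) {t : ℝ}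
    (ht : 0 < t) (z w : CSpace N) :
    inner ℂ (kernelVector hR hμ ht z) (kernelVector hR hμ ht w) = sbKernel R μ t w z := by
  rw [inner_kernelVector, transformA, ← integral_kernelA hR hμ ht]
  refine integral_congr_ae ?_
  filter_upwards [(memLp_kernelA hR hμ ht w).star.coeFn_toLp] with q hq
  rw [kernelVector, hq]
  simp

/-- The kernel is the Gram matrix of the vectors `kernelVector`, hence positive semidefinite, and
the fallback value 0 is never taken. -/
lemma sbMatrixTotal_eq (hR : IsRootSystem R) (hμ : IsMultiplicity R μ) {t : ℝ} (ht : 0 < t) :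
    sbMatrixTotal R μ t = sbMatrix R μ t := by
  have h := posSemidef_gram (kernelVector hR hμ ht)
  simp only [inner_kernelVector_kernelVector] at h
  exact if_pos h

lemma kernel_segalBargmann_apply (hR : IsRootSystem R) (hμ : IsMultiplicity R μ) {t : ℝ}
    (ht : 0 < t) (z w : CSpace N) :
    RKHS.kernel (SegalBargmann R μ t) z w 1 = sbKernel R μ t w z := by
  rw [kernel_segalBargmann, sbMatrixTotal_eq hR hμ ht]
  simp [sbMatrix]

lemma integrable_kernelA_mul (hR : IsRootSystem R) (hμ : IsMultiplicity R μ) {t : ℝ} (ht : 0 < t)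
    (ψ : L2Weight R μ t) (z : CSpace N) :
    Integrable (fun q => kernelA R μ t z q * ψ q) (weightMeasure R μ t) :=
  (memLp_kernelA hR hμ ht z).integrable_mul (Lp.memLp ψ)

/-- The Segal-Bargmann transform is a bounded operator. -/
lemma exists_transformA (hR : IsRootSystem R) (hμ : IsMultiplicity R μ) {t : ℝ} (ht : 0 < t) :
    ∃ A : L2Weight R μ t →L[ℂ] SegalBargmann R μ t, ∀ ψ z, A ψ z = transformA R μ t ψ z := by
  obtain ⟨A, hA⟩ := exists_clm_of_gram (H := SegalBargmann R μ t) (kernelVector hR hμ ht)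
    fun z w => by rw [inner_kernelVector_kernelVector, kernel_segalBargmann_apply hR hμ ht]
  exact ⟨A, fun ψ z => by rw [hA, inner_kernelVector]⟩

/-- Dilations act boundedly between Segal-Bargmann spaces. -/
lemma exists_dilComplex (hR : IsRootSystem R) (hμ : IsMultiplicity R μ) {c s : ℝ} (hc : 0 < c)
    (hs : 0 < s) : ∃ D : SegalBargmann R μ (c ^ 2 * s) →L[ℂ] SegalBargmann R μ s,
      ∀ f z, D f z = f ((c : ℂ) • z) := by
  have ht : 0 < c ^ 2 * s := by positivity
  obtain ⟨D, hD⟩ := exists_clm_of_gram (H := SegalBargmann R μ s)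
    -- The kernel functions at the dilated points: pairing with them evaluates f at cz, and by
    -- scaling their Gram matrix is the kernel with parameter s.
    (fun z : CSpace N => RKHS.kerFun (SegalBargmann R μ (c ^ 2 * s)) ((c : ℂ) • z) (1 : ℂ))
    fun z w => by
      rw [RKHS.kerFun_inner, RKHS.kerFun_apply, kernel_segalBargmann_apply hR hμ ht,
        kernel_segalBargmann_apply hR hμ hs, sbKernel_smul hc]
      simp
  exact ⟨D, fun f z => by rw [hD, RKHS.kerFun_inner]; simp⟩

end Operators

end Dunkl

/-! ### The commuting diagram -/

/-- The four arrows of the diagram are bounded operators between the Hilbert spaces, given by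
the stated formulas (which determine them), and the diagram commutes. -/
theorem mainTheorem5 {N : ℕ} (R : Finset (Dunkl.RSpace N)) (hR : Dunkl.IsRootSystem R)
    (μ : Dunkl.RSpace N → ℝ) (hμ : Dunkl.IsMultiplicity R μ)
    (s t : ℝ) (hs : 0 < s) (ht : 0 < t) :
    ∃ (A_t : Dunkl.L2Weight R μ t →L[ℂ] Dunkl.SegalBargmann R μ t)
      (A_s : Dunkl.L2Weight R μ s →L[ℂ] Dunkl.SegalBargmann R μ s)
      (δ : Dunkl.L2Weight R μ t →L[ℂ] Dunkl.L2Weight R μ s)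
      (D : Dunkl.SegalBargmann R μ t →L[ℂ] Dunkl.SegalBargmann R μ s),
      (∀ (ψ : Dunkl.L2Weight R μ t) (z : Dunkl.CSpace N),
        MeasureTheory.Integrable (fun q => Dunkl.kernelA R μ t z q * ψ q)
          (Dunkl.weightMeasure R μ t) ∧
        A_t ψ z = Dunkl.transformA R μ t ψ z) ∧
      (∀ (ψ : Dunkl.L2Weight R μ s) (z : Dunkl.CSpace N),
        MeasureTheory.Integrable (fun q => Dunkl.kernelA R μ s z q * ψ q)
          (Dunkl.weightMeasure R μ s) ∧
        A_s ψ z = Dunkl.transformA R μ s ψ z) ∧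
      (∀ ψ : Dunkl.L2Weight R μ t,
        (δ ψ : Dunkl.RSpace N → ℂ) =ᵐ[Dunkl.weightMeasure R μ s]
          Dunkl.dilReal (Real.sqrt (t / s)) ψ) ∧
      (∀ f : Dunkl.SegalBargmann R μ t,
        (D f : Dunkl.CSpace N → ℂ) = Dunkl.dilComplex (Real.sqrt (t / s) : ℂ) f) ∧
      D ∘L A_t = A_s ∘L δ := by
  have hc : 0 < Real.sqrt (t / s) := Real.sqrt_pos.2 (div_pos ht hs)
  have hc2 : t = Real.sqrt (t / s) ^ 2 * s := by
    rw [Real.sq_sqrt (div_pos ht hs).le, div_mul_cancel₀ _ hs.ne']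
  -- Only c > 0 and t = c²s matter from here on, so t is eliminated in favour of c.
  generalize Real.sqrt (t / s) = c at hc hc2
  subst hc2
  have hmp := Dunkl.measurePreserving_smul (R := R) hμ hc hs
  obtain ⟨A_t, hA_t⟩ := Dunkl.exists_transformA hR hμ ht
  obtain ⟨A_s, hA_s⟩ := Dunkl.exists_transformA hR hμ hs
  obtain ⟨D, hD⟩ := Dunkl.exists_dilComplex hR hμ hc hs
  have hδ : ∀ ψ : Dunkl.L2Weight R μ (c ^ 2 * s),
      (Lp.compMeasurePreservingₗᵢ ℂ (fun x : Dunkl.RSpace N => c • x) hmp ψ :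
        Dunkl.RSpace N → ℂ) =ᵐ[Dunkl.weightMeasure R μ s] Dunkl.dilReal c ψ := fun ψ =>
    Lp.coeFn_compMeasurePreserving ψ hmp
  refine ⟨A_t, A_s, (Lp.compMeasurePreservingₗᵢ ℂ (fun x : Dunkl.RSpace N => c • x)
    hmp).toContinuousLinearMap, D,
    fun ψ z => ⟨Dunkl.integrable_kernelA_mul hR hμ ht ψ z, hA_t ψ z⟩,
    fun ψ z => ⟨Dunkl.integrable_kernelA_mul hR hμ hs ψ z, hA_s ψ z⟩, hδ,
    fun f => funext fun z => hD f z, ?_⟩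
  -- Elements of the target space are determined by their point values; at z the claim is the
  -- substitution q ↦ cq in the integral.
  refine ContinuousLinearMap.ext fun ψ => RKHS.ext fun z => ?_
  rw [ContinuousLinearMap.comp_apply, ContinuousLinearMap.comp_apply, hD, hA_t, hA_s,
    Dunkl.transformA, Dunkl.transformA, ← hmp.integral_comp (Dunkl.measurableEmbedding_smul hc)]
  refine integral_congr_ae ?_
  filter_upwards [hδ ψ] with x hx
  rw [Dunkl.kernelA_smul hc hs, LinearIsometry.coe_toContinuousLinearMap, hx]
  rfl
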